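/- Let $k\text{-Junta}$ denote the class of Boolean functions $f:\{0,1\}^n\to\{0,1\}$ that depend on at most $k$ coordinates. A distribution-free algorithm has two oracles, for an unknown $f:\{0,1\}^n\to\{0,1\}$ and an unknown probability distribution $\mathcal D$ on $\{0,1\}^n$: a membership query returns $f(x)$ for a string $x$ chosen by the algorithm, and an example query returns a fresh random $x\sim\mathcal D$. There is a single randomized adaptive algorithm (a program of a randomized random access machine with unit-cost addition, truncated subtraction and halving), and there are absolute constants $A,B,a,b$, such that for all integers $n\ge 0$, $k\ge 1$ and every real $\varepsilon>0$ the following holds. The algorithm receives $n$, $k$ and $\varepsilon$ as input, where $\varepsilon$ is given by a rational number $e$ with $\varepsilon/2\le e\le\varepsilon$ (one may take $e=\varepsilon$ when $\varepsilon$ is rational). For every $f$ and every $\mathcal D$: 1. if $f\in k\text{-Junta}$, the algorithm accepts with probability at least $2/3$; 2. if $\Pr_{x\sim\mathcal D}[f(x)\ne g(x)]\ge\varepsilon$ for every $g\in k\text{-Junta}$, the algorithm rejects with probability at least $2/3$; 3. it always halts within $A\,(n+1/\varepsilon+1)^a$ steps; 4. it always makes at most $B\cdot\frac{k}{\varepsilon}\cdot\bigl(\log(2+\frac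 k\varepsilon)\bigr)^{b}$ queries in total, i.e. $\tilde O(k/\varepsilon)$ queries. -/

import Mathlib

namespace JuntaTesting

/-! ## Boolean functions, juntas, distance -/

/-- The Boolean cube `{0,1}^n`. -/
abbrev Cube (n : ℕ) : Type := Fin n → Bool

/-- `f` is a `k`-junta: it depends on at most `k` coordinates. -/
def IsJunta {n : ℕ} (k : ℕ) (f : Cube n → Bool) : Prop :=
  ∃ S : Finset (Fin n), S.card ≤ k ∧ ∀ x y : Cube n, (∀ i ∈ S, x i = y i) → f x = f y

/-- The class of all `k`-juntas on `n` variables. -/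
def kJunta (n k : ℕ) : Set (Cube n → Bool) := {f | IsJunta k f}

/-- `f` is `ε`-far from every function of the class with respect to the distribution `D`:
`Pr_{x ∼ D}[f x ≠ g x] ≥ ε` for every `g` in the class. -/
def FarFrom {n : ℕ} (D : PMF (Cube n)) (ε : ℝ) (f : Cube n → Bool)
    (cls : Set (Cube n → Bool)) : Prop :=
  ∀ g ∈ cls, ENNReal.ofReal ε ≤ D.toOuterMeasure {x | f x ≠ g x}

/-! ## The machine model

A randomized random access machine, programmed in a structured language, with two oracles.
A program uses finitely many arrays of natural numbers (of unbounded length). The arithmetic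
operations are addition, truncated subtraction and halving; there is no multiplication, so every
step lengthens the binary representation of the numbers in memory by at most a constant, and the
number of steps is polynomially related to the running time of a Turing machine. -/

/-- Expressions. `get a i` is the entry of the array with name `a` at index `i`. -/
inductive Expr : Type where
  | lit (c : ℕ) : Expr
  | get (a : ℕ) (i : Expr) : Expr
  | add (e₁ e₂ : Expr) : Expr
  | sub (e₁ e₂ : Expr) : Expr
  | half (e : Expr) : Expr

/-- A memory: `m a i` is the entry of array `a` at index `i`. -/
abbrev Memory : Type := ℕ → ℕ → ℕ

/-- The value of an expression. -/
def Expr.eval (m : Memory) : Expr → ℕ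
  | .lit c => c
  | .get a i => m a (i.eval m)
  | .add e₁ e₂ => e₁.eval m + e₂.eval m
  | .sub e₁ e₂ => e₁.eval m - e₂.eval m
  | .half e => e.eval m / 2

/-- Writing one entry of the memory. -/
def Memory.write (m : Memory) (a i v : ℕ) : Memory :=
  fun a' i' => if a' = a ∧ i' = i then v else m a' i'

/-- The string in `{0,1}^n` held in the entries `0, …, n - 1` of array `a`
(an entry stands for `1` when it is nonzero). -/
def Memory.readString (m : Memory) (n a : ℕ) : Cube n :=
  fun j => decide (m a j ≠ 0)

/-- Writing a string in `{0,1}^n` to the entries `0, …, n - 1` of array `a`. -/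
def Memory.writeString {n : ℕ} (m : Memory) (a : ℕ) (x : Cube n) : Memory :=
  fun a' i' => if h : a' = a ∧ i' < n then (x ⟨i', h.2⟩).toNat else m a' i'

/-- Programs.
* `assign a i e` : `a[i] := e`;
* `coin a i` : `a[i] :=` a fresh uniform random bit;
* `memberQuery a i b` : `a[i] := f x` where `x` is the string in array `b` (a membership query);
* `exampleQuery b` : array `b` receives a fresh `x ∼ D` (an example query);
* `branch e p q` : if `e ≠ 0` then `p` else `q`;
* `loop e p` : while `e ≠ 0` do `p`. -/
inductive Program : Type where
  | skip : Program
  | assign (a : ℕ) (i e : Expr) : Program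
  | coin (a : ℕ) (i : Expr) : Program
  | memberQuery (a : ℕ) (i : Expr) (b : ℕ) : Program
  | exampleQuery (b : ℕ) : Program
  | seq (p q : Program) : Program
  | branch (e : Expr) (p q : Program) : Program
  | loop (e : Expr) (p : Program) : Program

/-- A configuration: the list of programs still to be executed, the memory, and the number of
queries (of both kinds) made so far. -/
structure Config : Type where
  todo : List Program
  mem : Memory
  queries : ℕ

/-- The machine has halted. -/
def Config.Halted (z : Config) : Prop := z.todo = []

/-- The machine has halted with the output "accept": the entry `1[0]` is nonzero. -/
def Config.Accepting (z : Config) : Prop := z.Halted ∧ z.mem 1 0 ≠ 0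

/-- The machine has halted with the output "reject": the entry `1[0]` is zero. -/
def Config.Rejecting (z : Config) : Prop := z.Halted ∧ z.mem 1 0 = 0

/-- One step of the machine, with membership oracle `f` and example oracle `D`. -/
noncomputable def step {n : ℕ} (f : Cube n → Bool) (D : PMF (Cube n)) (z : Config) :
    PMF Config :=
  match z.todo with
  | [] => PMF.pure z
  | .skip :: K => PMF.pure { z with todo := K }
  | .assign a i e :: K =>
      PMF.pure { z with todo := K, mem := z.mem.write a (i.eval z.mem) (e.eval z.mem) }
  | .coin a i :: K =>
      (PMF.uniformOfFintype Bool).map fun r =>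
        { z with todo := K, mem := z.mem.write a (i.eval z.mem) r.toNat }
  | .memberQuery a i b :: K =>
      PMF.pure
        { todo := K
          mem := z.mem.write a (i.eval z.mem) (f (z.mem.readString n b)).toNat
          queries := z.queries + 1 }
  | .exampleQuery b :: K =>
      D.map fun x =>
        { todo := K
          mem := z.mem.writeString b x
          queries := z.queries + 1 }
  | .seq p q :: K => PMF.pure { z with todo := p :: q :: K }
  | .branch e p q :: K =>
      PMF.pure { z with todo := (if e.eval z.mem ≠ 0 then p else q) :: K }
  | .loop e p :: K =>
      PMF.pure { z with todo := if e.eval z.mem ≠ 0 then p :: .loop e p :: K else K }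

/-- The distribution of the configuration after `t` steps. -/
noncomputable def run {n : ℕ} (f : Cube n → Bool) (D : PMF (Cube n)) :
    ℕ → Config → PMF Config
  | 0, z => PMF.pure z
  | t + 1, z => (step f D z).bind (run f D t)

/-- The input of the machine: the entries `0[0], 0[1], 0[2], 0[3]` hold `n`, `k` and the numerator
and denominator of the (positive, rational) distance parameter; everything else is zero. -/
def inputMemory (n k : ℕ) (e : ℚ) : Memory := fun a i =>
  if a = 0 then
    match i with
    | 0 => n
    | 1 => k
    | 2 => e.num.toNat
    | 3 => e.den
    | _ => 0
  else 0

/-- The initial configuration of the program `P`. -/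
def initConfig (P : Program) (n k : ℕ) (e : ℚ) : Config where
  todo := [P]
  mem := inputMemory n k e
  queries := 0

/-! ## Testers and their complexity -/

/-- On input `(n, k, e)`, with any oracles and any outcome of the random choices, `P` halts after
at most `T` steps. -/
def HaltsWithin (P : Program) (n k : ℕ) (e : ℚ) (T : ℕ) : Prop :=
  ∀ (f : Cube n → Bool) (D : PMF (Cube n)),
    ∀ z ∈ (run f D T (initConfig P n k e)).support, z.Halted

/-- On input `(n, k, e)`, with any oracles and any outcome of the random choices, `P` makes at most
`Q` membership and example queries in total. -/
def QueriesAtMost (P : Program) (n k : ℕ) (e : ℚ) (Q : ℝ) : Prop :=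
  ∀ (f : Cube n → Bool) (D : PMF (Cube n)) (t : ℕ),
    ∀ z ∈ (run f D t (initConfig P n k e)).support, (z.queries : ℝ) ≤ Q

/-- The probability that `P` halts and accepts. -/
noncomputable def acceptProb {n : ℕ} (P : Program) (k : ℕ) (e : ℚ) (f : Cube n → Bool)
    (D : PMF (Cube n)) : ENNReal :=
  ⨆ t : ℕ, (run f D t (initConfig P n k e)).toOuterMeasure {z | z.Accepting}

/-- The probability that `P` halts and rejects. -/
noncomputable def rejectProb {n : ℕ} (P : Program) (k : ℕ) (e : ℚ) (f : Cube n → Bool)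
    (D : PMF (Cube n)) : ENNReal :=
  ⨆ t : ℕ, (run f D t (initConfig P n k e)).toOuterMeasure {z | z.Rejecting}

/-- On input `(n, k, e)`, `P` is a (two-sided, distribution-free) `ε`-tester for the class of
`k`-juntas on `n` variables. -/
def IsJuntaTester (P : Program) (n k : ℕ) (e : ℚ) (ε : ℝ) : Prop :=
  ∀ (f : Cube n → Bool) (D : PMF (Cube n)),
    (f ∈ kJunta n k → 2 / 3 ≤ acceptProb P k e f D) ∧
    (FarFrom D ε f (kJunta n k) → 2 / 3 ≤ rejectProb P k e f D)

end JuntaTesting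

/-! The tester hides the coordinates behind random labels. Each coordinate receives a random label
of `L = 2t` bits, where `2^t ≥ 16(k+1)`; with good probability no two relevant coordinates of a
`k`-junta share a label. A block is a set of coordinates with a common label.

Search. Samples `u ∼ D` are compared with `restr own u`, in which everything outside the known
blocks is zero. If `f` tells the two apart, a binary search over the threshold label finds two
consecutive hybrids on which `f` differs; these differ only in unowned coordinates of one label,
which become a new block, together with a string witnessing its relevance. The search stops growing
after `k + 1` blocks, or after a whole stage of `M` failed attempts. In the latter case `f u = f
(restr own u)` except with small `D`-probability (`pr_search_le`). The cost of a binary search is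
`L`, so `n` does not enter the query count.

Verification. If `f` is a `k`-junta with distinctly labelled relevant coordinates, every block
contains exactly one of them, and `f` restricted to the block (`probe`) is a dictator up to
negation. Each block is therefore tested for this. For `g = probe f b ℓ` and a random base point
`r`, the derivative `u ↦ g r ^^ g (r + u)` has to respect sum, meet and top. If these tests seldom
fail, the majority value `G u` of the derivative is exactly a homomorphism of Boolean algebras
(`exists_hom`), hence a coordinate `τ` (`exists_coordinate`). Evaluating the derivative at a sample
`u` reveals `u τ` without identifying `τ`. Filling every block with the value so obtained gives a
string depending on at most `k` bits of `u`, on which `f` must agree with `f (restr own u)`.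

Soundness (`process_sound`) holds for each fixed labelling. After a successful search with at most
`k` blocks, either some block fails its test often, or `u ↦ f (fill u)` is a `k`-junta. In the
second case farness forces `f (fill u)` to differ from `f (restr own u)` with probability at least
`1/(2N)`, where `1/N ≤ ε`, and each sample catches this with probability at least `1/(4N)`
(`pr_sampleStep_le`). Completeness (`process_complete`) can fail only through a collision of labels.

The probabilistic argument concerns the abstract process `process`. The transfer to the machine uses
`Impl`: a program realizes a distribution on abstract states, with worst-case bounds on steps and
queries, in front of an arbitrary continuation. `impl_coreProg` realizes the process and
`guarantees_of_impl` reads off the required guarantees. The inputs `n ≤ k` and `e > 1`, for which no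
function is far, are accepted at once, so the running time need not depend on `k`. -/

namespace JuntaTesting

open scoped ENNReal

/-! ## Expectations over discrete distributions -/

/-- The expectation of `p` under `μ`. -/
noncomputable def ex {β : Type} (μ : PMF β) (p : β → ℝ≥0∞) : ℝ≥0∞ := ∑' b, μ b * p b

section Expectation

variable {β γ : Type}

theorem ex_pure (b : β) (p : β → ℝ≥0∞) : ex (PMF.pure b) p = p b := by
  classical
  unfold ex
  rw [tsum_eq_single b]
  · simp
  · intro b' hb'; simp [hb']

theorem ex_bind (μ : PMF β) (κ : β → PMF γ) (p : γ → ℝ≥0∞) :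
    ex (μ.bind κ) p = ex μ fun b => ex (κ b) p := by
  unfold ex
  simp only [PMF.bind_apply, ← ENNReal.tsum_mul_right, ← ENNReal.tsum_mul_left]
  rw [ENNReal.tsum_comm]
  simp only [mul_assoc]

theorem ex_map (μ : PMF β) (g : β → γ) (p : γ → ℝ≥0∞) :
    ex (μ.map g) p = ex μ fun b => p (g b) := by
  unfold PMF.map
  rw [ex_bind]
  simp [ex_pure]

theorem ex_mono_support {μ : PMF β} {p q : β → ℝ≥0∞} (h : ∀ b ∈ μ.support, p b ≤ q b) :
    ex μ p ≤ ex μ q := by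
  unfold ex
  refine ENNReal.tsum_le_tsum fun b => ?_
  by_cases hb : b ∈ μ.support
  · gcongr; exact h b hb
  · rw [PMF.mem_support_iff, not_not] at hb
    simp [hb]

theorem ex_mono {μ : PMF β} {p q : β → ℝ≥0∞} (h : ∀ b, p b ≤ q b) : ex μ p ≤ ex μ q :=
  ex_mono_support fun b _ => h b

theorem ex_const (μ : PMF β) (c : ℝ≥0∞) : (ex μ fun _ => c) = c := by
  unfold ex
  rw [ENNReal.tsum_mul_right, μ.tsum_coe, one_mul]

theorem ex_add (μ : PMF β) (p q : β → ℝ≥0∞) :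
    (ex μ fun b => p b + q b) = ex μ p + ex μ q := by
  unfold ex
  simp only [mul_add]
  exact ENNReal.tsum_add

theorem ex_mul_right (μ : PMF β) (p : β → ℝ≥0∞) (c : ℝ≥0∞) :
    (ex μ fun b => p b * c) = ex μ p * c := by
  unfold ex
  simp only [← mul_assoc]
  exact ENNReal.tsum_mul_right

theorem ex_mul_left (μ : PMF β) (p : β → ℝ≥0∞) (c : ℝ≥0∞) :
    (ex μ fun b => c * p b) = c * ex μ p := by
  simp only [mul_comm c]
  exact ex_mul_right μ p c

open Classical in
/-- The indicator of a proposition. -/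
noncomputable def ind (p : Prop) : ℝ≥0∞ := if p then 1 else 0

theorem ind_le_one (p : Prop) : ind p ≤ 1 := by
  unfold ind; split_ifs <;> simp

/-- The probability of an event. -/
noncomputable def pr (μ : PMF β) (A : β → Prop) : ℝ≥0∞ := ex μ fun b => ind (A b)

theorem pr_eq_toOuterMeasure (μ : PMF β) (A : β → Prop) :
    pr μ A = μ.toOuterMeasure {b | A b} := by
  classical
  rw [PMF.toOuterMeasure_apply]
  unfold pr ex
  refine tsum_congr fun b => ?_
  by_cases h : A b <;> simp [Set.indicator, ind, h]

theorem pr_mono_support {μ : PMF β} {A B : β → Prop} (h : ∀ b ∈ μ.support, A b → B b) :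
    pr μ A ≤ pr μ B := by
  classical
  refine ex_mono_support fun b hb => ?_
  by_cases hA : A b
  · simp [ind, hA, h b hb hA]
  · simp [ind, hA]

theorem pr_mono {μ : PMF β} {A B : β → Prop} (h : ∀ b, A b → B b) : pr μ A ≤ pr μ B :=
  pr_mono_support fun b _ => h b

theorem pr_or_le (μ : PMF β) (A B : β → Prop) :
    pr μ (fun b => A b ∨ B b) ≤ pr μ A + pr μ B := by
  classical
  unfold pr
  rw [← ex_add]
  refine ex_mono fun b => ?_
  by_cases hA : A b <;> by_cases hB : B b <;> simp [ind, hA, hB]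

theorem pr_le_one (μ : PMF β) (A : β → Prop) : pr μ A ≤ 1 := by
  classical
  calc pr μ A ≤ ex μ fun _ => 1 := ex_mono fun b => ind_le_one _
    _ = 1 := ex_const μ 1

theorem pr_add_pr_not (μ : PMF β) (A : β → Prop) : pr μ A + pr μ (fun b => ¬ A b) = 1 := by
  classical
  unfold pr
  rw [← ex_add]
  refine Eq.trans ?_ (ex_const μ 1)
  congr 1
  funext b
  by_cases hA : A b <;> simp [ind, hA]

theorem pr_bind (μ : PMF β) (κ : β → PMF γ) (A : γ → Prop) :
    pr (μ.bind κ) A = ex μ fun b => pr (κ b) A := ex_bind _ _ _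

theorem pr_map (μ : PMF β) (g : β → γ) (A : γ → Prop) :
    pr (μ.map g) A = pr μ fun b => A (g b) := ex_map _ _ _

theorem pr_pure (b : β) (A : β → Prop) : pr (PMF.pure b) A = ind (A b) :=
  ex_pure _ _

theorem pr_eq_zero {μ : PMF β} {A : β → Prop} (h : ∀ b ∈ μ.support, ¬ A b) : pr μ A = 0 := by
  refine le_antisymm ?_ bot_le
  calc pr μ A ≤ ex μ fun _ => 0 := ex_mono_support fun b hb => by simp [ind, h b hb]
    _ = 0 := ex_const μ 0

theorem pr_eq_one {μ : PMF β} {A : β → Prop} (h : ∀ b ∈ μ.support, A b) : pr μ A = 1 := by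
  rw [← pr_add_pr_not μ A, pr_eq_zero (A := fun b => ¬ A b) fun b hb => not_not.2 (h b hb),
    add_zero]

/-- An event that is needed for another one to have a large expectation. -/
theorem ex_le_pr_add {μ : PMF β} {A : β → Prop} {p : β → ℝ≥0∞} {c : ℝ≥0∞} (hp : ∀ b, p b ≤ 1)
    (h : ∀ b ∈ μ.support, ¬ A b → p b ≤ c) : ex μ p ≤ pr μ A + c := by
  classical
  calc ex μ p ≤ ex μ fun b => ind (A b) + c := by
        refine ex_mono_support fun b hb => ?_
        by_cases hA : A b
        · simpa [ind, hA] using le_add_right (hp b)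
        · simpa [ind, hA] using h b hb hA
    _ = _ := by rw [ex_add, ex_const]; rfl

end Expectation

/-! ## Iteration -/

/-- Apply `F j`, `F (j + 1)`, …, `F (j + N - 1)` one after the other. -/
noncomputable def iter {σ : Type} (F : ℕ → σ → PMF σ) : ℕ → ℕ → σ → PMF σ
  | _, 0, s => PMF.pure s
  | j, N + 1, s => (F j s).bind (iter F (j + 1) N)

section Iteration

variable {σ : Type} {F : ℕ → σ → PMF σ}

/-- Supermartingale argument: a potential that does not grow in expectation in any round does not
grow over the whole iteration. -/
theorem ex_iter_le {Φ : ℕ → σ → ℝ≥0∞} (h : ∀ j s, ex (F j s) (Φ (j + 1)) ≤ Φ j s) (N : ℕ) :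
    ∀ j s, ex (iter F j N s) (Φ (j + N)) ≤ Φ j s := by
  induction N with
  | zero => intro j s; simp [iter, ex_pure]
  | succ N ih =>
    intro j s
    rw [iter, ex_bind]
    refine (ex_mono fun b => ?_).trans (h j s)
    have := ih (j + 1) b
    rwa [show j + 1 + N = j + (N + 1) by ring] at this

theorem iter_support {I : ℕ → σ → Prop}
    {j N : ℕ} (h : ∀ i s, i < j + N → I i s → ∀ s' ∈ (F i s).support, I (i + 1) s') {s : σ}
    (hs : I j s) : ∀ s' ∈ (iter F j N s).support, I (j + N) s' := by
  induction N generalizing j s with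
  | zero => intro s' hs'; simp [iter] at hs'; subst hs'; exact hs
  | succ N ih =>
    intro s' hs'
    rw [iter, PMF.mem_support_bind_iff] at hs'
    obtain ⟨b, hb, hs'⟩ := hs'
    have := ih (j := j + 1) (fun i s hi => h i s (by omega)) (h j s (by omega) hs b hb) s' hs'
    rwa [show j + 1 + N = j + (N + 1) by ring] at this

/-- The union bound along an iteration. -/
theorem pr_iter_le {I : ℕ → σ → Prop} {δ : ℕ → ℝ≥0∞}
    (h : ∀ j s, I j s → pr (F j s) (fun s' => ¬ I (j + 1) s') ≤ δ j) (N : ℕ) :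
    ∀ j s, I j s →
      pr (iter F j N s) (fun s' => ¬ I (j + N) s') ≤ ∑ i ∈ Finset.range N, δ (j + i) := by
  classical
  induction N with
  | zero => intro j s hs; simp [iter, pr_pure, ind, hs]
  | succ N ih =>
    intro j s hs
    rw [iter, pr_bind]
    have key : (ex (F j s) fun b => pr (iter F (j + 1) N b) fun s' => ¬ I (j + (N + 1)) s') ≤
        pr (F j s) (fun s' => ¬ I (j + 1) s') + ∑ i ∈ Finset.range N, δ (j + 1 + i) := by
      refine ex_le_pr_add (fun b => pr_le_one _ _) fun b _ hb => ?_
      have := ih (j + 1) b (not_not.1 hb)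
      rwa [show j + 1 + N = j + (N + 1) by ring] at this
    refine key.trans ?_
    rw [Finset.sum_range_succ', add_comm]
    have e : ∀ i, j + 1 + i = j + (i + 1) := fun i => by ring
    simp only [e, add_zero]
    gcongr
    exact h j s hs

/-- An event that survives every round with probability at most `c`. -/
theorem pr_iter_le_pow {A : σ → Prop} {c : ℝ≥0∞}
    (h : ∀ j s, A s → pr (F j s) A ≤ c)
    (h' : ∀ j s, ¬ A s → ∀ s' ∈ (F j s).support, ¬ A s') (N : ℕ) :
    ∀ j s, pr (iter F j N s) A ≤ c ^ N := by
  classical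
  induction N with
  | zero => intro j s; simpa using pr_le_one _ _
  | succ N ih =>
    intro j s
    by_cases hs : A s
    · rw [iter, pr_bind]
      calc (ex (F j s) fun b => pr (iter F (j + 1) N b) A)
          ≤ ex (F j s) fun b => ind (A b) * c ^ N := by
            refine ex_mono fun b => ?_
            by_cases hb : A b
            · simpa [ind, hb] using ih (j + 1) b
            · simp only [ind, hb, if_false, zero_mul, nonpos_iff_eq_zero]
              exact pr_eq_zero fun s' hs' => iter_support (I := fun _ s => ¬ A s)
                (fun i s _ => h' i s) hb s' hs'
        _ = pr (F j s) A * c ^ N := ex_mul_right _ _ _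
        _ ≤ c * c ^ N := by gcongr; exact h j s hs
        _ = c ^ (N + 1) := by ring
    · rw [pr_eq_zero (fun s' hs' => iter_support (I := fun _ s => ¬ A s)
                (fun i s _ => h' i s) hs s' hs')]
      exact bot_le

end Iteration

/-! ## Verification of programs -/

section Programs

variable {n : ℕ} (f : Cube n → Bool) (D : PMF (Cube n)) (S : Set Config)

theorem run_halted {z : Config} (hz : z.Halted) (t : ℕ) : run f D t z = PMF.pure z := by
  have hs : step f D z = PMF.pure z := by
    unfold Config.Halted at hz
    unfold step
    rw [hz]
  induction t with
  | zero => rfl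
  | succ t ih => rw [run, hs, PMF.pure_bind, ih]

theorem run_add (t s : ℕ) (z : Config) : run f D (t + s) z = (run f D t z).bind (run f D s) := by
  induction t generalizing z with
  | zero => simp [run]
  | succ t ih =>
    rw [show t + 1 + s = (t + s) + 1 by ring, run, run, PMF.bind_bind]
    congr 1
    funext z'
    exact ih z'

/-- From the configuration `z`, the machine surely halts within `T` steps, makes at most `Q` more
queries, and ends in `S` with probability at least `p`. -/
structure Good (z : Config) (T Q : ℕ) (p : ℝ≥0∞) : Prop where
  halts : ∀ z' ∈ (run f D T z).support, z'.Halted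
  queries : ∀ t, ∀ z' ∈ (run f D t z).support, z'.queries ≤ z.queries + Q
  prob : p ≤ pr (run f D T z) fun z' => z' ∈ S

variable {f D S}

/-- All runs have halted by time `T` and halted configurations are fixed, so the distribution at any
later time is the same. -/
theorem Good.mono {z : Config} {T T' Q Q' : ℕ} {p p' : ℝ≥0∞} (h : Good f D S z T Q p)
    (hT : T ≤ T') (hQ : Q ≤ Q') (hp : p' ≤ p) : Good f D S z T' Q' p' := by
  have e : run f D T' z = run f D T z := by
    obtain ⟨s, rfl⟩ := Nat.exists_eq_add_of_le hT
    rw [run_add]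
    conv_rhs => rw [← PMF.bind_pure (run f D T z)]
    ext z''
    simp only [PMF.bind_apply]
    refine tsum_congr fun z' => ?_
    by_cases hz' : z' ∈ (run f D T z).support
    · rw [run_halted f D (h.halts z' hz')]
    · rw [PMF.mem_support_iff, not_not] at hz'
      simp [hz']
  exact ⟨by rw [e]; exact h.halts, fun t z' hz' => (h.queries t z' hz').trans (by omega),
    by rw [e]; exact hp.trans h.prob⟩

theorem Good.of_step {z : Config} {T Q q : ℕ} {p : Config → ℝ≥0∞}
    (h : ∀ z' ∈ (step f D z).support, z'.queries ≤ z.queries + q ∧ Good f D S z' T Q (p z')) :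
    Good f D S z (T + 1) (q + Q) (ex (step f D z) p) := by
  refine ⟨fun z'' hz'' => ?_, fun t z'' hz'' => ?_, ?_⟩
  · rw [run, PMF.mem_support_bind_iff] at hz''
    obtain ⟨z', hz', hz''⟩ := hz''
    exact (h z' hz').2.halts z'' hz''
  · cases t with
    | zero => simp [run] at hz''; subst hz''; omega
    | succ t =>
      rw [run, PMF.mem_support_bind_iff] at hz''
      obtain ⟨z', hz', hz''⟩ := hz''
      have h1 := (h z' hz').2.queries t z'' hz''
      have h2 := (h z' hz').1
      omega
  · rw [run, pr_bind]
    exact ex_mono_support fun z' hz' => (h z' hz').2.prob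

variable (f D S)

/-- Started in the memory `m`, the program `P` surely ends within `T` steps, makes at most `Q`
queries, and leaves a memory that represents, in the sense of `R`, a random element of
distribution `μ`. -/
def Impl {β : Type} (P : Program) (m : Memory) (T Q : ℕ) (μ : PMF β) (R : β → Memory → Prop) :
    Prop :=
  ∀ (K : List Program) (q T' Q' : ℕ) (p : β → ℝ≥0∞),
    (∀ b ∈ μ.support, ∀ m', R b m' → ∀ q', Good f D S ⟨K, m', q'⟩ T' Q' (p b)) →
    Good f D S ⟨P :: K, m, q⟩ (T + T') (Q + Q') (ex μ p)

variable {f D S}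
variable {β γ : Type} {P P' : Program} {m : Memory} {T T₁ T₂ Q Q₁ Q₂ : ℕ} {μ : PMF β}
  {R : β → Memory → Prop}

theorem Impl.mono {R' : β → Memory → Prop} (h : Impl f D S P m T₁ Q₁ μ R) (hT : T₁ ≤ T₂)
    (hQ : Q₁ ≤ Q₂) (hR : ∀ b ∈ μ.support, ∀ m', R b m' → R' b m') :
    Impl f D S P m T₂ Q₂ μ R' := by
  intro K q T' Q' p hK
  exact (h K q T' Q' p fun b hb m' hm' => hK b hb m' (hR b hb m' hm')).mono (by omega) (by omega)
    le_rfl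

theorem Impl.map {R' : γ → Memory → Prop} (g : β → γ) (h : Impl f D S P m T Q μ R)
    (hR : ∀ b ∈ μ.support, ∀ m', R b m' → R' (g b) m') : Impl f D S P m T Q (μ.map g) R' := by
  intro K q T' Q' p hK
  rw [ex_map]
  refine h K q T' Q' _ fun b hb m' hm' => hK _ ?_ m' (hR b hb m' hm')
  rw [PMF.mem_support_map_iff]
  exact ⟨b, hb, rfl⟩

theorem Impl.skip {b : β} (h : R b m) : Impl f D S .skip m 1 0 (PMF.pure b) R := by
  intro K q T' Q' p hK
  have h1 := hK b (by simp) m h q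
  have := Good.of_step (f := f) (D := D) (S := S) (z := ⟨.skip :: K, m, q⟩) (T := T') (Q := Q')
    (q := 0) (p := fun _ => p b) (by
      intro z' hz'; simp [step] at hz'; subst hz'; exact ⟨by simp, h1⟩)
  rw [ex_const] at this
  rw [ex_pure, add_comm 1]
  exact this

theorem Impl.assign {b : β} {a : ℕ} {i e : Expr} (h : R b (m.write a (i.eval m) (e.eval m))) :
    Impl f D S (.assign a i e) m 1 0 (PMF.pure b) R := by
  intro K q T' Q' p hK
  have h1 := hK b (by simp) _ h q
  have := Good.of_step (f := f) (D := D) (S := S) (z := ⟨.assign a i e :: K, m, q⟩) (T := T')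
    (Q := Q') (q := 0) (p := fun _ => p b) (by
      intro z' hz'; simp [step] at hz'; subst hz'; exact ⟨by simp, h1⟩)
  rw [ex_const] at this
  rw [ex_pure, add_comm 1]
  exact this

theorem Impl.memberQuery {b : β} {a b' : ℕ} {i : Expr}
    (h : R b (m.write a (i.eval m) (f (m.readString n b')).toNat)) :
    Impl f D S (.memberQuery a i b') m 1 1 (PMF.pure b) R := by
  intro K q T' Q' p hK
  have h1 := hK b (by simp) _ h (q + 1)
  have := Good.of_step (f := f) (D := D) (S := S) (z := ⟨.memberQuery a i b' :: K, m, q⟩)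
    (T := T') (Q := Q') (q := 1) (p := fun _ => p b) (by
      intro z' hz'; simp [step] at hz'; subst hz'; exact ⟨by simp, h1⟩)
  rw [ex_const] at this
  rw [ex_pure, add_comm 1 T']
  exact this

theorem Impl.coin {R : Bool → Memory → Prop} {a : ℕ} {i : Expr}
    (h : ∀ r, R r (m.write a (i.eval m) r.toNat)) :
    Impl f D S (.coin a i) m 1 0 (PMF.uniformOfFintype Bool) R := by
  intro K q T' Q' p hK
  have h1 := fun r => hK r (by simp) _ (h r) q
  have := Good.of_step (f := f) (D := D) (S := S) (z := ⟨.coin a i :: K, m, q⟩)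
    (T := T') (Q := Q') (q := 0)
    -- The payoff must be a function of the configuration, whereas `p` is a function of the bit. The
    -- written entry determines the bit, so the supremum has at most one nontrivial term.
    (p := fun z => ⨆ (r : Bool) (_ : z = ⟨K, m.write a (i.eval m) r.toNat, q⟩), p r) (by
      intro z' hz'
      simp only [step, PMF.mem_support_map_iff] at hz'
      obtain ⟨r, -, rfl⟩ := hz'
      refine ⟨by simp, ?_⟩
      have e : (⨆ (r' : Bool) (_ : (⟨K, m.write a (i.eval m) r.toNat, q⟩ : Config) =
          ⟨K, m.write a (i.eval m) r'.toNat, q⟩), p r') ≤ p r := by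
        refine iSup₂_le fun r' hr' => ?_
        have : r = r' := by
          have h2 := congrArg (fun z : Config => z.mem a (i.eval m)) hr'
          simp [Memory.write] at h2
          cases r <;> cases r' <;> simp_all
        rw [this]
      exact (h1 r).mono le_rfl le_rfl e)
  refine this.mono (by omega) (by omega) ?_
  simp only [step]
  rw [ex_map]
  exact ex_mono fun r => le_iSup₂_of_le r rfl le_rfl

theorem readString_writeString (m : Memory) (a : ℕ) (x : Cube n) :
    (m.writeString a x).readString n a = x := by
  funext i
  simp [Memory.readString, Memory.writeString]

theorem Impl.exampleQuery {R : Cube n → Memory → Prop} {a : ℕ}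
    (h : ∀ x, R x (m.writeString a x)) :
    Impl f D S (.exampleQuery a) m 1 1 D R := by
  intro K q T' Q' p hK
  have := Good.of_step (f := f) (D := D) (S := S) (z := ⟨.exampleQuery a :: K, m, q⟩)
    (T := T') (Q := Q') (q := 1)
    (p := fun z => p (z.mem.readString n a)) (by
      intro z' hz'
      simp only [step, PMF.mem_support_map_iff] at hz'
      obtain ⟨x, hx, rfl⟩ := hz'
      refine ⟨by simp, ?_⟩
      simp only [readString_writeString]
      exact hK x hx _ (h x) _)
  refine this.mono (by omega) (by omega) ?_
  simp only [step]
  rw [ex_map]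
  simp only [readString_writeString]
  exact le_rfl

/-- Because `Impl` quantifies over the remaining programs `K`, composition is the hypothesis on `P`
used with the continuation `P' :: K`; expectations compose as in `ex_bind`. -/
theorem Impl.seq {κ : β → PMF γ} {R' : γ → Memory → Prop} (h : Impl f D S P m T₁ Q₁ μ R)
    (h' : ∀ b ∈ μ.support, ∀ m', R b m' → Impl f D S P' m' T₂ Q₂ (κ b) R') :
    Impl f D S (.seq P P') m (T₁ + T₂ + 1) (Q₁ + Q₂) (μ.bind κ) R' := by
  intro K q T' Q' p hK
  have h1 := h (P' :: K) q (T₂ + T') (Q₂ + Q') (fun b => ex (κ b) p) fun b hb m' hm' q' =>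
    h' b hb m' hm' K q' T' Q' p fun c hc m'' hm'' => hK c (by
      rw [PMF.mem_support_bind_iff]; exact ⟨b, hb, hc⟩) m'' hm''
  have := Good.of_step (f := f) (D := D) (S := S) (z := ⟨.seq P P' :: K, m, q⟩) (q := 0)
    (p := fun _ => ex μ fun b => ex (κ b) p) (by
      intro z' hz'; simp [step] at hz'; subst hz'; exact ⟨by simp, h1⟩)
  rw [ex_const] at this
  rw [ex_bind]
  exact this.mono (by omega) (by omega) le_rfl

theorem Impl.branch {e : Expr} (h : e.eval m ≠ 0 → Impl f D S P m T Q μ R)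
    (h' : e.eval m = 0 → Impl f D S P' m T Q μ R) :
    Impl f D S (.branch e P P') m (T + 1) Q μ R := by
  intro K q T' Q' p hK
  have h1 : Good f D S ⟨(if e.eval m ≠ 0 then P else P') :: K, m, q⟩ (T + T') (Q + Q')
      (ex μ p) := by
    by_cases he : e.eval m = 0
    · simpa [he] using h' he K q T' Q' p hK
    · simpa [he] using h he K q T' Q' p hK
  have := Good.of_step (f := f) (D := D) (S := S) (z := ⟨.branch e P P' :: K, m, q⟩) (q := 0)
    (p := fun _ => ex μ p) (by
      intro z' hz'; simp [step] at hz'; subst hz'; exact ⟨by simp, by simpa using h1⟩)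
  rw [ex_const] at this
  exact this.mono (by omega) (by omega) le_rfl

theorem Impl.loop_exit {e : Expr} {b : β} (he : e.eval m = 0) (h : R b m) :
    Impl f D S (.loop e P) m 1 0 (PMF.pure b) R := by
  intro K q T' Q' p hK
  have h1 := hK b (by simp) m h q
  have := Good.of_step (f := f) (D := D) (S := S) (z := ⟨.loop e P :: K, m, q⟩) (T := T')
    (Q := Q') (q := 0) (p := fun _ => p b) (by
      intro z' hz'; simp [step, he] at hz'; subst hz'; exact ⟨by simp, h1⟩)
  rw [ex_const] at this
  rw [ex_pure, add_comm 1]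
  exact this

/-- When the condition holds, the loop and the sequence of its body with the loop reach the same
configuration after one step. The two runs differ only at time `0`, which is why the time bound must
be a successor. -/
theorem Impl.loop_enter {e : Expr} (he : e.eval m ≠ 0)
    (h : Impl f D S (.seq P (.loop e P)) m (T + 1) Q μ R) :
    Impl f D S (.loop e P) m (T + 1) Q μ R := by
  intro K q T' Q' p hK
  obtain ⟨h1, h2, h3⟩ := h K q T' Q' p hK
  have e1 : ∀ t, run f D (t + 1) ⟨.seq P (.loop e P) :: K, m, q⟩ =
      run f D (t + 1) ⟨.loop e P :: K, m, q⟩ := by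
    intro t
    simp [run, step, he]
  have e2 : T + 1 + T' = (T + T') + 1 := by ring
  rw [e2] at h1 h3 ⊢
  rw [e1] at h1 h3
  refine ⟨h1, fun t => ?_, h3⟩
  cases t with
  | zero => intro z' hz'; simp [run] at hz'; subst hz'; simp
  | succ t => rw [← e1]; exact h2 (t + 1)

/-! ### Counting loops -/

/-- The entry `0` of the array `a`, used as a scalar variable. -/
abbrev var (a : ℕ) : Expr := .get a (.lit 0)

/-- `for c := 0, …, N - 1 do P`. -/
def forLoop (c : ℕ) (N : Expr) (P : Program) : Program :=
  .seq (.assign c (.lit 0) (.lit 0))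
    (.loop (.sub N (var c)) (.seq P (.assign c (.lit 0) (.add (var c) (.lit 1)))))

/-- The bound `e` is evaluated anew in every round, so `I` has to determine its value; it also has
to be insensitive to the counter, which the program overwrites. The extra `3` per round pays for the
loop test, the sequencing and the increment. -/
theorem Impl.forLoop {c N : ℕ} {e : Expr} {F : ℕ → β → PMF β} {I : ℕ → β → Memory → Prop} {b : β}
    (hN : ∀ j b m, I j b m → e.eval m = N)
    (hw : ∀ j b m v, I j b m → I j b (m.write c 0 v))
    (h : ∀ j b m, j < N → I j b m → m c 0 = j →
      Impl f D S P m T Q (F j b) fun b' m' => m' c 0 = j ∧ I (j + 1) b' m')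
    (h0 : I 0 b m) :
    Impl f D S (forLoop c e P) m (N * (T + 3) + 3) (N * Q) (iter F 0 N b) fun b' m' => I N b' m' := by
  have key : ∀ (k j : ℕ) b m, j + k = N → I j b m → m c 0 = j →
      Impl f D S (.loop (.sub e (var c)) (.seq P (.assign c (.lit 0) (.add (var c) (.lit 1)))))
        m (k * (T + 3) + 1) (k * Q) (iter F j k b) fun b' m' => I N b' m' := by
    intro k
    induction k with
    | zero =>
      intro j b m hj hI hc
      simp only [iter]
      refine (Impl.loop_exit ?_ (by simpa [← hj] using hI)).mono (by omega) (by omega)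
        fun _ _ _ h => h
      simp [Expr.eval, hN j b m hI, hc]; omega
    | succ k ih =>
      intro j b m hj hI hc
      have h1 := h j b m (by omega) hI hc
      have e3 : (k + 1) * (T + 3) + 1 = (T + 1 + 1 + (k * (T + 3) + 1)) + 1 := by ring
      rw [e3]
      refine Impl.loop_enter (by simp [Expr.eval, hN j b m hI, hc]; omega) ?_
      rw [iter, ← PMF.bind_pure (F j b)]
      rw [show (k + 1) * Q = (Q + 0) + k * Q by ring]
      refine Impl.seq (R := fun b' m' => m' c 0 = j + 1 ∧ I (j + 1) b' m') ?_ ?_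
      · refine Impl.seq h1 fun b' _ m' hm' => ?_
        refine Impl.assign ⟨by simp [Memory.write, Expr.eval, hm'.1], ?_⟩
        exact hw _ _ _ _ hm'.2
      · intro b' _ m' hm'
        exact ih (j + 1) b' m' (by omega) hm'.2 hm'.1
  have := Impl.seq (Impl.assign (f := f) (D := D) (S := S) (b := ()) (m := m) (a := c)
    (i := .lit 0) (e := .lit 0)
    (R := fun _ m' => m' c 0 = 0 ∧ I 0 b m') ⟨by simp [Memory.write, Expr.eval], hw _ _ _ _ h0⟩)
    (fun _ _ m' hm' => key N 0 b m' (by omega) hm'.2 hm'.1)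
  rw [PMF.pure_bind] at this
  exact this.mono (by omega) (by omega) fun _ _ _ h => h

end Programs

end JuntaTesting

namespace JuntaTesting

open scoped ENNReal

/-! ## Testing dictators -/

section Uniform

variable {V : Type} [Fintype V] [Nonempty V]

/-- The uniform distribution. -/
noncomputable abbrev unif (V : Type) [Fintype V] [Nonempty V] : PMF V := PMF.uniformOfFintype V

theorem ex_comm {β γ : Type} (μ : PMF β) (ν : PMF γ) (p : β → γ → ℝ≥0∞) :
    (ex μ fun a => ex ν fun b => p a b) = ex ν fun b => ex μ fun a => p a b := by
  unfold ex
  simp only [← ENNReal.tsum_mul_left]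
  rw [ENNReal.tsum_comm]
  refine tsum_congr fun b => tsum_congr fun a => ?_
  ring

theorem ex_unif_equiv (σ : V ≃ V) (p : V → ℝ≥0∞) :
    (ex (unif V) fun v => p (σ v)) = ex (unif V) p := by
  unfold ex
  rw [← σ.tsum_eq fun v => unif V v * p v]
  simp

/-- Averaging. Finiteness of `c` is what makes the comparison of the two sums strict. -/
theorem exists_le_of_ex_le {β : Type} {μ : PMF β} {p : β → ℝ≥0∞} {c : ℝ≥0∞} (hc : c ≠ ∞)
    (h : ex μ p ≤ c) : ∃ b ∈ μ.support, p b ≤ c := by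
  by_contra! hcon
  have h2 : ∀ b, μ b * c ≤ μ b * p b := by
    intro b
    by_cases hb : b ∈ μ.support
    · gcongr; exact (hcon b hb).le
    · rw [PMF.mem_support_iff, not_not] at hb; simp [hb]
  obtain ⟨b, hb⟩ := μ.support_nonempty
  have h3 : ∑' b, μ b * c < ∑' b, μ b * p b := by
    refine ENNReal.tsum_lt_tsum (i := b) ?_ h2 ?_
    · rw [ENNReal.tsum_mul_right, μ.tsum_coe, one_mul]; exact hc
    · exact ENNReal.mul_lt_mul_right ((PMF.mem_support_iff _ _).1 hb) (PMF.apply_ne_top _ _)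
        (hcon b hb)
  have h4 : ∑' b, μ b * c = c := ex_const μ c
  rw [h4] at h3
  exact absurd h (not_le.2 h3)

end Uniform

section Dictator

variable {V : Type} [BooleanAlgebra V]

/-- The test rejects `g` with the random choices `r`, `x`, `y`. -/
def dictatorFails (g : V → Bool) (r x y : V) : Bool :=
  (g r ^^ g (symmDiff r x) ^^ g (symmDiff r y) ^^ g (symmDiff (symmDiff r x) y)) ||
  ((g r ^^ g (symmDiff r (x ⊓ y))) ^^ ((g r ^^ g (symmDiff r x)) && (g r ^^ g (symmDiff r y)))) ||
  !(g r ^^ g (symmDiff r ⊤))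

variable [Fintype V] {g : V → Bool}

/-- Only the linearity part of the test is kept. Translating `x` and `y` by the base point makes the
corners `z`, `w`, `t` of the plane independent and uniform. -/
theorem plane_fails_le {δ : ℝ≥0∞}
    (h : (ex (unif V) fun r => ex (unif V) fun x => pr (unif V) fun y =>
      dictatorFails g r x y) ≤ δ) :
    (ex (unif V) fun z => ex (unif V) fun w => pr (unif V) fun t =>
      (g z ^^ g w ^^ g t ^^ g (symmDiff (symmDiff z w) t)) = true) ≤ δ := by
  classical
  refine le_trans ?_ h
  refine ex_mono fun z => ?_
  let σ : V ≃ V := ⟨fun a => symmDiff z a, fun a => symmDiff z a, fun a => by simp, fun a => by simp⟩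
  rw [← ex_unif_equiv σ]
  refine ex_mono fun x => ?_
  unfold pr
  rw [← ex_unif_equiv σ]
  refine ex_mono fun y => ?_
  have e : symmDiff (symmDiff z (symmDiff z x)) (symmDiff z y) = symmDiff (symmDiff z x) y := by
    rw [symmDiff_symmDiff_cancel_left, ← symmDiff_assoc, symmDiff_comm x z]
  simp only [σ, Equiv.coe_fn_mk, e]
  unfold dictatorFails
  unfold ind
  split_ifs with h1 h2 <;> simp_all

/-- Compare the plane through `z, w, t` with the one through `z + u, w + u, t`: both have the same
fourth corner. When neither fails, the derivative in direction `u` at `z` equals that at `w`. Both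
planes are uniform, so the failure probability is at most `2δ`; fixing a good `w` and `t` by
averaging makes the value at `w` the constant. -/
theorem exists_selfCorrection {δ : ℝ≥0∞} (hδ : δ ≠ ∞)
    (h : (ex (unif V) fun r => ex (unif V) fun x => pr (unif V) fun y =>
      dictatorFails g r x y) ≤ δ) (u : V) :
    ∃ c : Bool, pr (unif V) (fun z => (g z ^^ g (symmDiff z u)) ≠ c) ≤ δ + δ := by
  classical
  have h1 := plane_fails_le h
  set q : V → V → V → Prop := fun z w t =>
    (g z ^^ g w ^^ g t ^^ g (symmDiff (symmDiff z w) t)) = true with hq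
  let σ : V ≃ V := ⟨fun a => symmDiff a u, fun a => symmDiff a u, fun a => by simp, fun a => by simp⟩
  have h2 : (ex (unif V) fun z => ex (unif V) fun w => pr (unif V) fun t =>
      q (symmDiff z u) (symmDiff w u) t) ≤ δ := by
    refine le_trans (le_of_eq ?_) h1
    conv_lhs => rw [← ex_unif_equiv σ]
    congr 1; funext z
    conv_lhs => rw [← ex_unif_equiv σ]
    simp [σ, hq]
  have h3 : (ex (unif V) fun w => ex (unif V) fun t => pr (unif V) fun z =>
      q z w t ∨ q (symmDiff z u) (symmDiff w u) t) ≤ δ + δ := by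
    refine le_trans ?_ (add_le_add h1 h2)
    rw [← ex_add]
    simp only [← ex_add]
    calc _ = ex (unif V) fun w => ex (unif V) fun z => ex (unif V) fun t =>
          ind (q z w t ∨ q (symmDiff z u) (symmDiff w u) t) := by
          congr 1; funext w; exact ex_comm _ _ _
      _ = ex (unif V) fun z => ex (unif V) fun w => ex (unif V) fun t =>
          ind (q z w t ∨ q (symmDiff z u) (symmDiff w u) t) := ex_comm _ _ _
      _ ≤ _ := ex_mono fun z => ex_mono fun w => pr_or_le _ _ _
  obtain ⟨w, -, h4⟩ := exists_le_of_ex_le (by simp [hδ]) h3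
  obtain ⟨t, -, h5⟩ := exists_le_of_ex_le (by simp [hδ]) h4
  refine ⟨g w ^^ g (symmDiff w u), le_trans (pr_mono fun z hz => ?_) h5⟩
  have e : symmDiff (symmDiff (symmDiff z u) (symmDiff w u)) t = symmDiff (symmDiff z w) t := by
    congr 1
    rw [symmDiff_comm w u, ← symmDiff_assoc]
    simp
  simp only [hq, e]
  generalize g (symmDiff (symmDiff z w) t) = a at *
  revert hz
  cases g z <;> cases g w <;> cases g t <;> cases g (symmDiff z u) <;>
    cases g (symmDiff w u) <;> cases a <;> simp

/-- If the test rejects with small probability, the self-correction is a homomorphism. -/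
theorem exists_hom (h : (ex (unif V) fun r => ex (unif V) fun x => pr (unif V) fun y =>
      dictatorFails g r x y) ≤ 1 / 32) :
    ∃ G : V → Bool, (∀ u, pr (unif V) (fun z => (g z ^^ g (symmDiff z u)) ≠ G u) ≤ 1 / 16) ∧
      (∀ u v, G (symmDiff u v) = (G u ^^ G v)) ∧ (∀ u v, G (u ⊓ v) = (G u && G v)) ∧
      G ⊤ = true := by
  classical
  have e16 : (1 / 32 + 1 / 32 : ℝ≥0∞) = 1 / 16 := by
    rw [← ENNReal.toReal_eq_toReal_iff' (by simp) (by simp)]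
    rw [ENNReal.toReal_add (by simp) (by simp)]
    norm_num
  have hs := exists_selfCorrection (by simp) h
  rw [e16] at hs
  choose G hG using hs
  have hadd : ∀ u v, G (symmDiff u v) = (G u ^^ G v) := by
    intro u v
    by_contra hcon
    let σ : V ≃ V := ⟨fun a => symmDiff a u, fun a => symmDiff a u, fun a => by simp,
      fun a => by simp⟩
    have h1 : pr (unif V) (fun z => (g (symmDiff z u) ^^ g (symmDiff (symmDiff z u) v)) ≠ G v) ≤
        1 / 16 := by
      refine le_trans (le_of_eq ?_) (hG v)
      unfold pr
      conv_rhs => rw [← ex_unif_equiv σ]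
      rfl
    -- If additivity fails at `u, v`, every `z` lies in one of three bad events, because the
    -- derivative along `u + v` is the sum of those along `u` at `z` and along `v` at `z + u`. Their
    -- total probability is below `1`.
    have h2 : (1 : ℝ≥0∞) ≤ 1 / 16 + 1 / 16 + 1 / 16 := by
      calc (1 : ℝ≥0∞) = pr (unif V) fun _ => True := (pr_eq_one fun _ _ => trivial).symm
        _ ≤ pr (unif V) fun z => ((g z ^^ g (symmDiff z u)) ≠ G u ∨
            (g (symmDiff z u) ^^ g (symmDiff (symmDiff z u) v)) ≠ G v) ∨
            (g z ^^ g (symmDiff z (symmDiff u v))) ≠ G (symmDiff u v) := by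
            refine pr_mono fun z _ => ?_
            by_contra! hz
            rw [symmDiff_assoc] at hz
            apply hcon
            rw [← hz.1.1, ← hz.1.2, ← hz.2]
            cases g z <;> cases g (symmDiff z u) <;> simp
        _ ≤ _ := (pr_or_le _ _ _).trans (add_le_add ((pr_or_le _ _ _).trans
            (add_le_add (hG u) h1)) (hG _))
    have h3 := ENNReal.toReal_mono (by simp) h2
    rw [ENNReal.toReal_add (by simp) (by simp), ENNReal.toReal_add (by simp) (by simp)] at h3
    norm_num at h3
  refine ⟨G, hG, hadd, fun x₀ y₀ => ?_, ?_⟩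
  · by_contra hcon
    have h1 : (ex (unif V) fun x => pr (unif V) fun y => G (x ⊓ y) ≠ (G x && G y)) ≤
        1 / 32 + 1 / 16 + 1 / 16 + 1 / 16 := by
      calc _ = ex (unif V) fun r => ex (unif V) fun x => pr (unif V) fun y =>
            G (x ⊓ y) ≠ (G x && G y) := (ex_const _ _).symm
        _ ≤ ex (unif V) fun r => ex (unif V) fun x => ex (unif V) fun y =>
            ind (dictatorFails g r x y) +
            ind ((g r ^^ g (symmDiff r x)) ≠ G x) +
            ind ((g r ^^ g (symmDiff r y)) ≠ G y) +
            ind ((g r ^^ g (symmDiff r (x ⊓ y))) ≠ G (x ⊓ y)) := by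
            refine ex_mono fun r => ex_mono fun x => ex_mono fun y => ?_
            by_cases hb : G (x ⊓ y) ≠ (G x && G y)
            · by_cases h2 : (g r ^^ g (symmDiff r x)) = G x
              · by_cases h3 : (g r ^^ g (symmDiff r y)) = G y
                · by_cases h4 : (g r ^^ g (symmDiff r (x ⊓ y))) = G (x ⊓ y)
                  · have h5 : dictatorFails g r x y = true := by
                      unfold dictatorFails
                      rw [h2, h3, h4]
                      have : (G (x ⊓ y) ^^ (G x && G y)) = true := by
                        revert hb; cases G (x ⊓ y) <;> cases (G x && G y) <;> simp
                      simp [this]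
                    simp [ind, hb, h5, h2, h3, h4]
                  · simp [ind, hb, h4]
                · simpa [ind, hb, h3] using le_add_right le_add_self
              · simpa [ind, hb, h2] using le_add_right (le_add_right le_add_self)
            · simp [ind, hb]
        _ ≤ 1 / 32 + 1 / 16 + 1 / 16 + 1 / 16 := by
            simp only [ex_add, ex_const]
            refine add_le_add (add_le_add (add_le_add h ?_) ?_) ?_
            · rw [ex_comm]
              exact (ex_mono fun x => hG x).trans (ex_const _ _).le
            · rw [ex_comm]
              exact (ex_mono fun x => hG x).trans (ex_const _ _).le
            · rw [ex_comm]
              refine (ex_mono fun x => ?_).trans (ex_const _ _).le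
              rw [ex_comm]
              exact (ex_mono fun y => hG (x ⊓ y)).trans (ex_const _ _).le
    -- By additivity of `G` the defect `G (x ⊓ y) + G x G y` is bilinear. If it is nonzero at `(x₀,
    -- y₀)`, then for all `x, y` it is nonzero at one of the four points obtained by shifting by
    -- `x₀` and `y₀`. So its density would be at least `1/4`, against the bound `7/32` just proved.
    set B : V → V → Prop := fun x y => G (x ⊓ y) ≠ (G x && G y) with hB
    let σ : V → (V ≃ V) := fun u => ⟨fun a => symmDiff a u, fun a => symmDiff a u,
      fun a => by simp, fun a => by simp⟩
    set b := ex (unif V) fun x => pr (unif V) fun y => B x y with hb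
    have s1 : (ex (unif V) fun x => pr (unif V) fun y => B (symmDiff x x₀) y) = b :=
      ex_unif_equiv (σ x₀) fun x => pr (unif V) fun y => B x y
    have s2 : (ex (unif V) fun x => pr (unif V) fun y => B x (symmDiff y y₀)) = b := by
      rw [hb]; congr 1; funext x
      exact ex_unif_equiv (σ y₀) fun y => ind (B x y)
    have s3 : (ex (unif V) fun x => pr (unif V) fun y => B (symmDiff x x₀) (symmDiff y y₀)) = b := by
      rw [← s2]
      exact ex_unif_equiv (σ x₀) fun x => pr (unif V) fun y => B x (symmDiff y y₀)
    have h2 : (1 : ℝ≥0∞) ≤ b + b + b + b := by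
      calc (1 : ℝ≥0∞) = ex (unif V) fun _ => 1 := (ex_const _ _).symm
        _ ≤ ex (unif V) fun x => (((pr (unif V) fun y => B x y) +
            pr (unif V) fun y => B (symmDiff x x₀) y) + pr (unif V) fun y => B x (symmDiff y y₀)) +
            pr (unif V) fun y => B (symmDiff x x₀) (symmDiff y y₀) := by
            refine ex_mono fun x => ?_
            have : (1 : ℝ≥0∞) = pr (unif V) fun y => ((B x y ∨ B (symmDiff x x₀) y) ∨
                B x (symmDiff y y₀)) ∨ B (symmDiff x x₀) (symmDiff y y₀) := by
              refine (pr_eq_one fun y _ => ?_).symm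
              by_contra! hy
              simp only [hB, not_not] at hy
              obtain ⟨⟨⟨h1, h2⟩, h3⟩, h4⟩ := hy
              apply hcon
              simp only [inf_symmDiff_distrib_left, inf_symmDiff_distrib_right, hadd] at h1 h2 h3 h4
              revert h1 h2 h3 h4
              generalize G (x ⊓ y) = a1
              generalize G (x ⊓ y₀) = a2
              generalize G (x₀ ⊓ y) = a3
              generalize G (x₀ ⊓ y₀) = a4
              generalize G x = a5
              generalize G x₀ = a6
              generalize G y = a7
              generalize G y₀ = a8
              revert a1 a2 a3 a4 a5 a6 a7 a8
              decide
            rw [this]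
            exact (pr_or_le _ _ _).trans (add_le_add ((pr_or_le _ _ _).trans
              (add_le_add (pr_or_le _ _ _) le_rfl)) le_rfl)
        _ = b + b + b + b := by simp only [ex_add]; rw [s1, s2, s3]
    have h3 : (1 : ℝ≥0∞) ≤ _ := h2.trans (add_le_add (add_le_add (add_le_add h1 h1) h1) h1)
    have h4 := ENNReal.toReal_mono (by simp) h3
    simp only [one_div] at h4
    repeat rw [ENNReal.toReal_add (by simp) (by simp)] at h4
    norm_num at h4
  · by_contra hcon
    have h2 : (1 : ℝ≥0∞) ≤ 1 / 32 + 1 / 16 := by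
      calc (1 : ℝ≥0∞) = ex (unif V) fun r => ex (unif V) fun x => ex (unif V) fun y => 1 := by
            simp only [ex_const]
        _ ≤ ex (unif V) fun r => ex (unif V) fun x => ex (unif V) fun y =>
            ind (dictatorFails g r x y) +
            ind ((g r ^^ g (symmDiff r ⊤)) ≠ G ⊤) := by
            refine ex_mono fun r => ex_mono fun x => ex_mono fun y => ?_
            by_cases h2 : (g r ^^ g (symmDiff r ⊤)) = G ⊤
            · have : dictatorFails g r x y = true := by
                unfold dictatorFails
                rw [h2]
                simp [Bool.eq_false_of_not_eq_true hcon]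
              simp [ind, this]
            · exact le_trans (by rw [ind, if_pos h2]) le_add_self
        _ ≤ 1 / 32 + 1 / 16 := by
            simp only [ex_add, ex_const]
            exact add_le_add h (hG ⊤)
    have h4 := ENNReal.toReal_mono (by simp) h2
    rw [ENNReal.toReal_add (by simp) (by simp)] at h4
    norm_num at h4

end Dictator

/-- The homomorphisms of Boolean algebras from the cube to `Bool` are the coordinates. -/
theorem exists_coordinate {n : ℕ} {G : Cube n → Bool}
    (hadd : ∀ u v, G (symmDiff u v) = (G u ^^ G v)) (hmul : ∀ u v, G (u ⊓ v) = (G u && G v))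
    (htop : G ⊤ = true) : ∃ τ, ∀ u, G u = u τ := by
  classical
  have hbot : G ⊥ = false := by
    have := hadd ⊥ ⊥
    simpa using this
  let χ : Finset (Fin n) → Cube n := fun T i => decide (i ∈ T)
  -- `⊤` is the sum of all singletons, so additivity gives a singleton `{τ}` with value `true`.
  -- Multiplicativity then reads off `G u`, since `u ⊓ χ {τ}` is `χ {τ}` or `⊥` according to `u τ`.
  have key : ∀ T : Finset (Fin n), G (χ T) = true → ∃ i, G (χ {i}) = true := by
    intro T
    induction T using Finset.induction_on with
    | empty =>
      intro h
      rw [show χ ∅ = ⊥ by funext i; simp [χ], hbot] at h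
      simp at h
    | insert i T hi ih =>
      intro h
      rw [show χ (insert i T) = symmDiff (χ {i}) (χ T) by
        funext j
        simp only [χ, Pi.symmDiff_apply, Bool.symmDiff_eq_xor]
        by_cases hj : j = i
        · subst hj; simp [hi]
        · simp [hj], hadd] at h
      by_cases h1 : G (χ {i}) = true
      · exact ⟨i, h1⟩
      · exact ih (by simpa [h1] using h)
  obtain ⟨τ, hτ⟩ := key Finset.univ (by
    rw [show χ Finset.univ = ⊤ by funext i; simp [χ]]; exact htop)
  refine ⟨τ, fun u => ?_⟩
  have h1 := hmul u (χ {τ})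
  rw [hτ, Bool.and_true] at h1
  rw [← h1]
  by_cases hu : u τ = true
  · rw [show u ⊓ χ {τ} = χ {τ} by
      funext j
      by_cases hj : j = τ
      · subst hj; simp [χ, hu]
      · simp [χ, hj], hτ, hu]
  · rw [show u ⊓ χ {τ} = ⊥ by
      funext j
      by_cases hj : j = τ
      · subst hj; simp [hu]
      · simp [χ, hj], hbot]
    simpa using hu

end JuntaTesting

namespace JuntaTesting

open scoped ENNReal

/-! ## The tester as a random process -/

/-- The blocks found so far: `own i = ℓ + 1` when coordinate `i` lies in the block number `ℓ`,
`own i = 0` when it lies in no such block; `wit ℓ` shows that block number `ℓ` is relevant. -/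
structure Blocks (n : ℕ) where
  own : Fin n → ℕ
  wit : ℕ → Cube n
  cnt : ℕ

section IdealTester

variable {n : ℕ}

/-- The string `u` with the coordinates outside of the blocks set to `0`. -/
def restr (own : Fin n → ℕ) (u : Cube n) : Cube n := fun i => u i && decide (own i ≠ 0)

/-- The string `u` with the coordinates outside of the blocks set to `0`, unless their label is
below `mid`. -/
def cut (own : Fin n → ℕ) (lab : ℕ → ℕ) (u : Cube n) (mid : ℕ) : Cube n :=
  fun i => u i && decide (own i ≠ 0 ∨ lab i < mid)

/-- Binary search in `[lo, lo + 2 ^ j)`. -/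
def bisect (p : ℕ → Bool) : ℕ → ℕ → ℕ
  | lo, 0 => lo
  | lo, j + 1 => bisect p (if p (lo + 2 ^ j) then lo + 2 ^ j else lo) j

/-- The label of a relevant block outside of the blocks found so far. -/
def newLabel (f : Cube n → Bool) (lab : ℕ → ℕ) (L : ℕ) (own : Fin n → ℕ) (u : Cube n) : ℕ :=
  bisect (fun mid => f u ^^ f (cut own lab u mid)) 0 L

/-- Adding a new block. -/
def extend (f : Cube n → Bool) (lab : ℕ → ℕ) (L : ℕ) (s : Blocks n) (u : Cube n) : Blocks n where
  own := fun i => if s.own i = 0 ∧ lab i = newLabel f lab L s.own u then s.cnt + 1 else s.own i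
  wit := Function.update s.wit s.cnt (cut s.own lab u (newLabel f lab L s.own u + 1))
  cnt := s.cnt + 1

/-- One attempt to find the block number `j`. -/
noncomputable def tryStep (f : Cube n → Bool) (D : PMF (Cube n)) (lab : ℕ → ℕ) (L j : ℕ)
    (s : Blocks n) : PMF (Blocks n) :=
  if s.cnt = j then
    D.map fun u => if f u ^^ f (restr s.own u) then extend f lab L s u else s
  else PMF.pure s

/-- The search for at most `k + 1` blocks, with `M` attempts for each. -/
noncomputable def search (f : Cube n → Bool) (D : PMF (Cube n)) (lab : ℕ → ℕ) (L M k : ℕ) :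
    PMF (Blocks n) :=
  iter (fun j => iter (fun _ => tryStep f D lab L j) 0 M) 0 (k + 1)
    ⟨fun _ => 0, fun _ _ => false, 0⟩

/-- The function `f` restricted to the block number `ℓ`. -/
def probe (f : Cube n → Bool) (s : Blocks n) (ℓ : ℕ) (z : Cube n) : Bool :=
  f fun i => if s.own i = ℓ + 1 then z i else s.wit ℓ i

/-- One round of the dictator test, and of the evaluation of the dictator at `u`. -/
noncomputable def repStep (g : Cube n → Bool) (u : Cube n) (s : Bool × (Bool → Bool)) :
    PMF (Bool × (Bool → Bool)) :=
  (unif (Cube n)).bind fun r => (unif (Cube n)).bind fun x => (unif (Cube n)).bind fun y =>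
    PMF.pure (s.1 || dictatorFails g r x y, Function.update s.2 (g r ^^ g (symmDiff r u)) true)

/-- Test of the block number `ℓ`. -/
noncomputable def blockStep (f : Cube n → Bool) (R : ℕ) (b : Blocks n) (u : Cube n) (ℓ : ℕ)
    (s : Bool × Cube n) : PMF (Bool × Cube n) :=
  (iter (fun _ => repStep (probe f b ℓ) u) 0 R (s.1, fun _ => false)).map fun q =>
    (q.1 || (q.2 false && q.2 true), fun i => if b.own i = ℓ + 1 then q.2 true else s.2 i)

/-- Test with one sample. -/
noncomputable def sampleStep (f : Cube n → Bool) (D : PMF (Cube n)) (R : ℕ) (b : Blocks n)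
    (rej : Bool) : PMF Bool :=
  D.bind fun u => (iter (blockStep f R b u) 0 b.cnt (rej, fun _ => false)).map fun s =>
    s.1 || (f s.2 ^^ f (restr b.own u))

/-- The verification, with output `true` for rejection. -/
noncomputable def verify (f : Cube n → Bool) (D : PMF (Cube n)) (R M k : ℕ) (b : Blocks n) :
    PMF Bool :=
  iter (fun _ => sampleStep f D R b) 0 M (decide (k < b.cnt))

/-- A random number with `L` binary digits. -/
noncomputable def coins (L : ℕ) : PMF ℕ :=
  iter (fun _ c => (unif Bool).map fun r => c + c + r.toNat) 0 L 0

/-- A random labelling. -/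
noncomputable def labels (n L : ℕ) : PMF (ℕ → ℕ) :=
  iter (fun j lab => (coins L).map fun c => Function.update lab j c) 0 n fun _ => 0

/-- The whole process. -/
noncomputable def process (f : Cube n → Bool) (D : PMF (Cube n)) (L R M k : ℕ) : PMF Bool :=
  (labels n L).bind fun lab => (search f D lab L M k).bind (verify f D R M k)

/-! ### Soundness -/

theorem pr_not_le {β : Type} {μ : PMF β} {A : β → Prop} {c : ℝ≥0∞} (hc : c ≤ pr μ A) :
    pr μ (fun b => ¬ A b) ≤ 1 - c := by
  have h := pr_add_pr_not μ A
  have hc' : c ≠ ∞ := ne_top_of_le_ne_top ENNReal.one_ne_top (hc.trans (pr_le_one _ _))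
  refine ENNReal.le_sub_of_add_le_left hc' ?_
  rw [← h]
  gcongr

/-- `(1 - 1/N)^N ≤ 1/e ≤ 1/2`: thus `N * s` independent trials with success probability `1/N` all
fail with probability at most `2^{-s}`. -/
theorem one_sub_inv_pow_le {N s K : ℕ} (hN : 1 ≤ N) (h : N * s ≤ K) :
    (1 - (N : ℝ≥0∞)⁻¹) ^ K ≤ 2⁻¹ ^ s := by
  have h1 : (1 - (N : ℝ≥0∞)⁻¹) ^ N ≤ 2⁻¹ := by
    have e : (1 - (N : ℝ≥0∞)⁻¹) = ENNReal.ofReal (1 - 1 / (N : ℝ)) := by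
      rw [ENNReal.ofReal_sub _ (by positivity), ENNReal.ofReal_one, one_div,
        ENNReal.ofReal_inv_of_pos (by positivity), ENNReal.ofReal_natCast]
    have h2 : (0 : ℝ) ≤ 1 - 1 / (N : ℝ) := by
      rw [sub_nonneg, div_le_one (by positivity)]
      exact_mod_cast hN
    rw [e, ← ENNReal.ofReal_pow h2, show (2 : ℝ≥0∞)⁻¹ = ENNReal.ofReal (2⁻¹) by
      rw [ENNReal.ofReal_inv_of_pos (by norm_num)]; simp]
    refine ENNReal.ofReal_le_ofReal ?_
    refine (Real.one_sub_div_pow_le_exp_neg (by exact_mod_cast hN)).trans ?_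
    rw [Real.exp_neg]
    have := Real.add_one_le_exp (1 : ℝ)
    gcongr
    linarith
  calc (1 - (N : ℝ≥0∞)⁻¹) ^ K ≤ (1 - (N : ℝ≥0∞)⁻¹) ^ (N * s) :=
        pow_le_pow_right_of_le_one' tsub_le_self h
    _ = ((1 - (N : ℝ≥0∞)⁻¹) ^ N) ^ s := pow_mul _ _ _
    _ ≤ 2⁻¹ ^ s := by gcongr

variable {f : Cube n → Bool} {D : PMF (Cube n)} {lab : ℕ → ℕ} {L R M k : ℕ}

theorem tryStep_support {j : ℕ} {s s' : Blocks n} (h : s' ∈ (tryStep f D lab L j s).support) :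
    s' = s ∨ s.cnt = j ∧ ∃ u, (f u ^^ f (restr s.own u)) = true ∧ s' = extend f lab L s u := by
  unfold tryStep at h
  split_ifs at h with hj
  · rw [PMF.mem_support_map_iff] at h
    obtain ⟨u, -, rfl⟩ := h
    by_cases hu : (f u ^^ f (restr s.own u)) = true
    · right; exact ⟨hj, u, hu, by simp [hu]⟩
    · left; simp [hu]
  · left; simpa using h

/-- While nothing is found the state stays `s`, so each attempt succeeds with probability at least
`β`; after a success the count exceeds `j`, and `s` cannot recur. -/
theorem pr_stage_le {β : ℝ≥0∞} {j : ℕ} {s : Blocks n} (hs : s.cnt = j)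
    (hβ : β ≤ pr D fun u => f u ≠ f (restr s.own u)) :
    pr (iter (fun _ => tryStep f D lab L j) 0 M s) (fun s' => s' = s) ≤ (1 - β) ^ M := by
  refine pr_iter_le_pow ?_ ?_ M 0 s
  · rintro i s' rfl
    rw [tryStep, if_pos hs, pr_map]
    refine le_trans (pr_mono fun u hu => ?_) (pr_not_le hβ)
    by_contra hne
    have : (f u ^^ f (restr s'.own u)) = true := by
      revert hne; cases f u <;> cases f (restr s'.own u) <;> simp
    rw [if_pos this] at hu
    have := congrArg Blocks.cnt hu
    simp [extend] at this
  · rintro i s' hne s'' hs'' rfl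
    rcases tryStep_support hs'' with h | ⟨h1, u, -, h⟩
    · exact hne h.symm
    · rw [h] at hs
      simp [extend] at hs
      omega

theorem pr_search_le (β : ℝ≥0∞) :
    pr (search f D lab L M k)
      (fun s => s.cnt ≤ k ∧ β < pr D fun u => f u ≠ f (restr s.own u)) ≤
      (k + 1) * (1 - β) ^ M := by
  -- Either every stage so far has found its block, or the search has stalled in a state already
  -- good enough. A stalled state is never changed again, as later stages act only when the count
  -- equals their index. Only a stalled state that is not good violates `I`.
  set I : ℕ → Blocks n → Prop := fun j s =>
    s.cnt = j ∨ s.cnt < j ∧ ¬ β < pr D fun u => f u ≠ f (restr s.own u)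
  have h := pr_iter_le (F := fun j => iter (fun _ => tryStep f D lab L j) 0 M) (I := I)
    (δ := fun _ => (1 - β) ^ M) ?_ (k + 1) 0 ⟨fun _ => 0, fun _ _ => false, 0⟩ (by simp [I])
  · rw [Finset.sum_const, Finset.card_range, nsmul_eq_mul, zero_add] at h
    push_cast at h
    refine le_trans (pr_mono ?_) h
    rintro s ⟨h1, h2⟩ (h3 | h3)
    · omega
    · exact h3.2 h2
  · intro j s hs
    have hsup : ∀ s' ∈ (iter (fun _ => tryStep f D lab L j) 0 M s).support,
        s' = s ∨ s.cnt = j ∧ s'.cnt = j + 1 := by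
      refine iter_support (I := fun _ s' => s' = s ∨ s.cnt = j ∧ s'.cnt = j + 1) ?_ (Or.inl rfl)
      intro i s' _ hs' s'' hs''
      rcases tryStep_support hs'' with rfl | ⟨h1, u, -, rfl⟩
      · exact hs'
      · right
        rcases hs' with rfl | h
        · exact ⟨h1, by simp [extend, h1]⟩
        · omega
    rcases hs with hs | hs
    · by_cases hb : β < pr D fun u => f u ≠ f (restr s.own u)
      · refine le_trans (pr_mono_support fun s' hs' hI => ?_) (pr_stage_le hs hb.le)
        rcases hsup s' hs' with h | h
        · exact h
        · exact absurd (Or.inl h.2) hI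
      · rw [pr_eq_zero]
        · exact bot_le
        · intro s' hs' hI
          rcases hsup s' hs' with rfl | h
          · exact hI (Or.inr ⟨by omega, hb⟩)
          · exact hI (Or.inl h.2)
    · rw [pr_eq_zero]
      · exact bot_le
      · intro s' hs' hI
        rcases hsup s' hs' with rfl | h
        · exact hI (Or.inr ⟨by omega, hs.2⟩)
        · omega

theorem repStep_support {g : Cube n → Bool} {u : Cube n} {s s' : Bool × (Bool → Bool)}
    (h : s' ∈ (repStep g u s).support) : ∃ r x y, s' =
      (s.1 || dictatorFails g r x y, Function.update s.2 (g r ^^ g (symmDiff r u)) true) := by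
  unfold repStep at h
  simp only [PMF.mem_support_bind_iff, PMF.mem_support_pure_iff] at h
  obtain ⟨r, -, x, -, y, -, h⟩ := h
  exact ⟨r, x, y, h⟩

/-- Each round uses fresh `r, x, y` and therefore rejects with probability at least `δ`,
independently of `u`; rejection is permanent. -/
theorem pr_reps_not_rejected_le {g : Cube n → Bool} {δ : ℝ≥0∞}
    (h : δ ≤ ex (unif (Cube n)) fun r => ex (unif (Cube n)) fun x => pr (unif (Cube n)) fun y =>
      dictatorFails g r x y) (u : Cube n) (s : Bool × (Bool → Bool)) :
    pr (iter (fun _ => repStep g u) 0 R s) (fun q => ¬ q.1) ≤ (1 - δ) ^ R := by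
  refine pr_iter_le_pow ?_ ?_ R 0 s
  · intro _ s hs
    refine pr_not_le (h.trans ?_)
    simp only [repStep, pr_bind, pr_pure]
    refine ex_mono fun r => ex_mono fun x => ex_mono fun y => ?_
    by_cases hf : dictatorFails g r x y = true <;> simp [ind, hf]
  · intro _ s hs s' hs'
    obtain ⟨r, x, y, rfl⟩ := repStep_support hs'
    simp at hs
    simp [hs]

/-- The derivative at a fresh base point takes the majority value `c` except with probability
`1/16`, and a value once seen stays recorded. -/
theorem pr_reps_unseen_le {g : Cube n → Bool} {c : Bool} {u : Cube n}
    (h : pr (unif (Cube n)) (fun r => (g r ^^ g (symmDiff r u)) ≠ c) ≤ 1 / 16)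
    (s : Bool × (Bool → Bool)) :
    pr (iter (fun _ => repStep g u) 0 R s) (fun q => q.2 c = false) ≤ (1 / 16) ^ R := by
  refine pr_iter_le_pow ?_ ?_ R 0 s
  · intro _ s hs
    simp only [repStep, pr_bind, pr_pure, ex_const]
    refine le_trans (ex_mono fun r => ?_) h
    by_cases hf : (g r ^^ g (symmDiff r u)) = c
    · simp [ind, hf]
    · exact (ind_le_one _).trans (by rw [ind, if_pos hf])
  · intro _ s hs s' hs'
    obtain ⟨r, x, y, rfl⟩ := repStep_support hs'
    by_cases hf : (g r ^^ g (symmDiff r u)) = c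
    · simp [hf]
    · simpa [Function.update_of_ne (Ne.symm hf)] using hs

theorem blockStep_support_rejected {b : Blocks n} {u : Cube n} {ℓ : ℕ} {s s' : Bool × Cube n}
    (hs : s.1 = true) (h : s' ∈ (blockStep f R b u ℓ s).support) : s'.1 = true := by
  unfold blockStep at h
  rw [PMF.mem_support_map_iff] at h
  obtain ⟨q, hq, rfl⟩ := h
  have : q.1 = true := iter_support (I := fun _ q => q.1 = true) (fun i q _ hq q' hq' => by
    obtain ⟨r, x, y, rfl⟩ := repStep_support hq'
    simp [hq]) (by simpa using hs) q hq
  simp [this]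

theorem sampleStep_support_rejected {b : Blocks n} {x : Bool}
    (h : x ∈ (sampleStep f D R b true).support) : x = true := by
  unfold sampleStep at h
  simp only [PMF.mem_support_bind_iff, PMF.mem_support_map_iff] at h
  obtain ⟨u, -, s, hs, rfl⟩ := h
  have : s.1 = true := iter_support (I := fun _ q => q.1 = true)
    (fun i q _ hq q' hq' => blockStep_support_rejected hq hq') rfl s hs
  simp [this]

/-- A block on which `f` is not close to a dictator is rejected. -/
theorem pr_blocks_not_rejected_le {b : Blocks n} {ℓ : ℕ} (hℓ : ℓ < b.cnt) {δ : ℝ≥0∞}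
    (h : δ ≤ ex (unif (Cube n)) fun r => ex (unif (Cube n)) fun x => pr (unif (Cube n)) fun y =>
      dictatorFails (probe f b ℓ) r x y) (u : Cube n) (s : Bool × Cube n) :
    pr (iter (blockStep f R b u) 0 b.cnt s) (fun s => ¬ s.1) ≤ (1 - δ) ^ R := by
  classical
  have hc : (1 - δ) ^ R ≤ 1 := pow_le_one' tsub_le_self _
  -- The potential bounds the probability of surviving to the end: `0` after rejection, `(1 - δ)^R`
  -- as long as block `ℓ` is still to come, and `1` afterwards.
  have key := ex_iter_le (F := blockStep f R b u)
    (Φ := fun j s => if s.1 then 0 else if j ≤ ℓ then (1 - δ) ^ R else 1) ?_ b.cnt 0 s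
  · refine le_trans (ex_mono fun s' => ?_) (key.trans ?_)
    · by_cases hs' : s'.1 = true
      · simp [hs', ind]
      · simp [hs', ind, not_le.2 hℓ]
    · split_ifs <;> simp_all
  · intro j s
    by_cases hs : s.1 = true
    · simp only [hs, if_true]
      refine (ex_mono_support fun s' hs' => ?_).trans (ex_const (blockStep f R b u j s) 0).le
      simp [blockStep_support_rejected hs hs']
    · rw [if_neg hs]
      rcases lt_trichotomy j ℓ with hj | rfl | hj
      · rw [if_pos hj.le]
        refine (ex_mono fun s' => ?_).trans (ex_const (blockStep f R b u j s) ((1 - δ) ^ R)).le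
        rw [if_pos (show j + 1 ≤ ℓ by omega)]
        split_ifs <;> simp
      · simp only [le_refl, if_true]
        refine le_trans ?_ (pr_reps_not_rejected_le (R := R) h u (s.1, fun _ => false))
        unfold blockStep
        rw [ex_map]
        refine ex_mono fun q => ?_
        by_cases hq : q.1 = true
        · simp [hq]
        · simp only [ind, hq]
          split_ifs <;> simp_all
      · rw [if_neg (show ¬ j ≤ ℓ by omega)]
        refine (ex_mono fun s' => ?_).trans (ex_const (blockStep f R b u j s) 1).le
        split_ifs <;> simp [hc]

/-- The string in which the block number `ℓ < j` is filled with the value of its dictator. -/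
def fill (own : Fin n → ℕ) (τ : ℕ → Fin n) (j : ℕ) (u : Cube n) : Cube n :=
  fun i => if 1 ≤ own i ∧ own i ≤ j then u (τ (own i - 1)) else false

/-- A block can contribute a wrong bit without rejection only if the right value never shows up in
its `R` rounds: seeing both values already causes rejection. -/
theorem pr_blocks_wrong_le {b : Blocks n} {τ : ℕ → Fin n} {u : Cube n}
    (h : ∀ ℓ < b.cnt, pr (unif (Cube n)) (fun r => (probe f b ℓ r ^^
      probe f b ℓ (symmDiff r u)) ≠ u (τ ℓ)) ≤ 1 / 16) (s : Bool) :
    pr (iter (blockStep f R b u) 0 b.cnt (s, fun _ => false))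
      (fun s => ¬ (s.1 = true ∨ s.2 = fill b.own τ b.cnt u)) ≤ b.cnt * (1 / 16) ^ R := by
  classical
  -- Indices from `b.cnt` on never occur; they get the trivial bound `1` because the union bound
  -- asks for one at every index.
  have key := pr_iter_le (F := blockStep f R b u)
    (I := fun j s => s.1 = true ∨ s.2 = fill b.own τ j u)
    (δ := fun j => if j < b.cnt then (1 / 16) ^ R else 1) ?_ b.cnt 0 (s, fun _ => false) ?_
  · rw [zero_add] at key
    refine key.trans (le_of_eq ?_)
    rw [Finset.sum_congr rfl (g := fun _ => (1 / 16 : ℝ≥0∞) ^ R) (fun i hi => by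
      simp [Finset.mem_range.1 hi])]
    simp
  · intro j s hs
    by_cases hj : j < b.cnt
    · rw [if_pos hj]
      refine le_trans ?_ (pr_reps_unseen_le (R := R) (h j hj) (s.1, fun _ => false))
      by_cases hs1 : s.1 = true
      · rw [pr_eq_zero]
        · exact bot_le
        · intro s' hs' hn
          exact hn (Or.inl (blockStep_support_rejected hs1 hs'))
      · replace hs := hs.resolve_left hs1
        unfold blockStep
        rw [pr_map]
        refine pr_mono fun q hq => ?_
        by_contra hcon
        apply hq
        simp only [Bool.or_eq_true, Bool.and_eq_true]
        by_cases hboth : q.2 false = true ∧ q.2 true = true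
        · exact Or.inl (Or.inr hboth)
        · right
          -- The right value was seen and not both were, so the flag of `true` is the bit itself.
          have hbit : q.2 true = u (τ j) := by
            cases hu : u (τ j)
            · rw [hu] at hcon
              by_contra h2
              exact hboth ⟨by simpa using hcon, by simpa using h2⟩
            · rw [hu] at hcon
              simpa using hcon
          funext i
          rw [hs, hbit]
          unfold fill
          by_cases hi : b.own i = j + 1
          · simp [hi]
          · simp only [hi, if_false]
            by_cases hi2 : 1 ≤ b.own i ∧ b.own i ≤ j
            · rw [if_pos hi2, if_pos (by omega)]
            · rw [if_neg hi2, if_neg (by omega)]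
    · rw [if_neg hj]
      exact pr_le_one _ _
  · right
    funext i
    unfold fill
    rw [if_neg (by omega)]

theorem isJunta_fill {b : Blocks n} (τ : ℕ → Fin n) (hk : b.cnt ≤ k) :
    IsJunta k fun u => f (fill b.own τ b.cnt u) := by
  classical
  refine ⟨(Finset.range b.cnt).image τ, Finset.card_image_le.trans (by simpa using hk), ?_⟩
  intro x y h
  show f _ = f _
  congr 1
  funext i
  unfold fill
  split_ifs with hi
  · exact h _ (Finset.mem_image.2 ⟨_, Finset.mem_range.2 (by omega), rfl⟩)
  · rfl

/-- Dichotomy on the blocks. If some block fails its test with probability above `1/32`, then `R ≥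
32` rounds reject with probability at least `1/2`. Otherwise all blocks are close to dictators, and
farness of `f` from the junta `f ∘ fill` makes the final comparison fail. -/
theorem pr_sampleStep_le [Nonempty (Fin n)] {b : Blocks n} {N : ℕ} (hN : 1 ≤ N) (hk : b.cnt ≤ k)
    (hR : 32 ≤ R) (hkR : (k : ℝ≥0∞) * (1 / 16) ^ R ≤ 2⁻¹)
    (hb : (pr D fun u => f u ≠ f (restr b.own u)) ≤ (2 * N : ℝ≥0∞)⁻¹)
    (hfar : ∀ g ∈ kJunta n k, (N : ℝ≥0∞)⁻¹ ≤ pr D fun u => f u ≠ g u) :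
    pr (sampleStep f D R b false) (fun x => x = false) ≤ 1 - (4 * N : ℝ≥0∞)⁻¹ := by
  classical
  have h0 : (N : ℝ≥0∞) ≠ 0 := by simp; omega
  have ht : (N : ℝ≥0∞) ≠ ∞ := by simp
  have half_le : (2⁻¹ : ℝ≥0∞) ≤ 1 - (4 * N : ℝ≥0∞)⁻¹ := by
    refine ENNReal.le_sub_of_add_le_left (by simp [h0]) ?_
    calc (4 * N : ℝ≥0∞)⁻¹ + 2⁻¹ ≤ 2⁻¹ + 2⁻¹ := by
          gcongr
          calc (2 : ℝ≥0∞) ≤ 4 * 1 := by norm_num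
            _ ≤ 4 * N := by gcongr; exact_mod_cast hN
      _ = 1 := ENNReal.inv_two_add_inv_two
  have hacc : ∀ u, pr ((iter (blockStep f R b u) 0 b.cnt (false, fun _ => false)).map fun s =>
      s.1 || (f s.2 ^^ f (restr b.own u))) (fun x => x = false) ≤
      pr (iter (blockStep f R b u) 0 b.cnt (false, fun _ => false)) (fun s => ¬ s.1) := by
    intro u
    rw [pr_map]
    exact pr_mono fun s hs => by simp at hs; simp [hs.1]
  by_cases hbad : ∃ ℓ < b.cnt, (1 / 32 : ℝ≥0∞) < ex (unif (Cube n)) fun r =>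
      ex (unif (Cube n)) fun x => pr (unif (Cube n)) fun y => dictatorFails (probe f b ℓ) r x y
  · obtain ⟨ℓ, hℓ, hbad⟩ := hbad
    refine le_trans ?_ half_le
    unfold sampleStep
    rw [pr_bind]
    refine (ex_mono fun u => (hacc u).trans
      (pr_blocks_not_rejected_le hℓ hbad.le u _)).trans ?_
    rw [ex_const, one_div]
    have := one_sub_inv_pow_le (N := 32) (s := 1) (K := R) (by norm_num) (by omega)
    simpa using this
  · push Not at hbad
    have hτ : ∀ ℓ, ∃ τ : Fin n, ℓ < b.cnt → ∀ u, pr (unif (Cube n)) (fun r =>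
        (probe f b ℓ r ^^ probe f b ℓ (symmDiff r u)) ≠ u τ) ≤ 1 / 16 := by
      intro ℓ
      by_cases hℓ : ℓ < b.cnt
      · obtain ⟨G, hG, h1, h2, h3⟩ := exists_hom (hbad ℓ hℓ)
        obtain ⟨τ, hτ⟩ := exists_coordinate h1 h2 h3
        exact ⟨τ, fun _ u => hτ u ▸ hG u⟩
      -- A default coordinate for block numbers that do not occur.
      · exact ⟨Classical.arbitrary _, fun h => absurd h hℓ⟩
    choose τ hτ using hτ
    set A : Cube n → Prop := fun u => f (fill b.own τ b.cnt u) ≠ f (restr b.own u) with hA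
    -- Triangle inequality: `f` is `1/N`-far from the junta `f ∘ fill` but within `1/(2N)` of `f ∘
    -- restr`, so the two compositions differ on at least `1/(2N)` of the mass.
    have hPA : (2 * N : ℝ≥0∞)⁻¹ ≤ pr D A := by
      have h1 := hfar _ (isJunta_fill (f := f) (b := b) τ hk)
      have h2 : (pr D fun u => f u ≠ f (fill b.own τ b.cnt u)) ≤
          (pr D fun u => f u ≠ f (restr b.own u)) + pr D A := by
        refine le_trans (pr_mono fun u hu => ?_) (pr_or_le _ _ _)
        by_contra! h
        exact hu (h.1.trans (not_not.1 h.2).symm)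
      have h3 : (N : ℝ≥0∞)⁻¹ = (2 * N : ℝ≥0∞)⁻¹ + (2 * N : ℝ≥0∞)⁻¹ := by
        rw [ENNReal.mul_inv (by simp) (by simp), ← add_mul, ENNReal.inv_two_add_inv_two, one_mul]
      have h4 : (2 * N : ℝ≥0∞)⁻¹ + (2 * N : ℝ≥0∞)⁻¹ ≤ (2 * N : ℝ≥0∞)⁻¹ + pr D A := by
        rw [← h3]
        exact h1.trans (h2.trans (by gcongr))
      exact (ENNReal.add_le_add_iff_left (by simp [h0])).1 h4
    unfold sampleStep
    rw [pr_bind]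
    -- On `A` acceptance requires a wrong bit in some block, which has probability at most `k ·
    -- 16^{-R} ≤ 1/2`; off `A` nothing is claimed.
    have h5 : ∀ u, pr ((iter (blockStep f R b u) 0 b.cnt (false, fun _ => false)).map fun s =>
        s.1 || (f s.2 ^^ f (restr b.own u))) (fun x => x = false) ≤
        ind (¬ A u) + 2⁻¹ * ind (A u) := by
      intro u
      by_cases hu : A u
      · simp only [ind, hu, not_true, if_false, if_true, mul_one, zero_add]
        rw [pr_map]
        calc _ ≤ pr (iter (blockStep f R b u) 0 b.cnt (false, fun _ => false))
              (fun s => ¬ (s.1 = true ∨ s.2 = fill b.own τ b.cnt u)) := by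
              refine pr_mono fun s hs => ?_
              rintro (h | h)
              · simp [h] at hs
              · rw [h] at hs
                simp only [Bool.or_eq_false_iff] at hs
                apply hu
                revert hs
                cases f (fill b.own τ b.cnt u) <;> cases f (restr b.own u) <;> simp
          _ ≤ b.cnt * (1 / 16) ^ R := pr_blocks_wrong_le (fun ℓ hℓ => hτ ℓ hℓ u) false
          _ ≤ k * (1 / 16) ^ R := by gcongr
          _ ≤ 2⁻¹ := hkR
      · simp only [ind, hu, not_false_iff, if_true, if_false, mul_zero, add_zero]
        exact pr_le_one _ _
    refine (ex_mono h5).trans ?_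
    rw [ex_add, ex_mul_left]
    change pr D (fun u => ¬ A u) + 2⁻¹ * pr D A ≤ _
    refine ENNReal.le_sub_of_add_le_left (by simp [h0]) ?_
    calc (4 * N : ℝ≥0∞)⁻¹ + (pr D (fun u => ¬ A u) + 2⁻¹ * pr D A)
        ≤ 2⁻¹ * pr D A + (pr D (fun u => ¬ A u) + 2⁻¹ * pr D A) := by
          gcongr
          calc (4 * N : ℝ≥0∞)⁻¹ = 2⁻¹ * (2 * N : ℝ≥0∞)⁻¹ := by
                rw [← ENNReal.mul_inv (by simp) (by simp), ← mul_assoc]; norm_num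
            _ ≤ 2⁻¹ * pr D A := by gcongr
      _ = (2⁻¹ + 2⁻¹) * pr D A + pr D (fun u => ¬ A u) := by ring
      _ = 1 := by rw [ENNReal.inv_two_add_inv_two, one_mul]; exact pr_add_pr_not D A

theorem pr_verify_le [Nonempty (Fin n)] {b : Blocks n} {N t : ℕ} (hN : 1 ≤ N) (hk : b.cnt ≤ k)
    (hR : 32 ≤ R) (hkR : (k : ℝ≥0∞) * (1 / 16) ^ R ≤ 2⁻¹) (hM : 4 * N * t ≤ M)
    (hb : (pr D fun u => f u ≠ f (restr b.own u)) ≤ (2 * N : ℝ≥0∞)⁻¹)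
    (hfar : ∀ g ∈ kJunta n k, (N : ℝ≥0∞)⁻¹ ≤ pr D fun u => f u ≠ g u) :
    pr (verify f D R M k b) (fun x => x = false) ≤ 2⁻¹ ^ t := by
  refine le_trans (pr_iter_le_pow (c := 1 - (4 * N : ℝ≥0∞)⁻¹) ?_ ?_ M 0 _) ?_
  · rintro _ x rfl
    exact pr_sampleStep_le hN hk hR hkR hb hfar
  · intro _ x hx x' hx'
    have hx : x = true := by simpa using hx
    subst hx
    simp [sampleStep_support_rejected hx']
  · have := one_sub_inv_pow_le (N := 4 * N) (s := t) (K := M) (by omega) hM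
    simpa using this

theorem verify_of_lt {b : Blocks n} (hk : k < b.cnt) :
    pr (verify f D R M k b) (fun x => x = false) = 0 := by
  refine pr_eq_zero fun x hx => ?_
  have : x = true := iter_support (I := fun _ x => x = true) (fun i x _ hx x' hx' => by
    subst hx; exact sampleStep_support_rejected hx') (by simpa using hk) x hx
  simp [this]

/-- The estimate is uniform in the labels. For a fixed labelling, acceptance needs either a failed
search, of probability at most `(k+1) 2^{-t} ≤ 1/16`, or `M` accepting samples, of probability at
most `2^{-t} ≤ 1/16`; more than `k` blocks are rejected outright. -/
theorem process_sound [Nonempty (Fin n)] {N t : ℕ} (hN : 1 ≤ N) (ht : 4 ≤ t)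
    (hkt : 16 * (k + 1) ≤ 2 ^ t) (hR : R = 8 * t) (hM : M = 4 * N * t)
    (hfar : ∀ g ∈ kJunta n k, (N : ℝ≥0∞)⁻¹ ≤ pr D fun u => f u ≠ g u) :
    pr (process f D L R M k) (fun x => x = false) ≤ 1 / 3 := by
  have e16 : (k + 1 : ℝ≥0∞) * 2⁻¹ ^ t ≤ 1 / 16 := by
    rw [ENNReal.le_div_iff_mul_le (by simp) (by simp), mul_right_comm, ← ENNReal.inv_pow]
    rw [← div_eq_mul_inv]
    refine ENNReal.div_le_of_le_mul ?_
    rw [one_mul, mul_comm]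
    exact_mod_cast hkt
  have h1 : (2⁻¹ : ℝ≥0∞) ^ t ≤ 1 / 16 := by
    refine le_trans ?_ e16
    calc (2⁻¹ : ℝ≥0∞) ^ t = 1 * 2⁻¹ ^ t := (one_mul _).symm
      _ ≤ (k + 1) * 2⁻¹ ^ t := by gcongr; exact le_add_self
  have hkR : (k : ℝ≥0∞) * (1 / 16) ^ R ≤ 2⁻¹ := by
    calc (k : ℝ≥0∞) * (1 / 16) ^ R ≤ (k + 1) * 2⁻¹ ^ t := by
          refine mul_le_mul' le_self_add ?_
          calc (1 / 16 : ℝ≥0∞) ^ R ≤ 2⁻¹ ^ R := by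
                gcongr
                rw [one_div]; gcongr; norm_num
            _ ≤ 2⁻¹ ^ t := pow_le_pow_right_of_le_one' (by simp) (by omega)
      _ ≤ 1 / 16 := e16
      _ ≤ 2⁻¹ := by rw [one_div]; gcongr; norm_num
  unfold process
  rw [pr_bind]
  refine (ex_mono fun lab => ?_).trans (ex_const (labels n L) (1 / 3)).le
  rw [pr_bind]
  have key : (ex (search f D lab L M k) fun b => pr (verify f D R M k b) fun x => x = false) ≤
      pr (search f D lab L M k) (fun s => s.cnt ≤ k ∧ ((2 * N : ℕ) : ℝ≥0∞)⁻¹ <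
        pr D fun u => f u ≠ f (restr s.own u)) + 2⁻¹ ^ t := by
    refine ex_le_pr_add (fun b => pr_le_one _ _) fun b _ hb => ?_
    by_cases hk : b.cnt ≤ k
    · exact pr_verify_le hN hk (by omega) hkR hM.ge (by
        have : ¬ _ := fun h => hb ⟨hk, h⟩
        simpa using this) hfar
    · rw [verify_of_lt (by omega)]
      exact bot_le
  refine key.trans ?_
  have h2 : pr (search f D lab L M k) (fun s => s.cnt ≤ k ∧ ((2 * N : ℕ) : ℝ≥0∞)⁻¹ <
        pr D fun u => f u ≠ f (restr s.own u)) ≤ 1 / 16 := by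
    refine (pr_search_le _).trans (le_trans ?_ e16)
    refine mul_le_mul' le_rfl (one_sub_inv_pow_le (by omega) ?_)
    rw [hM]; gcongr; omega
  calc _ ≤ (1 / 16 + 1 / 16 : ℝ≥0∞) := add_le_add h2 h1
    _ ≤ 1 / 3 := by
      rw [← ENNReal.toReal_le_toReal (by simp) (by simp), ENNReal.toReal_add (by simp) (by simp)]
      norm_num

end IdealTester

end JuntaTesting

/-! ### Completeness: juntas with distinct labels are never rejected. -/

namespace JuntaTesting

open scoped ENNReal

section Completeness

variable {n : ℕ} {f : Cube n → Bool} {D : PMF (Cube n)} {lab : ℕ → ℕ} {L R M k : ℕ}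

/-! ### Random labels -/

/-- With `N` digits still to be drawn, the prefix `c` can lead to `v` only if it is the leading part
of `v`, and then through exactly one continuation. -/
theorem pr_coins_from_le (N j c v : ℕ) :
    pr (iter (fun _ c => (unif Bool).map fun r => c + c + r.toNat) j N c) (fun c' => c' = v) ≤
      if v / 2 ^ N = c then 2⁻¹ ^ N else 0 := by
  induction N generalizing j c with
  | zero =>
    simp only [iter, pr_pure, ind, pow_zero, Nat.div_one]
    split_ifs <;> simp_all
  | succ N ih =>
    rw [iter, pr_bind, ex_map]
    refine (ex_mono fun r => ih (j + 1) _).trans ?_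
    have e : v / 2 ^ (N + 1) = v / 2 ^ N / 2 := by rw [pow_succ, Nat.div_div_eq_div_mul]
    rw [e]
    generalize v / 2 ^ N = w
    unfold ex
    rw [tsum_fintype]
    simp only [Fintype.univ_bool, Finset.mem_singleton, Bool.true_eq_false, not_false_eq_true,
      Finset.sum_insert, Finset.sum_singleton, PMF.uniformOfFintype_apply, Fintype.card_bool,
      Bool.toNat_true, Bool.toNat_false, add_zero]
    by_cases h1 : w = c + c + 1
    · rw [if_pos h1, if_neg (by omega), if_pos (by omega)]
      simp [pow_succ, mul_comm]
    · by_cases h2 : w = c + c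
      · rw [if_neg h1, if_pos h2, if_pos (by omega)]
        simp [pow_succ, mul_comm]
      · rw [if_neg h1, if_neg h2]
        simp

theorem pr_coins_le (v : ℕ) : pr (coins L) (fun c => c = v) ≤ 2⁻¹ ^ L := by
  refine (pr_coins_from_le L 0 0 v).trans ?_
  split_ifs <;> simp

theorem coins_lt {c : ℕ} (h : c ∈ (coins L).support) : c < 2 ^ L := by
  have := iter_support (I := fun j c => c < 2 ^ j) (j := 0) (N := L) (fun i c _ hc c' hc' => by
    rw [PMF.mem_support_map_iff] at hc'
    obtain ⟨r, -, rfl⟩ := hc'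
    rw [pow_succ]
    cases r <;> simp <;> omega) (s := 0) (by simp) c h
  simpa using this

theorem labels_lt {lab : ℕ → ℕ} (h : lab ∈ (labels n L).support) (i : ℕ) : lab i < 2 ^ L := by
  refine iter_support (I := fun _ lab => ∀ i, lab i < 2 ^ L) ?_ (fun i => by simp) lab h i
  intro j lab _ hlab lab' hlab' i
  rw [PMF.mem_support_map_iff] at hlab'
  obtain ⟨c, hc, rfl⟩ := hlab'
  by_cases hi : i = j
  · subst hi; simpa using coins_lt hc
  · simpa [hi] using hlab i

theorem pr_exists_eq_le (T : Finset ℕ) (μ : PMF ℕ) (g : ℕ → ℕ) {c : ℝ≥0∞}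
    (h : ∀ v, pr μ (fun x => x = v) ≤ c) : pr μ (fun x => ∃ a ∈ T, x = g a) ≤ T.card * c := by
  classical
  induction T using Finset.induction_on with
  | empty => rw [pr_eq_zero]; · exact bot_le
             · simp
  | insert a T ha ih =>
    rw [Finset.card_insert_of_notMem ha]
    calc _ ≤ pr μ (fun x => x = g a ∨ ∃ a ∈ T, x = g a) := by
          refine pr_mono fun x hx => ?_
          simpa using hx
      _ ≤ c + T.card * c := (pr_or_le _ _ _).trans (add_le_add (h _) ih)
      _ = _ := by push_cast; ring

/-- The coordinates in a small set get distinct labels. -/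
theorem pr_labels_not_injOn_le (T : Finset ℕ) :
    pr (labels n L) (fun lab => ¬ ∀ a ∈ T, ∀ b ∈ T, a < n → b < n → lab a = lab b → a = b) ≤
      T.card * (T.card * 2⁻¹ ^ L) := by
  classical
  -- The invariant concerns only the members of `T` labelled so far. Labelling one more member
  -- creates a collision with probability at most `|T| · 2^{-L}`, and other coordinates are
  -- harmless.
  have key := pr_iter_le (F := fun j lab => (coins L).map fun c => Function.update lab j c)
    (I := fun j lab => ∀ a ∈ T, ∀ b ∈ T, a < j → b < j → lab a = lab b → a = b)
    (δ := fun j => if j ∈ T then T.card * 2⁻¹ ^ L else 0) ?_ n 0 (fun _ => 0) (by simp)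
  · rw [zero_add] at key
    refine key.trans ?_
    simp only [zero_add]
    rw [Finset.sum_ite_mem, Finset.sum_const, nsmul_eq_mul]
    gcongr
    exact Finset.inter_subset_right
  · intro j lab hlab
    rw [pr_map]
    by_cases hj : j ∈ T
    · rw [if_pos hj]
      refine le_trans (pr_mono fun c hc => ?_) (pr_exists_eq_le T (coins L) lab pr_coins_le)
      by_contra! hne
      apply hc
      intro a ha b hb haj hbj hab
      by_cases h1 : a = j
      · by_cases h2 : b = j
        · rw [h1, h2]
        · subst h1
          simp only [Function.update_self, Function.update_of_ne h2] at hab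
          exact absurd hab (hne b hb)
      · by_cases h2 : b = j
        · subst h2
          simp only [Function.update_self, Function.update_of_ne h1] at hab
          exact absurd hab.symm (hne a ha)
        · simp only [Function.update_of_ne h1, Function.update_of_ne h2] at hab
          exact hlab a ha b hb (by omega) (by omega) hab
    · rw [if_neg hj, pr_eq_zero]
      intro c _ hc
      apply hc
      intro a ha b hb haj hbj hab
      have h1 : a ≠ j := fun h => hj (h ▸ ha)
      have h2 : b ≠ j := fun h => hj (h ▸ hb)
      simp only [Function.update_of_ne h1, Function.update_of_ne h2] at hab
      exact hlab a ha b hb (by omega) (by omega) hab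

/-! ### Search -/

/-- No monotonicity of `p` is needed: the interval always has `p` true at its left end and false at
its right end. -/
theorem bisect_spec {p : ℕ → Bool} (j : ℕ) : ∀ {lo : ℕ}, p lo = true → p (lo + 2 ^ j) = false →
    p (bisect p lo j) = true ∧ p (bisect p lo j + 1) = false := by
  induction j with
  | zero => intro lo h1 h2; exact ⟨h1, by simpa [bisect] using h2⟩
  | succ j ih =>
    intro lo h1 h2
    rw [bisect]
    by_cases h : p (lo + 2 ^ j) = true
    · rw [if_pos h]
      refine ih h ?_
      rw [← h2]; congr 1; ring
    · rw [if_neg h]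
      exact ih h1 (by simpa using h)

theorem cut_zero (own : Fin n → ℕ) (u : Cube n) : cut own lab u 0 = restr own u := by
  funext i; simp [cut, restr]

/-- The thresholds `0` and `2^L` give `restr own u` and `u`, on which `f` differs; the second uses
that all labels are below `2^L`. So the binary search ends at a jump between consecutive hybrids. -/
theorem newLabel_spec {own : Fin n → ℕ} {u : Cube n} (hlab : ∀ i, lab i < 2 ^ L)
    (h : (f u ^^ f (restr own u)) = true) :
    f (cut own lab u (newLabel f lab L own u)) ≠ f (cut own lab u (newLabel f lab L own u + 1)) := by
  have h1 := bisect_spec (p := fun mid => f u ^^ f (cut own lab u mid)) L (lo := 0)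
    (by simpa only [cut_zero] using h) (by
      have : cut own lab u (0 + 2 ^ L) = u := by
        funext i; simp [cut, hlab]
      simp only [this, Bool.xor_self])
  change (f u ^^ f (cut own lab u (newLabel f lab L own u))) = true ∧
    (f u ^^ f (cut own lab u (newLabel f lab L own u + 1))) = false at h1
  revert h1
  cases f u <;> cases f (cut own lab u (newLabel f lab L own u)) <;>
    cases f (cut own lab u (newLabel f lab L own u + 1)) <;> simp

/-- What the search guarantees. -/
structure Found (f : Cube n → Bool) (lab : ℕ → ℕ) (s : Blocks n) : Prop where
  lab_eq : ∀ i i', s.own i = s.own i' → s.own i ≠ 0 → lab i = lab i'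
  own_le : ∀ i, s.own i ≤ s.cnt
  relevant : ∀ ℓ < s.cnt, f (s.wit ℓ) ≠ f fun i => if s.own i = ℓ + 1 then false else s.wit ℓ i

theorem Found.extend (hlab : ∀ i, lab i < 2 ^ L) {s : Blocks n} (hs : Found f lab s) {u : Cube n}
    (hu : (f u ^^ f (restr s.own u)) = true) : Found f lab (extend f lab L s u) := by
  have h := newLabel_spec (L := L) hlab hu
  unfold JuntaTesting.extend
  generalize newLabel f lab L s.own u = lo at h
  refine ⟨?_, ?_, ?_⟩
  · intro i i'
    have h1 := hs.own_le i
    have h2 := hs.own_le i'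
    have h3 := hs.lab_eq i i'
    dsimp only
    split_ifs with h4 h5 h5
    · intros; rw [h4.2, h5.2]
    · intros; omega
    · intros; omega
    · exact h3
  · intro i
    have h1 := hs.own_le i
    dsimp only
    split_ifs <;> omega
  · intro ℓ hℓ
    dsimp only at hℓ ⊢
    by_cases hc : ℓ = s.cnt
    · subst hc
      simp only [Function.update_self]
      -- Erasing the new block from the hybrid at threshold `lo + 1` leaves the hybrid at threshold
      -- `lo`.
      refine Ne.symm (ne_of_eq_of_ne ?_ h)
      congr 1
      funext i
      have h1 := hs.own_le i
      unfold cut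
      by_cases h2 : s.own i = 0
      · by_cases h3 : lab i = lo
        · simp [h2, h3]
        · have : lab i < lo + 1 ↔ lab i < lo := by omega
          simp [h2, h3, this]
      · have : s.own i ≠ s.cnt + 1 := by omega
        simp [h2, this]
    -- An older block keeps its coordinates: only unowned ones change owner, and they receive the
    -- number `s.cnt + 1`.
    · have hℓ' : ℓ < s.cnt := by omega
      simp only [Function.update_of_ne hc]
      convert hs.relevant ℓ hℓ' using 3
      rename_i i
      by_cases h2 : s.own i = 0 ∧ lab i = lo
      · rw [if_pos h2, if_neg (by omega), if_neg (by omega)]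
      · rw [if_neg h2]

theorem found_of_search (hlab : ∀ i, lab i < 2 ^ L) {s : Blocks n}
    (h : s ∈ (search f D lab L M k).support) : Found f lab s := by
  refine iter_support (I := fun _ s => Found f lab s) ?_ ⟨by simp, by simp, by simp⟩ s h
  intro j s _ hs s' hs'
  refine iter_support (I := fun _ s => Found f lab s) ?_ hs s' hs'
  intro _ s _ hs s' hs'
  rcases tryStep_support hs' with rfl | ⟨-, u, hu, rfl⟩
  · exact hs
  · exact hs.extend hlab hu

/-! ### Verification of juntas -/

section Junta

variable {S : Finset (Fin n)} (hf : ∀ x y : Cube n, (∀ i ∈ S, x i = y i) → f x = f y)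
  (hinj : ∀ i ∈ S, ∀ i' ∈ S, lab i = lab i' → i = i') {b : Blocks n} (hb : Found f lab b)

include hf hinj hb

/-- Erasing the block changes `f` at the witness, so the block meets `S`; coordinates of one block
share a label, so by `hinj` it meets `S` only once. Hence `probe` depends on one bit, and it is not
constant since the witness and the zero string give different values. -/
theorem Found.exists_coordinate {ℓ : ℕ} (hℓ : ℓ < b.cnt) :
    ∃ τ ∈ S, b.own τ = ℓ + 1 ∧ (∀ i ∈ S, b.own i = ℓ + 1 → i = τ) ∧
      ∃ c, ∀ z, probe f b ℓ z = (z τ ^^ c) := by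
  have h1 := hb.relevant ℓ hℓ
  have h2 : ∃ τ ∈ S, b.own τ = ℓ + 1 := by
    by_contra! hcon
    exact h1 (hf _ _ fun i hi => by rw [if_neg (hcon i hi)])
  obtain ⟨τ, hτS, hτ⟩ := h2
  have h3 : ∀ i ∈ S, b.own i = ℓ + 1 → i = τ := fun i hi h =>
    hinj i hi τ hτS (hb.lab_eq i τ (h.trans hτ.symm) (by omega))
  have h4 : ∀ z z', z τ = z' τ → probe f b ℓ z = probe f b ℓ z' := by
    intro z z' hz
    refine hf _ _ fun i hi => ?_
    by_cases h : b.own i = ℓ + 1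
    · rw [if_pos h, if_pos h, h3 i hi h, hz]
    · rw [if_neg h, if_neg h]
  have h5 : probe f b ℓ (b.wit ℓ) = f (b.wit ℓ) := by
    unfold probe; congr 1; funext i; simp
  have h6 : probe f b ℓ (fun _ => false) ≠ probe f b ℓ (b.wit ℓ) := by
    rw [h5]; exact h1.symm
  have h7 : b.wit ℓ τ = true := by
    by_contra h
    exact h6 (h4 _ _ (by simpa using h))
  refine ⟨τ, hτS, hτ, h3, probe f b ℓ (fun _ => false), fun z => ?_⟩
  by_cases hz : z τ = true
  · rw [h4 z (b.wit ℓ) (by rw [hz, h7]), hz]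
    revert h6
    cases probe f b ℓ (fun _ => false) <;> cases probe f b ℓ (b.wit ℓ) <;> simp
  · rw [h4 z (fun _ => false) (by simpa using hz)]
    simp [hz]

omit hf hinj hb in
theorem dictatorFails_coordinate {g : Cube n → Bool} {τ : Fin n} {c : Bool}
    (h : ∀ z, g z = (z τ ^^ c)) (r x y : Cube n) : dictatorFails g r x y = false := by
  unfold dictatorFails
  simp only [h, Pi.symmDiff_apply, Pi.inf_apply, Pi.top_apply, Bool.symmDiff_eq_xor,
    Bool.inf_eq_band, show (⊤ : Bool) = true from rfl]
  cases r τ <;> cases x τ <;> cases y τ <;> cases c <;> rfl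

theorem Found.cnt_le : b.cnt ≤ S.card := by
  classical
  have h := fun ℓ : Fin b.cnt => hb.exists_coordinate hf hinj ℓ.2
  choose τ hS hτ _ using h
  rw [← Fintype.card_fin b.cnt, ← Finset.card_univ]
  refine Finset.card_le_card_of_injOn τ (fun ℓ _ => hS ℓ) ?_
  intro ℓ _ ℓ' _ h
  have h1 := hτ ℓ
  have h2 := hτ ℓ'
  rw [h] at h1
  ext
  omega

/-- The derivative of a negated or plain dictator is the dictator itself, at every base point. So
every round reports `u τ`, only one flag is raised, and one round suffices to raise it. Off `S` the
filled block may differ from `u`, which `f` does not notice. -/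
theorem Found.blockStep_support (hR : 0 < R) {u : Cube n} {ℓ : ℕ} (hℓ : ℓ < b.cnt)
    {s s' : Bool × Cube n} (hs : s.1 = false) (h : s' ∈ (blockStep f R b u ℓ s).support) :
    s'.1 = false ∧ ∀ i ∈ S, s'.2 i = if b.own i = ℓ + 1 then u i else s.2 i := by
  obtain ⟨τ, hτS, hτ, huniq, c, hc⟩ := hb.exists_coordinate hf hinj hℓ
  unfold blockStep at h
  rw [PMF.mem_support_map_iff] at h
  obtain ⟨q, hq, rfl⟩ := h
  have key := iter_support (I := fun j (q : Bool × (Bool → Bool)) => q.1 = false ∧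
    q.2 (!(u τ)) = false ∧ (0 < j → q.2 (u τ) = true)) (fun i q _ hq q' hq' => by
      obtain ⟨r, x, y, rfl⟩ := repStep_support hq'
      have e : (probe f b ℓ r ^^ probe f b ℓ (symmDiff r u)) = u τ := by
        rw [hc, hc, Pi.symmDiff_apply, Bool.symmDiff_eq_xor]
        cases r τ <;> cases u τ <;> cases c <;> rfl
      dsimp only
      rw [dictatorFails_coordinate hc, e]
      refine ⟨by simp [hq.1], ?_, by simp⟩
      rw [Function.update_of_ne (by simp)]
      exact hq.2.1) (s := (s.1, fun _ => false)) ⟨hs, rfl, by simp⟩ q hq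
  obtain ⟨h1, h2, h3⟩ := key
  replace h3 := h3 (by omega)
  have h4 : q.2 true = u τ ∧ (q.2 false && q.2 true) = false := by
    cases hu : u τ <;> rw [hu] at h2 h3 <;> simp_all
  refine ⟨by simp [h1, h4.2], fun i hi => ?_⟩
  dsimp only
  by_cases h : b.own i = ℓ + 1
  · rw [if_pos h, if_pos h, h4.1, huniq i hi h]
  · rw [if_neg h, if_neg h]

theorem Found.sampleStep_support (hR : 0 < R) {x : Bool}
    (h : x ∈ (sampleStep f D R b false).support) : x = false := by
  unfold sampleStep at h
  simp only [PMF.mem_support_bind_iff, PMF.mem_support_map_iff] at h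
  obtain ⟨u, -, s, hs, rfl⟩ := h
  have key := iter_support (I := fun j (s : Bool × Cube n) => s.1 = false ∧
    ∀ i ∈ S, s.2 i = if 1 ≤ b.own i ∧ b.own i ≤ j then u i else false)
    (fun ℓ s hℓ hs s' hs' => by
      obtain ⟨h1, h2⟩ := hb.blockStep_support hf hinj hR (by omega) hs.1 hs'
      refine ⟨h1, fun i hi => ?_⟩
      rw [h2 i hi, hs.2 i hi]
      by_cases h : b.own i = ℓ + 1
      · rw [if_pos h, if_pos (by omega)]
      · rw [if_neg h]
        congr 1
        simp only [eq_iff_iff]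
        omega) (s := (false, fun _ => false)) ⟨rfl, fun i _ => by rw [if_neg (by omega)]⟩ s hs
  rw [zero_add] at key
  rw [key.1, hf s.2 (restr b.own u) fun i hi => ?_]
  · simp
  · rw [key.2 i hi, restr]
    have := hb.own_le i
    by_cases h : b.own i = 0
    · simp [h]
    · rw [if_pos (by omega)]
      simp [h]

theorem Found.verify_support (hR : 0 < R) (hk : S.card ≤ k) {x : Bool}
    (h : x ∈ (verify f D R M k b).support) : x = false := by
  refine iter_support (I := fun _ x => x = false) (fun i x _ hx x' hx' => ?_) ?_ x h
  · subst hx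
    exact hb.sampleStep_support hf hinj hR hx'
  · have := hb.cnt_le hf hinj
    simp; omega

end Junta

theorem process_complete {t : ℕ} (hR : 0 < R) (hL : L = 2 * t) (hkt : 16 * (k + 1) ≤ 2 ^ t)
    (hf : f ∈ kJunta n k) : pr (process f D L R M k) (fun x => x = true) ≤ 1 / 3 := by
  classical
  obtain ⟨S, hS, hf⟩ := hf
  set T : Finset ℕ := S.image Fin.val
  have hT : T.card ≤ k := Finset.card_image_le.trans hS
  have h1 := pr_labels_not_injOn_le (n := n) (L := L) T
  have h2 : (T.card * (T.card * 2⁻¹ ^ L) : ℝ≥0∞) ≤ 1 / 3 := by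
    have h3 : (T.card : ℝ≥0∞) * 2⁻¹ ^ t ≤ 1 / 3 := by
      rw [ENNReal.le_div_iff_mul_le (by simp) (by simp), mul_right_comm, ← ENNReal.inv_pow,
        ← div_eq_mul_inv]
      refine ENNReal.div_le_of_le_mul ?_
      rw [one_mul]
      have : T.card * 3 ≤ 2 ^ t := by omega
      exact_mod_cast this
    -- Here `L = 2t` is used: the birthday bound `|T|² 2^{-L}` is the square of `|T| 2^{-t}`.
    calc (T.card * (T.card * 2⁻¹ ^ L) : ℝ≥0∞)
        = (T.card * 2⁻¹ ^ t) * (T.card * 2⁻¹ ^ t) := by rw [hL]; ring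
      _ ≤ (1 / 3) * 1 := by
          gcongr
          exact h3.trans (by rw [one_div]; simp)
      _ = 1 / 3 := mul_one _
  unfold process
  rw [pr_bind]
  have key : (ex (labels n L) fun lab => pr ((search f D lab L M k).bind (verify f D R M k))
      fun x => x = true) ≤ pr (labels n L) (fun lab => ¬ ∀ a ∈ T, ∀ b ∈ T, a < n → b < n →
        lab a = lab b → a = b) + 0 := by
    refine ex_le_pr_add (fun b => pr_le_one _ _) fun lab hlab hT => ?_
    rw [not_not] at hT
    rw [pr_eq_zero]
    intro x hx
    rw [PMF.mem_support_bind_iff] at hx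
    obtain ⟨b, hb, hx⟩ := hx
    rw [(found_of_search (labels_lt hlab) hb).verify_support hf (fun i hi i' hi' h =>
      Fin.ext (hT i (Finset.mem_image_of_mem _ hi) i' (Finset.mem_image_of_mem _ hi') i.2 i'.2 h))
      hR hS hx]
    simp
  rw [add_zero] at key
  exact key.trans (h1.trans h2)

end Completeness

end JuntaTesting

/-! ### Program logic for deterministic code, and string routines. -/

namespace JuntaTesting

open scoped ENNReal

section Routines

variable {n : ℕ} {f : Cube n → Bool} {D : PMF (Cube n)} {S : Set Config}
variable {β γ : Type} {P P' : Program} {m : Memory} {T T₁ T₂ Q Q₁ Q₂ : ℕ} {μ : PMF β}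
  {R : β → Memory → Prop}

/-! ### Deterministic programs -/

/-- `Impl` for a program with a certain outcome. -/
abbrev Det (f : Cube n → Bool) (D : PMF (Cube n)) (S : Set Config) (P : Program) (m : Memory)
    (T Q : ℕ) (R : Memory → Prop) : Prop :=
  Impl f D S P m T Q (PMF.pure ()) fun _ m' => R m'

theorem Impl.then {R' : Memory → Prop} (h : Det f D S P m T₁ Q₁ R')
    (h' : ∀ m', R' m' → Impl f D S P' m' T₂ Q₂ μ R) :
    Impl f D S (.seq P P') m (T₁ + T₂ + 1) (Q₁ + Q₂) μ R := by
  have := Impl.seq h (fun _ _ m' hm' => h' m' hm')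
  rwa [PMF.pure_bind] at this

theorem Impl.assign_then {a : ℕ} {i e : Expr}
    (h : Impl f D S P (m.write a (i.eval m) (e.eval m)) T Q μ R) :
    Impl f D S (.seq (.assign a i e) P) m (T + 2) Q μ R :=
  (Impl.then (R' := fun m' => m' = m.write a (i.eval m) (e.eval m)) (Impl.assign rfl)
    (by rintro _ rfl; exact h)).mono (by omega) (by omega) fun _ _ _ h => h

theorem Impl.memberQuery_then {a b : ℕ} {i : Expr}
    (h : Impl f D S P (m.write a (i.eval m) (f (m.readString n b)).toNat) T Q μ R) :
    Impl f D S (.seq (.memberQuery a i b) P) m (T + 2) (Q + 1) μ R :=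
  (Impl.then (R' := fun m' => m' = m.write a (i.eval m) (f (m.readString n b)).toNat)
    (Impl.memberQuery rfl) (by rintro _ rfl; exact h)).mono (by omega) (by omega)
    fun _ _ _ h => h

theorem Impl.of_det {b : β} {R' : Memory → Prop} (h : Det f D S P m T Q R')
    (hR : ∀ m', R' m' → R b m') : Impl f D S P m T Q (PMF.pure b) R := by
  have := Impl.map (R' := R) (fun _ => b) h (fun _ _ m' hm' => hR m' hm')
  rwa [PMF.pure_map] at this

theorem iter_pure {σ : Type} (j N : ℕ) (s : σ) : iter (fun _ => PMF.pure) j N s = PMF.pure s := by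
  induction N generalizing j with
  | zero => rfl
  | succ N ih => rw [iter, PMF.pure_bind, ih]

theorem Det.forLoop {c N : ℕ} {e : Expr} {I : ℕ → Memory → Prop}
    (hN : ∀ j m, I j m → e.eval m = N)
    (hw : ∀ j m v, I j m → I j (m.write c 0 v))
    (h : ∀ j m, j < N → I j m → m c 0 = j →
      Det f D S P m T Q fun m' => m' c 0 = j ∧ I (j + 1) m')
    (h0 : I 0 m) :
    Det f D S (forLoop c e P) m (N * (T + 3) + 3) (N * Q) fun m' => I N m' := by
  have := Impl.forLoop (f := f) (D := D) (S := S) (P := P) (T := T) (Q := Q) (c := c) (N := N)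
    (e := e) (F := fun _ => PMF.pure) (I := fun j (_ : Unit) m => I j m) (b := ()) (m := m)
    (fun j _ => hN j) (fun j _ => hw j) (fun j _ => h j) h0
  rwa [iter_pure] at this

/-- A loop with an exit after `N` rounds. -/
theorem Det.while {e : Expr} {I : ℕ → Memory → Prop}
    (h : ∀ j m, I (j + 1) m → e.eval m ≠ 0 ∧ Det f D S P m T Q (I j))
    (h0 : ∀ m, I 0 m → e.eval m = 0) (N : ℕ) :
    ∀ m, I N m → Det f D S (.loop e P) m (N * (T + 2) + 1) (N * Q) (I 0) := by
  induction N with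
  | zero =>
    intro m hm
    refine Impl.mono (R := fun _ => I 0) (Impl.loop_exit (h0 m hm) hm) ?_ ?_ fun _ _ _ h => h
    · omega
    · omega
  | succ N ih =>
    intro m hm
    have h1 := h N m hm
    have h2 := Impl.loop_enter h1.1 ((Impl.then h1.2 ih).mono
      (T₂ := T + (N * (T + 2) + 1) + 1) le_rfl le_rfl fun _ _ _ h => h)
    exact h2.mono (by linarith [add_mul N 1 (T + 2)]) (by linarith [add_mul N 1 Q]) fun _ _ _ h => h

/-! ### Memory -/

theorem write_apply (m : Memory) (a i v a' i' : ℕ) :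
    m.write a i v a' i' = if a' = a ∧ i' = i then v else m a' i' := rfl

theorem write_of_ne (m : Memory) {a a' : ℕ} (i v : ℕ) (h : a' ≠ a) : m.write a i v a' = m a' := by
  funext i'; simp [write_apply, h]

theorem writeString_of_ne (m : Memory) {a a' : ℕ} (x : Cube n) (h : a' ≠ a) :
    m.writeString a x a' = m a' := by
  funext i'; simp [Memory.writeString, h]

theorem writeString_self (m : Memory) (a : ℕ) (x : Cube n) (i : Fin n) :
    m.writeString a x a i = (x i).toNat := by
  simp [Memory.writeString]

/-- The array `a` holds the string `x`. -/
def Holds (m : Memory) (a : ℕ) (x : Cube n) : Prop := ∀ i : Fin n, m a i = (x i).toNat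

theorem Holds.readString {a : ℕ} {x : Cube n} (h : Holds m a x) : m.readString n a = x := by
  funext i
  simp only [Memory.readString, h i]
  cases x i <;> rfl

theorem Holds.congr {m' : Memory} {a : ℕ} {x : Cube n} (h : Holds m a x) (e : m' a = m a) :
    Holds m' a x := fun i => by rw [e]; exact h i

/-- The memories agree on all arrays that are not listed. -/
def Off (A : List ℕ) (m m' : Memory) : Prop := ∀ a, a ∉ A → m' a = m a

theorem Off.refl (A : List ℕ) (m : Memory) : Off A m m := fun _ _ => rfl

theorem Off.trans {A B C : List ℕ} {m₁ m₂ m₃ : Memory} (h : Off A m₁ m₂) (h' : Off B m₂ m₃)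
    (hA : A ⊆ C) (hB : B ⊆ C) : Off C m₁ m₃ := fun a ha =>
  (h' a fun h => ha (hB h)).trans (h a fun h => ha (hA h))

theorem Off.write {A : List ℕ} {m₁ m₂ : Memory} (h : Off A m₁ m₂) {a : ℕ} (ha : a ∈ A)
    (i v : ℕ) : Off A m₁ (m₂.write a i v) := fun a' ha' => by
  rw [write_of_ne _ _ _ (by rintro rfl; exact ha' ha)]
  exact h a' ha'

theorem Off.mono {A B : List ℕ} {m₁ m₂ : Memory} (h : Off A m₁ m₂) (hA : A ⊆ B) : Off B m₁ m₂ :=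
  fun a ha => h a fun h => ha (hA h)

/-! ### String routines -/

/-- The current entry of the array `a` in a string routine. -/
abbrev el (a : ℕ) : Expr := .get a (var 2)

/-- The exclusive or of two bits, and the distance of two numbers. -/
def dist (e₁ e₂ : Expr) : Expr := .add (.sub e₁ e₂) (.sub e₂ e₁)

theorem eval_dist_eq_zero {e₁ e₂ : Expr} : (dist e₁ e₂).eval m = 0 ↔ e₁.eval m = e₂.eval m := by
  simp only [dist, Expr.eval]; omega

theorem eval_dist_bool {e₁ e₂ : Expr} {b₁ b₂ : Bool} (h₁ : e₁.eval m = b₁.toNat)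
    (h₂ : e₂.eval m = b₂.toNat) : (dist e₁ e₂).eval m = (b₁ ^^ b₂).toNat := by
  simp only [dist, Expr.eval, h₁, h₂]
  cases b₁ <;> cases b₂ <;> rfl

/-- `for i := 0, …, n - 1 do a[off + i] := if c ≠ 0 then e₁ else e₂`. -/
def strMap (a : ℕ) (off c e₁ e₂ : Expr) : Program :=
  forLoop 2 (var 0) (.branch c (.assign a (.add off (var 2)) e₁) (.assign a (.add off (var 2)) e₂))

/-- The expressions may read the array being written, provided that they read entries not yet
overwritten; `h` supplies exactly that information about the intermediate memory. -/
theorem det_strMap {a B : ℕ} {off c e₁ e₂ : Expr} {g : ℕ → ℕ} (ha : a ≠ 0) (ha2 : a ≠ 2)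
    (hn : m 0 0 = n)
    (h : ∀ i < n, ∀ m', Off [a, 2] m m' → m' 2 0 = i →
      (∀ j, ¬ (B ≤ j ∧ j < B + i) → m' a j = m a j) → off.eval m' = B ∧
        (if c.eval m' ≠ 0 then e₁.eval m' else e₂.eval m') = g i) :
    Det f D S (strMap a off c e₁ e₂) m (n * 5 + 3) 0 fun m' =>
      Off [a, 2] m m' ∧ ∀ j, m' a j = if B ≤ j ∧ j < B + n then g (j - B) else m a j := by
  refine (Det.forLoop (T := 2) (Q := 0) (N := n) (I := fun i m' => Off [a, 2] m m' ∧
    ∀ j, m' a j = if B ≤ j ∧ j < B + i then g (j - B) else m a j) ?_ ?_ ?_ ?_).mono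
    (by omega) (by omega) fun _ _ _ h => h
  · rintro j m' ⟨h1, -⟩
    simp [Expr.eval, h1 0 (by simp [ha.symm]), hn]
  · rintro j m' v ⟨h1, h2⟩
    exact ⟨h1.write (by simp) _ _, by rwa [write_of_ne _ _ _ ha2]⟩
  · rintro i m' hi ⟨h1, h2⟩ h3
    obtain ⟨h4, h5⟩ := h i hi m' h1 h3 fun j hj => by rw [h2, if_neg hj]
    have key : ∀ v, v = g i → ∀ m'', m'' = m'.write a (B + i) v → m'' 2 0 = i ∧
        Off [a, 2] m m'' ∧
        ∀ j, m'' a j = if B ≤ j ∧ j < B + (i + 1) then g (j - B) else m a j := by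
      rintro v rfl m'' rfl
      refine ⟨by rw [write_of_ne _ _ _ ha2.symm, h3], h1.write (by simp) _ _, fun j => ?_⟩
      rw [write_apply, h2]
      by_cases hj : j = B + i
      · subst hj
        rw [if_pos ⟨rfl, rfl⟩, if_pos (by omega)]
        congr 1; omega
      · rw [if_neg (by tauto)]
        by_cases hj2 : B ≤ j ∧ j < B + i
        · rw [if_pos hj2, if_pos (by omega)]
        · rw [if_neg hj2, if_neg (by omega)]
    refine Impl.branch (T := 1) (fun hc => ?_) (fun hc => ?_)
    · rw [if_pos hc] at h5
      exact Impl.assign (key _ h5 _ (by simp [Expr.eval, h4, h3]))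
    · rw [if_neg (by simpa using hc)] at h5
      exact Impl.assign (key _ h5 _ (by simp [Expr.eval, h4, h3]))
  · exact ⟨Off.refl _ _, fun j => by rw [if_neg (by omega)]⟩

/-- The special case of `det_strMap` in which a string is stored from the entry `0` on. -/
theorem det_strMap_holds {a : ℕ} {c e₁ e₂ : Expr} {x : Cube n} (ha : a ≠ 0) (ha2 : a ≠ 2)
    (hn : m 0 0 = n)
    (h : ∀ i : Fin n, ∀ m', Off [a, 2] m m' → m' 2 0 = i → m' a i = m a i →
        (if c.eval m' ≠ 0 then e₁.eval m' else e₂.eval m') = (x i).toNat) :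
    Det f D S (strMap a (.lit 0) c e₁ e₂) m (n * 5 + 3) 0 fun m' =>
      Off [a, 2] m m' ∧ Holds m' a x := by
  refine (det_strMap (B := 0) (g := fun i => if hi : i < n then (x ⟨i, hi⟩).toNat else 0) ha ha2 hn
    ?_).mono le_rfl le_rfl ?_
  · intro i hi m' h1 h2 h3
    refine ⟨rfl, ?_⟩
    rw [dif_pos hi]
    exact h ⟨i, hi⟩ m' h1 h2 (h3 i (by omega))
  · rintro _ - m' ⟨h1, h2⟩
    refine ⟨h1, fun i => ?_⟩
    rw [h2, if_pos (by omega)]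
    simp

/-- `for i := 0, …, n - 1 do a[i] :=` a random bit. -/
def randStr (a : ℕ) : Program := forLoop 2 (var 0) (.coin a (var 2))

/-- From stage `j` on, the coordinates below `j` are frozen and the other `N` are independent fair
bits. For `j = 0` this is the uniform distribution on the cube. -/
theorem iter_update_apply (N j : ℕ) (hj : j + N = n) (s x : Cube n) :
    iter (fun j s => (unif Bool).map fun r => fun i : Fin n => if i.1 = j then r else s i) j N s x =
      if ∀ i : Fin n, i.1 < j → x i = s i then 2⁻¹ ^ N else 0 := by
  induction N generalizing j s with
  | zero =>
    rw [iter, PMF.pure_apply]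
    have : x = s ↔ ∀ i : Fin n, i.1 < j → x i = s i := by
      constructor
      · rintro rfl; simp
      · intro h; funext i; exact h i (by omega)
    simp only [this, pow_zero]
  | succ N ih =>
    rw [iter, PMF.map, PMF.bind_bind, PMF.bind_apply, tsum_fintype]
    simp only [Function.comp_apply, PMF.pure_bind, ih (j + 1) (by omega)]
    have hjn : j < n := by omega
    have e : ∀ r : Bool, (∀ i : Fin n, i.1 < j + 1 → x i = if i.1 = j then r else s i) ↔
        (∀ i : Fin n, i.1 < j → x i = s i) ∧ x ⟨j, hjn⟩ = r := by
      intro r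
      constructor
      · intro h
        refine ⟨fun i hi => ?_, ?_⟩
        · rw [h i (by omega), if_neg (by omega)]
        · rw [h ⟨j, hjn⟩ (by simp), if_pos rfl]
      · rintro ⟨h1, h2⟩ i hi
        by_cases hij : i.1 = j
        · rw [if_pos hij, ← h2]; congr 1; exact Fin.ext hij
        · rw [if_neg hij]; exact h1 i (by omega)
    simp only [e, Fintype.univ_bool, Finset.mem_singleton, Bool.true_eq_false, not_false_eq_true,
      Finset.sum_insert, Finset.sum_singleton, PMF.uniformOfFintype_apply, Fintype.card_bool]
    by_cases h : ∀ i : Fin n, i.1 < j → x i = s i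
    · cases hx : x ⟨j, hjn⟩ <;> simp [pow_succ, mul_comm]
    · simp [h]

theorem impl_randStr {a : ℕ} (ha : a ≠ 0) (ha2 : a ≠ 2) (hn : m 0 0 = n) :
    Impl f D S (randStr a) m (n * 4 + 3) 0 (unif (Cube n)) fun x m' =>
      Off [a, 2] m m' ∧ Holds m' a x := by
  have h := Impl.forLoop (f := f) (D := D) (S := S) (P := .coin a (var 2)) (T := 1) (Q := 0)
    (c := 2) (N := n) (e := var 0) (b := fun _ => false) (m := m)
    (F := fun j (s : Cube n) => (unif Bool).map fun r => fun i : Fin n => if i.1 = j then r else s i)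
    (I := fun j s m' => Off [a, 2] m m' ∧ ∀ i : Fin n, i.1 < j → m' a i = (s i).toNat)
    ?_ ?_ ?_ ⟨Off.refl _ _, by simp⟩
  · have e : iter (fun j (s : Cube n) => (unif Bool).map fun r => fun i : Fin n =>
        if i.1 = j then r else s i) 0 n (fun _ => false) = unif (Cube n) := by
      ext x
      rw [iter_update_apply n 0 (by omega)]
      simp [ENNReal.inv_pow]
    rw [e] at h
    refine h.mono (by omega) (by omega) ?_
    rintro x - m' ⟨h1, h2⟩
    exact ⟨h1, fun i => h2 i i.2⟩
  · rintro j s m' ⟨h1, -⟩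
    simp [Expr.eval, h1 0 (by simp [ha.symm]), hn]
  · rintro j s m' v ⟨h1, h2⟩
    exact ⟨h1.write (by simp) _ _, by rwa [write_of_ne _ _ _ ha2]⟩
  · rintro j s m' hj ⟨h1, h2⟩ h3
    refine Impl.map _ (Impl.coin (R := fun r m'' => m'' = m'.write a j r.toNat)
      fun r => by simp [Expr.eval, h3]) ?_
    rintro r - m'' rfl
    refine ⟨by rw [write_of_ne _ _ _ ha2.symm, h3], h1.write (by simp) _ _, fun i hi => ?_⟩
    rw [write_apply]
    by_cases hij : i.1 = j
    · simp [hij]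
    · simp only [hij, and_false, if_false]
      exact h2 i (by omega)

end Routines

end JuntaTesting

/-! ### Implementation of the search for blocks. -/

namespace JuntaTesting

open scoped ENNReal

/-- The memory holds the parameters and the labels. -/
structure Env (n k L R M : ℕ) (lab : ℕ → ℕ) (m : Memory) : Prop where
  n_eq : m 0 0 = n
  k_eq : m 0 1 = k
  L_eq : m 5 0 = L
  H_eq : m 6 0 = 2 ^ L
  R_eq : m 7 0 = R
  M_eq : m 8 0 = M
  lab_eq : ∀ i < n, m 10 i = lab i

/-- The memory holds the blocks. -/
structure Rep {n : ℕ} (s : Blocks n) (m : Memory) : Prop where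
  own_eq : ∀ i : Fin n, m 11 i = s.own i
  wit_eq : ∀ ℓ < s.cnt, ∀ i : Fin n, m 12 (ℓ * n + i) = (s.wit ℓ i).toNat
  cnt_eq : m 13 0 = s.cnt
  base_eq : m 14 0 = s.cnt * n

theorem toNat_ne_zero {b : Bool} : b.toNat ≠ 0 ↔ b = true := by cases b <;> simp

section Search

variable {n k L R M : ℕ} {lab : ℕ → ℕ} {f : Cube n → Bool} {D : PMF (Cube n)} {S : Set Config}
  {m m' : Memory} {A : List ℕ} {s : Blocks n}

theorem Env.congr (h : Env n k L R M lab m) (e : Off A m m')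
    (hA : ∀ a ∈ [0, 5, 6, 7, 8, 10], a ∉ A) : Env n k L R M lab m' := by
  have e' : ∀ a ∈ [0, 5, 6, 7, 8, 10], m' a = m a := fun a ha => e a (hA a ha)
  simp only [List.mem_cons, List.not_mem_nil, or_false, forall_eq_or_imp, forall_eq] at e'
  obtain ⟨h1, h2, h3, h4, h5, h6⟩ := e'
  exact ⟨by rw [h1, h.n_eq], by rw [h1, h.k_eq], by rw [h2, h.L_eq], by rw [h3, h.H_eq],
    by rw [h4, h.R_eq], by rw [h5, h.M_eq], fun i hi => by rw [h6, h.lab_eq i hi]⟩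

theorem Rep.congr (h : Rep s m) (e : Off A m m')
    (hA : ∀ a ∈ [11, 12, 13, 14], a ∉ A) : Rep s m' := by
  have e' : ∀ a ∈ [11, 12, 13, 14], m' a = m a := fun a ha => e a (hA a ha)
  simp only [List.mem_cons, List.not_mem_nil, or_false, forall_eq_or_imp, forall_eq] at e'
  obtain ⟨h1, h2, h3, h4⟩ := e'
  exact ⟨fun i => by rw [h1, h.own_eq], fun ℓ hℓ i => by rw [h2, h.wit_eq ℓ hℓ],
    by rw [h3, h.cnt_eq], by rw [h4, h.base_eq]⟩

theorem Holds.off {a : ℕ} {x : Cube n} (h : Holds m a x) (e : Off A m m') (ha : a ∉ A) :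
    Holds m' a x := h.congr (e a ha)

/-! ### Binary search -/

/-- The query string for the threshold `mid`. -/
def cutStr (mid : Expr) : Program :=
  strMap 16 (.lit 0) (.add (el 11) (.sub mid (el 10))) (el 15) (.lit 0)

/-- The sum of the owner and the truncated difference `mid - label` is nonzero exactly when the
coordinate is owned or its label is below `mid`. -/
theorem det_cutStr {mid : Expr} {v : ℕ} {u : Cube n} (hE : Env n k L R M lab m)
    (hR : ∀ i : Fin n, m 11 i = s.own i)
    (hu : Holds m 15 u) (hmid : ∀ m', Off [16, 2] m m' → mid.eval m' = v) :
    Det f D S (cutStr mid) m (n * 5 + 3) 0 fun m' =>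
      Off [16, 2] m m' ∧ Holds m' 16 (cut s.own lab u v) := by
  refine det_strMap_holds (by decide) (by decide) hE.n_eq fun i m' h1 h2 _ => ?_
  have hE' := hE.congr h1 (by decide)
  simp only [Expr.eval, h2, hE'.lab_eq i i.2, hmid m' h1, h1 11 (by decide), hR,
    h1 15 (by decide), hu i]
  unfold cut
  by_cases h : s.own i ≠ 0 ∨ lab i < v
  · rw [if_pos (by omega)]; simp [h]
  · rw [if_neg (by omega)]; simp [h]

/-- One round of the binary search. -/
def bisectBody : Program :=
  .seq (.assign 24 (.lit 0) (.half (var 24)))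
  (.seq (cutStr (.add (var 23) (var 24)))
  (.seq (.memberQuery 22 (.lit 0) 16)
  (.branch (dist (var 21) (var 22)) (.assign 23 (.lit 0) (.add (var 23) (var 24))) .skip)))

/-- The binary search for a new relevant block. -/
def bisectProg : Program :=
  .seq (.assign 23 (.lit 0) (.lit 0))
  (.seq (.assign 24 (.lit 0) (var 6)) (forLoop 29 (var 5) bisectBody))

theorem det_bisectProg {u : Cube n} (hE : Env n k L R M lab m)
    (hR : ∀ i : Fin n, m 11 i = s.own i) (hu : Holds m 15 u) (hf : m 21 0 = (f u).toNat) :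
    Det f D S bisectProg m (L * (n * 5 + 13) + 7) L fun m' =>
      Off [2, 16, 22, 23, 24, 29] m m' ∧ m' 23 0 = newLabel f lab L s.own u := by
  set p : ℕ → Bool := fun mid => f u ^^ f (cut s.own lab u mid) with hp
  unfold bisectProg
  refine (Impl.assign_then (Impl.assign_then ?_)).mono (T₁ := L * (n * 5 + 10 + 3) + 3 + 2 + 2)
    (Q₁ := L * 1) (by ring_nf; rfl) (by omega) fun _ _ _ h => h
  -- The invariant does not compute the final label; it states that the remaining ideal bisection
  -- from the current left end still leads to it. Array `24` holds the current interval length,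
  -- which the body halves first.
  refine (Det.forLoop (N := L) (T := n * 5 + 10) (Q := 1) (I := fun j m' =>
    Off [2, 16, 22, 23, 24, 29] m m' ∧ m' 24 0 = 2 ^ (L - j) ∧
      bisect p (m' 23 0) (L - j) = newLabel f lab L s.own u) ?_ ?_ ?_ ?_).mono le_rfl le_rfl ?_
  · rintro j m' ⟨h1, -⟩
    exact (hE.congr h1 (by decide)).L_eq
  · rintro j m' v ⟨h1, h2, h3⟩
    exact ⟨h1.write (by decide) _ _, by rwa [write_of_ne _ _ _ (by decide)],
      by rwa [write_of_ne _ _ _ (by decide)]⟩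
  · rintro j m₁ hj ⟨h1, h2, h3⟩ h4
    obtain ⟨d, hd⟩ : ∃ d, L - j = d + 1 := ⟨L - j - 1, by omega⟩
    have hd' : L - (j + 1) = d := by omega
    rw [hd] at h2 h3
    rw [bisect] at h3
    unfold bisectBody
    refine (Impl.assign_then (T := n * 5 + 8) (Q := 1) ?_).mono (by omega) le_rfl
      fun _ _ _ h => h
    have e24 : Expr.eval m₁ (.half (var 24)) = 2 ^ d := by
      simp only [Expr.eval, h2, pow_succ]; omega
    rw [e24]
    set m₂ := m₁.write 24 (Expr.eval m₁ (.lit 0)) (2 ^ d) with hm₂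
    have o2 : Off [2, 16, 22, 23, 24, 29] m m₂ := h1.write (by decide) _ _
    have v24 : m₂ 24 0 = 2 ^ d := by simp [hm₂, write_apply, Expr.eval]
    have v23 : m₂ 23 0 = m₁ 23 0 := by rw [hm₂, write_of_ne _ _ _ (by decide)]
    have v29 : m₂ 29 0 = j := by rw [hm₂, write_of_ne _ _ _ (by decide), h4]
    refine (Impl.then (det_cutStr (s := s) (u := u) (v := m₁ 23 0 + 2 ^ d)
      (hE.congr o2 (by decide)) (fun i => by rw [o2 11 (by decide), hR])
      (hu.off o2 (by decide)) ?_)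
      (T₂ := 4) (Q₂ := 1) ?_).mono (by omega) (by omega) fun _ _ _ h => h
    · intro m' h
      simp only [Expr.eval, h 23 (by decide), h 24 (by decide), v23, v24]
    · rintro m₃ ⟨o3, h5⟩
      refine Impl.memberQuery_then (T := 2) (Q := 0) ?_
      rw [h5.readString]
      set m₄ := m₃.write 22 (Expr.eval m₃ (.lit 0)) (f (cut s.own lab u (m₁ 23 0 + 2 ^ d))).toNat
        with hm₄
      have o4 : Off [2, 16, 22, 23, 24, 29] m m₄ :=
        (o2.trans o3 (C := [2, 16, 22, 23, 24, 29]) (by simp) (by simp)).write (by decide) _ _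
      have w : ∀ a ∉ [16, 2, 22], m₄ a = m₂ a := fun a ha => by
        rw [hm₄, write_of_ne _ _ _ (by rintro rfl; simp at ha), o3 a (by simp at ha ⊢; tauto)]
      have q : (dist (var 21) (var 22)).eval m₄ = (p (m₁ 23 0 + 2 ^ d)).toNat := by
        refine eval_dist_bool ?_ ?_
        · simp only [Expr.eval, o4 21 (by decide), hf]
        · simp [Expr.eval, hm₄, write_apply]
      have hd2 : m₄ 24 0 = 2 ^ (L - (j + 1)) := by rw [hd', w 24 (by decide), v24]
      refine Impl.branch (T := 1) (fun hc => ?_) (fun hc => ?_)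
      · have hpt : p (m₁ 23 0 + 2 ^ d) = true := by
          rw [q] at hc; by_contra h; simp [h] at hc
        rw [if_pos hpt] at h3
        refine Impl.assign ⟨by rw [write_of_ne _ _ _ (by decide), w 29 (by decide), v29],
          o4.write (by decide) _ _, by rwa [write_of_ne _ _ _ (by decide)], ?_⟩
        simp only [write_apply, Expr.eval, and_self, if_true, hd', w 23 (by decide), v23,
          w 24 (by decide), v24]
        exact h3
      · have hpt : p (m₁ 23 0 + 2 ^ d) = false := by
          rw [q] at hc; by_contra h; simp [h] at hc
        rw [hpt, if_neg (by simp)] at h3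
        exact Impl.skip ⟨by rw [w 29 (by decide), v29], o4, hd2, by
          rw [hd', w 23 (by decide), v23]; exact h3⟩
  · refine ⟨((Off.refl _ _).write (by decide) _ _).write (by decide) _ _, ?_, ?_⟩
    · simp [write_apply, Expr.eval, hE.H_eq]
    · simp only [write_apply, Expr.eval]
      rfl
  · rintro _ - m' ⟨h1, -, h3⟩
    rw [Nat.sub_self] at h3
    exact ⟨h1, h3⟩

/-! ### Search -/

/-- Adding a new block. -/
def extendProg : Program :=
  .seq bisectProg
  (.seq (strMap 12 (var 14) (.add (el 11) (.sub (.add (var 23) (.lit 1)) (el 10))) (el 15) (.lit 0))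
  (.seq (strMap 11 (.lit 0) (.add (el 11) (dist (el 10) (var 23))) (el 11)
    (.add (var 13) (.lit 1)))
  (.seq (.assign 13 (.lit 0) (.add (var 13) (.lit 1)))
  (.assign 14 (.lit 0) (.add (var 14) (var 0))))))

theorem det_extendProg {u : Cube n} (hE : Env n k L R M lab m) (hR : Rep s m)
    (hu : Holds m 15 u) (hf : m 21 0 = (f u).toNat) :
    Det f D S extendProg m (L * (n * 5 + 13) + n * 10 + 30) L fun m' =>
      Off [2, 11, 12, 13, 14, 16, 22, 23, 24, 29] m m' ∧ Rep (extend f lab L s u) m' := by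
  unfold extendProg
  refine (Impl.then (det_bisectProg hE hR.own_eq hu hf) (T₂ := n * 10 + 20) (Q₂ := 0) ?_).mono
    (by omega) le_rfl fun _ _ _ h => h
  rintro m₁ ⟨o1, h1⟩
  have R1 := hR.congr o1 (by decide)
  have E1 := hE.congr o1 (by decide)
  have u1 := hu.off o1 (by decide)
  set lo := newLabel f lab L s.own u with hlo
  refine (Impl.then (det_strMap (B := s.cnt * n) (g := fun i => if hi : i < n then
    (cut s.own lab u (lo + 1) ⟨i, hi⟩).toNat else 0) (by decide) (by decide) E1.n_eq ?_)
    (T₂ := n * 5 + 8) (Q₂ := 0) ?_).mono (by omega) (by omega) fun _ _ _ h => h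
  · intro i hi m' h2 h3 _
    refine ⟨by simp only [Expr.eval, h2 14 (by decide), R1.base_eq], ?_⟩
    rw [dif_pos hi]
    have own_i : m' 11 i = s.own ⟨i, hi⟩ := by rw [h2 11 (by decide), R1.own_eq ⟨i, hi⟩]
    have lab_i : m' 10 i = lab i := by rw [h2 10 (by decide), E1.lab_eq i hi]
    have u_i : m' 15 i = (u ⟨i, hi⟩).toNat := by rw [h2 15 (by decide), u1 ⟨i, hi⟩]
    simp only [Expr.eval, h3, own_i, lab_i, u_i, h2 23 (by decide), h1]
    unfold cut
    by_cases h : s.own ⟨i, hi⟩ ≠ 0 ∨ lab i < lo + 1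
    · rw [if_pos (by omega), decide_eq_true h, Bool.and_true]
    · rw [if_neg (by omega), decide_eq_false h, Bool.and_false]; rfl
  rintro m₂ ⟨o2, h2⟩
  have E2 := E1.congr o2 (by decide)
  -- The owners are updated only after the witness has been computed from the old ones, and each
  -- entry is read just before it is overwritten. The sum of the owner and the distance of the label
  -- to `lo` vanishes exactly on the new block.
  refine (Impl.then (det_strMap (B := 0) (g := fun i => if hi : i < n then
    (extend f lab L s u).own ⟨i, hi⟩ else 0) (by decide) (by decide) E2.n_eq ?_)
    (T₂ := 3) (Q₂ := 0) ?_).mono (by omega) (by omega) fun _ _ _ h => h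
  · intro i hi m' h3 h4 h5
    refine ⟨rfl, ?_⟩
    rw [dif_pos hi]
    have own_i : m' 11 i = s.own ⟨i, hi⟩ := by
      rw [h5 i (by omega), o2 11 (by decide), R1.own_eq ⟨i, hi⟩]
    have lab_i : m' 10 i = lab i := by rw [h3 10 (by decide), E2.lab_eq i hi]
    have lo_i : m' 23 0 = lo := by rw [h3 23 (by decide), o2 23 (by decide), h1]
    have cnt_i : m' 13 0 = s.cnt := by rw [h3 13 (by decide), o2 13 (by decide), R1.cnt_eq]
    simp only [Expr.eval, dist, h4, own_i, lab_i, lo_i, cnt_i, extend, ← hlo]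
    by_cases h : s.own ⟨i, hi⟩ = 0 ∧ lab i = lo
    · rw [if_pos h, if_neg (by omega)]
    · rw [if_neg h, if_pos (by omega)]
  rintro m₃ ⟨o3, h3⟩
  refine Impl.assign_then (T := 1) (Impl.assign ?_)
  have e13 : m₃ 13 0 = s.cnt := by rw [o3 13 (by decide), o2 13 (by decide), R1.cnt_eq]
  have e14 : m₃ 14 0 = s.cnt * n := by rw [o3 14 (by decide), o2 14 (by decide), R1.base_eq]
  have e0 : m₃ 0 0 = n := by rw [o3 0 (by decide), E2.n_eq]
  refine ⟨?_, ⟨fun i => ?_, fun ℓ hℓ i => ?_, ?_, ?_⟩⟩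
  · exact (((o1.trans o2 (C := [2, 11, 12, 13, 14, 16, 22, 23, 24, 29]) (by simp)
      (by simp)).trans o3 (C := [2, 11, 12, 13, 14, 16, 22, 23, 24, 29]) (by simp)
      (by simp)).write (by decide) _ _).write (by decide) _ _
  · rw [write_of_ne _ _ _ (by decide), write_of_ne _ _ _ (by decide), h3, if_pos (by omega)]
    simp
  · rw [write_of_ne _ _ _ (by decide), write_of_ne _ _ _ (by decide), o3 12 (by decide), h2]
    by_cases hc : ℓ = s.cnt
    · subst hc
      rw [if_pos (by omega)]
      simp [extend, ← hlo]
    · have h4 : ℓ < s.cnt := by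
        simp only [extend] at hℓ; omega
      -- The earlier witnesses occupy segments ending before the one just written.
      have h5 : ℓ * n + n ≤ s.cnt * n := by nlinarith
      rw [if_neg (by omega), R1.wit_eq ℓ h4]
      simp [extend, Function.update_of_ne hc]
  · simp [write_apply, Expr.eval, e13, extend]
  · simp [write_apply, Expr.eval, e14, e0, extend, add_mul]

/-- One attempt to find a new block. -/
def tryProg : Program :=
  .branch (dist (var 13) (var 27)) .skip
  (.seq (.exampleQuery 15)
  (.seq (strMap 16 (.lit 0) (el 11) (el 15) (.lit 0))
  (.seq (.memberQuery 21 (.lit 0) 15)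
  (.seq (.memberQuery 22 (.lit 0) 16)
  (.branch (dist (var 21) (var 22)) extendProg .skip)))))

theorem det_restr {a : ℕ} {u : Cube n} (hE : Env n k L R M lab m) (hR : Rep s m)
    (hu : Holds m 15 u) (ha : a ∉ [0, 2, 11, 15]) :
    Det f D S (strMap a (.lit 0) (el 11) (el 15) (.lit 0)) m (n * 5 + 3) 0 fun m' =>
      Off [a, 2] m m' ∧ Holds m' a (restr s.own u) := by
  simp only [List.mem_cons, List.not_mem_nil, or_false, not_or] at ha
  refine det_strMap_holds ha.1 ha.2.1 hE.n_eq fun i m' h1 h2 _ => ?_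
  simp only [Expr.eval, h2, h1 11 (by simp [Ne.symm ha.2.2.1]), hR.own_eq,
    h1 15 (by simp [Ne.symm ha.2.2.2]), hu i]
  unfold restr
  by_cases h : s.own i = 0 <;> simp [h]

theorem impl_tryProg {j : ℕ} (hE : Env n k L R M lab m) (hR : Rep s m) (hj : m 27 0 = j) :
    Impl f D S tryProg m (L * (n * 5 + 13) + n * 15 + 43) (L + 3) (tryStep f D lab L j s)
      fun s' m' => Off [2, 11, 12, 13, 14, 15, 16, 21, 22, 23, 24, 29] m m' ∧ Rep s' m' := by
  unfold tryProg tryStep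
  refine Impl.branch (T := L * (n * 5 + 13) + n * 15 + 42) (fun hc => ?_) (fun hc => ?_)
  · rw [Ne, eval_dist_eq_zero] at hc
    simp only [Expr.eval, hR.cnt_eq, hj] at hc
    rw [if_neg hc]
    exact (Impl.skip (R := fun s' m' => Off [2, 11, 12, 13, 14, 15, 16, 21, 22, 23, 24, 29] m m' ∧
      Rep s' m') ⟨Off.refl _ _, hR⟩).mono (by omega) (by omega) fun _ _ _ h => h
  · rw [eval_dist_eq_zero] at hc
    simp only [Expr.eval, hR.cnt_eq, hj] at hc
    rw [if_pos hc, PMF.map]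
    refine (Impl.seq (Impl.exampleQuery (R := fun u m' => m' = m.writeString 15 u) fun _ => rfl)
      (T₂ := L * (n * 5 + 13) + n * 15 + 40) (Q₂ := L + 2) ?_).mono (by omega) (by omega)
      fun _ _ _ h => h
    rintro u - m₁ rfl
    have o1 : Off [15] m (m.writeString 15 u) := fun a ha => writeString_of_ne _ _ (by simpa using ha)
    have u1 : Holds (m.writeString 15 u) 15 u := writeString_self m 15 u
    refine (Impl.then (det_restr (hE.congr o1 (by decide)) (hR.congr o1 (by decide)) u1
      (a := 16) (by decide)) (T₂ := L * (n * 5 + 13) + n * 10 + 35) (Q₂ := L + 2) ?_).mono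
      (by omega) (by omega) fun _ _ _ h => h
    rintro m₂ ⟨o2, h2⟩
    have u2 := u1.off o2 (by decide)
    refine Impl.memberQuery_then (Impl.memberQuery_then ?_)
    have h3 : Holds (m₂.write 21 (Expr.eval m₂ (.lit 0)) (f (m₂.readString n 15)).toNat) 16
      (restr s.own u) := h2.congr (write_of_ne _ _ _ (by decide))
    rw [h3.readString, u2.readString]
    set m₃ := (m₂.write 21 (Expr.eval m₂ (.lit 0)) (f u).toNat).write 22
      (Expr.eval (m₂.write 21 (Expr.eval m₂ (.lit 0)) (f u).toNat) (.lit 0))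
      (f (restr s.own u)).toNat with hm₃
    have o3 : Off [2, 15, 16, 21, 22] m m₃ :=
      ((o1.trans o2 (C := [2, 15, 16, 21, 22]) (by simp) (by simp)).write (by decide) _ _).write
        (by decide) _ _
    have e21 : m₃ 21 0 = (f u).toNat := by simp [hm₃, write_apply, Expr.eval]
    have q : (dist (var 21) (var 22)).eval m₃ = (f u ^^ f (restr s.own u)).toNat :=
      eval_dist_bool (by simp [Expr.eval, e21]) (by simp [Expr.eval, hm₃, write_apply])
    refine Impl.branch (T := L * (n * 5 + 13) + n * 10 + 30) (fun hc => ?_) (fun hc => ?_)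
    · have hx : (f u ^^ f (restr s.own u)) = true := by
        rwa [q, toNat_ne_zero] at hc
      refine ((det_extendProg (u := u) (hE.congr o3 (by decide)) (hR.congr o3 (by decide))
        (u2.off (A := [21, 22]) (((Off.refl _ _).write (by decide) _ _).write (by decide) _ _)
          (by decide)) e21).of_det ?_)
      rintro m₄ ⟨o4, h4⟩
      exact ⟨o3.trans o4 (by simp) (by simp), by simpa only [if_pos hx] using h4⟩
    · have hx : ¬ (f u ^^ f (restr s.own u)) = true := by
        rw [q] at hc; exact fun h => toNat_ne_zero.2 h hc
      exact (Impl.skip (R := fun s' m' => Off [2, 11, 12, 13, 14, 15, 16, 21, 22, 23, 24, 29] m m' ∧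
        Rep s' m') ⟨o3.mono (by simp), by
          simpa only [if_neg hx] using hR.congr o3 (by decide)⟩).mono (by omega) (by omega)
        fun _ _ _ h => h

/-- The search for blocks. -/
def searchProg : Program :=
  forLoop 27 (.add (.get 0 (.lit 1)) (.lit 1)) (forLoop 28 (var 8) tryProg)

theorem impl_searchProg (hE : Env n k L R M lab m)
    (hR : Rep (⟨fun _ => 0, fun _ _ => false, 0⟩ : Blocks n) m) :
    Impl f D S searchProg m ((k + 1) * (M * (L * (n * 5 + 13) + n * 15 + 46) + 6) + 3)
      ((k + 1) * (M * (L + 3))) (search f D lab L M k)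
      fun s m' => Env n k L R M lab m' ∧ Rep s m' := by
  refine (Impl.forLoop (N := k + 1) (T := M * (L * (n * 5 + 13) + n * 15 + 46) + 3)
    (Q := M * (L + 3)) (I := fun _ s m' => Env n k L R M lab m' ∧ Rep s m') ?_ ?_ ?_
    ⟨hE, hR⟩).mono le_rfl le_rfl fun _ _ _ h => h
  · rintro j s m' ⟨h1, -⟩
    simp [Expr.eval, h1.k_eq]
  · rintro j s m' v ⟨h1, h2⟩
    have o : Off [27] m' (m'.write 27 0 v) := (Off.refl _ _).write (by decide) _ _
    exact ⟨h1.congr o (by decide), h2.congr o (by decide)⟩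
  · rintro j s m₁ hj ⟨h1, h2⟩ h3
    refine (Impl.forLoop (N := M) (T := L * (n * 5 + 13) + n * 15 + 43) (Q := L + 3)
      (I := fun _ s m' => m' 27 0 = j ∧ Env n k L R M lab m' ∧ Rep s m') ?_ ?_ ?_
      ⟨h3, h1, h2⟩).mono le_rfl le_rfl fun _ _ _ h => h
    · rintro i s m' ⟨-, h1, -⟩
      exact h1.M_eq
    · rintro i s m' v ⟨h0, h1, h2⟩
      have o : Off [28] m' (m'.write 28 0 v) := (Off.refl _ _).write (by decide) _ _
      exact ⟨by rw [o 27 (by decide), h0], h1.congr o (by decide), h2.congr o (by decide)⟩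
    · rintro i s m' hi ⟨h0, h1, h2⟩ h3
      refine (impl_tryProg h1 h2 h0).mono le_rfl le_rfl ?_
      rintro s' - m'' ⟨o, h⟩
      exact ⟨by rw [o 28 (by decide), h3], by rw [o 27 (by decide), h0], h1.congr o (by decide), h⟩

end Search

end JuntaTesting

/-! ### Implementation of the verification. -/

namespace JuntaTesting

open scoped ENNReal

section Verify

variable {n k L R M : ℕ} {lab : ℕ → ℕ} {f : Cube n → Bool} {D : PMF (Cube n)} {S : Set Config}
  {m m' : Memory} {A : List ℕ} {b : Blocks n} {u r x y : Cube n} {ℓ : ℕ}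

/-! ### Dictator test -/

/-- A query to the block number `ℓ`, at the random string shifted by `w`. -/
def probeProg (idx : ℕ) (w : Expr) : Program :=
  .seq (strMap 16 (.lit 0) (dist (el 11) (.add (var 30) (.lit 1)))
    (.get 12 (.add (var 32) (var 2))) (dist (el 18) w))
  (.memberQuery 33 (.lit idx) 16)

/-- The memory during the test of the block number `ℓ`. -/
structure BlockEnv (b : Blocks n) (ℓ : ℕ) (u : Cube n) (m : Memory) : Prop where
  n_eq : m 0 0 = n
  rep : Rep b m
  lt : ℓ < b.cnt
  num_eq : m 30 0 = ℓ
  off_eq : m 32 0 = ℓ * n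
  sample : Holds m 15 u

theorem BlockEnv.congr (h : BlockEnv b ℓ u m) (e : Off A m m')
    (hA : ∀ a ∈ [0, 11, 12, 13, 14, 15, 30, 32], a ∉ A) : BlockEnv b ℓ u m' :=
  ⟨by rw [e 0 (hA _ (by simp)), h.n_eq], h.rep.congr e (fun a ha => hA a (by
    simp only [List.mem_cons, List.not_mem_nil, or_false] at ha ⊢; omega)), h.lt,
    by rw [e 30 (hA _ (by simp)), h.num_eq], by rw [e 32 (hA _ (by simp)), h.off_eq],
    h.sample.off e (hA _ (by simp))⟩

theorem det_probeProg {idx : ℕ} {w : Expr} {z : Cube n} (hB : BlockEnv b ℓ u m)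
    (hr : Holds m 18 r)
    (hw : ∀ i : Fin n, ∀ m', Off [16, 2] m m' → m' 2 0 = i → w.eval m' = (z i).toNat) :
    Det f D S (probeProg idx w) m (n * 5 + 5) 1 fun m' => Off [2, 16, 33] m m' ∧
      m' 33 idx = (probe f b ℓ (symmDiff r z)).toNat ∧ ∀ j, j ≠ idx → m' 33 j = m 33 j := by
  unfold probeProg
  refine Impl.then (T₁ := n * 5 + 3) (T₂ := 1) (Q₁ := 0) (Q₂ := 1)
    (det_strMap_holds (x := fun i => if b.own i = ℓ + 1 then symmDiff r z i else b.wit ℓ i)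
    (by decide) (by decide) hB.n_eq fun i m' h1 h2 _ => ?_) ?_
  · have e := eval_dist_eq_zero (m := m') (e₁ := el 11) (e₂ := .add (var 30) (.lit 1))
    simp only [Expr.eval, h2, h1 11 (by decide), h1 30 (by decide), hB.rep.own_eq i,
      hB.num_eq] at e
    by_cases h : b.own i = ℓ + 1
    · rw [if_neg (not_not.2 (e.2 h)), if_pos h, Pi.symmDiff_apply, Bool.symmDiff_eq_xor]
      exact eval_dist_bool (by simp only [Expr.eval, h2, h1 18 (by decide), hr i]) (hw i m' h1 h2)
    · rw [if_pos fun hc => h (e.1 hc), if_neg h]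
      simp only [Expr.eval, h2, h1 32 (by decide), h1 12 (by decide), hB.off_eq,
        hB.rep.wit_eq ℓ hB.lt i]
  · rintro m' ⟨h1, h2⟩
    refine Impl.memberQuery ⟨(h1.mono (by simp)).write (by decide) _ _, ?_, fun j hj => ?_⟩
    · rw [h2.readString]
      simp [write_apply, Expr.eval, probe]
    · rw [write_apply, if_neg (by simpa [Expr.eval] using hj), h1 33 (by decide)]

/-- The answer to the query number `i`. -/
abbrev ans (i : ℕ) : Expr := .get 33 (.lit i)

/-- The seven queries of one round. -/
def queriesProg (K : Program) : Program :=
  .seq (probeProg 0 (.lit 0))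
  (.seq (probeProg 1 (el 19))
  (.seq (probeProg 2 (el 20))
  (.seq (probeProg 3 (dist (el 19) (el 20)))
  (.seq (probeProg 4 (.half (.add (el 19) (el 20))))
  (.seq (probeProg 5 (.lit 1))
  (.seq (probeProg 6 (el 15)) K))))))

/-- All seven query points are shifts of `r`; on bits, distance computes the sum, the half of a sum
computes the meet, and the constants `0` and `1` stand for `⊥` and `⊤`. -/
theorem impl_queriesProg {β : Type} {μ : PMF β} {Q : β → Memory → Prop} {K : Program} {T q : ℕ}
    (hB : BlockEnv b ℓ u m) (hr : Holds m 18 r) (hx : Holds m 19 x) (hy : Holds m 20 y)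
    (h : ∀ m', Off [2, 16, 33] m m' →
      m' 33 0 = (probe f b ℓ r).toNat →
      m' 33 1 = (probe f b ℓ (symmDiff r x)).toNat →
      m' 33 2 = (probe f b ℓ (symmDiff r y)).toNat →
      m' 33 3 = (probe f b ℓ (symmDiff (symmDiff r x) y)).toNat →
      m' 33 4 = (probe f b ℓ (symmDiff r (x ⊓ y))).toNat →
      m' 33 5 = (probe f b ℓ (symmDiff r ⊤)).toNat →
      m' 33 6 = (probe f b ℓ (symmDiff r u)).toNat → Impl f D S K m' T q μ Q) :
    Impl f D S (queriesProg K) m (T + (n * 35 + 42)) (q + 7) μ Q := by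
  have step : ∀ {K : Program} {T q idx : ℕ} {w : Expr} {z : Cube n} {m₁ : Memory},
      Off [2, 16, 33] m m₁ →
      (∀ i : Fin n, ∀ m', Off [2, 16, 33] m m' → m' 2 0 = i → w.eval m' = (z i).toNat) →
      (∀ m', Off [2, 16, 33] m m' → m' 33 idx = (probe f b ℓ (symmDiff r z)).toNat →
        (∀ j, j ≠ idx → m' 33 j = m₁ 33 j) → Impl f D S K m' T q μ Q) →
      Impl f D S (.seq (probeProg idx w) K) m₁ (T + (n * 5 + 6)) (q + 1) μ Q := by
    intro K T q idx w z m₁ o hw hK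
    refine (Impl.then (det_probeProg (hB.congr o (by decide)) (hr.off o (by decide))
      (fun i m' h1 h2 => hw i m' (o.trans h1 (by simp) (by simp)) h2)) (T₂ := T) (Q₂ := q) ?_).mono
      (by omega) (by omega) fun _ _ _ h => h
    rintro m' ⟨h1, h2, h3⟩
    exact hK m' (o.trans h1 (by simp) (by simp)) h2 h3
  have eval_el : ∀ {a : ℕ} {z : Cube n} (_ : Holds m a z) (_ : a ∉ [2, 16, 33]) (i : Fin n)
      (m' : Memory), Off [2, 16, 33] m m' → m' 2 0 = i → (el a).eval m' = (z i).toNat := by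
    intro a z hz ha i m' o hi
    simp only [Expr.eval, hi, o a ha, hz i]
  have ex' := eval_el hx (by decide)
  have ey := eval_el hy (by decide)
  refine (step (z := ⊥) (Off.refl _ _) (fun _ _ _ _ => rfl) fun m₀ o₀ v₀ w₀ =>
    step (z := x) o₀ ex' fun m₁ o₁ v₁ w₁ =>
    step (z := y) o₁ ey fun m₂ o₂ v₂ w₂ =>
    step (z := symmDiff x y) o₂ (fun i m' o hi => by
      rw [Pi.symmDiff_apply, Bool.symmDiff_eq_xor]
      exact eval_dist_bool (ex' i m' o hi) (ey i m' o hi)) fun m₃ o₃ v₃ w₃ =>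
    step (z := x ⊓ y) o₃ (fun i m' o hi => by
      simp only [Expr.eval] at ex' ey
      simp only [Expr.eval, ex' i m' o hi, ey i m' o hi, Pi.inf_apply, Bool.inf_eq_band]
      cases x i <;> cases y i <;> rfl) fun m₄ o₄ v₄ w₄ =>
    step (z := ⊤) o₄ (fun _ _ _ _ => rfl) fun m₅ o₅ v₅ w₅ =>
    step (z := u) (T := T) (q := q) o₅ (eval_el hB.sample (by decide)) fun m₆ o₆ v₆ w₆ =>
    h m₆ o₆ ?_ ?_ ?_ ?_ ?_ ?_ ?_).mono (by omega) (by omega) fun _ _ _ h => h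
  · rw [w₆ 0 (by decide), w₅ 0 (by decide), w₄ 0 (by decide), w₃ 0 (by decide), w₂ 0 (by decide),
      w₁ 0 (by decide), v₀, symmDiff_bot]
  · rw [w₆ 1 (by decide), w₅ 1 (by decide), w₄ 1 (by decide), w₃ 1 (by decide), w₂ 1 (by decide),
      v₁]
  · rw [w₆ 2 (by decide), w₅ 2 (by decide), w₄ 2 (by decide), w₃ 2 (by decide), v₂]
  · rw [w₆ 3 (by decide), w₅ 3 (by decide), w₄ 3 (by decide), v₃, symmDiff_assoc]
  · rw [w₆ 4 (by decide), w₅ 4 (by decide), v₄]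
  · rw [w₆ 5 (by decide), v₅]
  · rw [v₆]

/-- An expression that is nonzero when the dictator test fails. -/
def failExpr : Expr :=
  .add (.add (dist (dist (dist (ans 0) (ans 1)) (ans 2)) (ans 3))
    (dist (dist (ans 0) (ans 4)) (.half (.add (dist (ans 0) (ans 1)) (dist (ans 0) (ans 2))))))
    (.sub (.lit 1) (dist (ans 0) (ans 5)))

/-- One round of the dictator test. -/
def repProg : Program :=
  .seq (randStr 18) (.seq (randStr 19) (.seq (randStr 20)
  (queriesProg (.seq (.assign 25 (.lit 0) (.add (var 25) failExpr))
    (.assign 26 (dist (ans 0) (ans 6)) (.lit 1))))))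

/-- The memory represents the state of the dictator test. -/
def RepState (q : Bool × (Bool → Bool)) (m : Memory) : Prop :=
  (m 25 0 ≠ 0 ↔ q.1 = true) ∧ ∀ c : Bool, m 26 c.toNat = (q.2 c).toNat

theorem impl_repProg {q : Bool × (Bool → Bool)} (hB : BlockEnv b ℓ u m) (hq : RepState q m) :
    Impl f D S repProg m (n * 47 + 57) 7 (repStep (probe f b ℓ) u q) fun q' m' =>
      Off [2, 16, 18, 19, 20, 25, 26, 33] m m' ∧ RepState q' m' := by
  unfold repProg repStep
  refine (Impl.seq (impl_randStr (by decide) (by decide) hB.n_eq)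
    (T₂ := n * 43 + 53) (Q₂ := 7) ?_).mono (by omega) (by omega) fun _ _ _ h => h
  rintro r - m₁ ⟨o1, hr⟩
  have B1 := hB.congr o1 (by decide)
  refine (Impl.seq (impl_randStr (by decide) (by decide) B1.n_eq)
    (T₂ := n * 39 + 49) (Q₂ := 7) ?_).mono (by omega) (by omega) fun _ _ _ h => h
  rintro x - m₂ ⟨o2, hx⟩
  have B2 := B1.congr o2 (by decide)
  refine (Impl.seq (impl_randStr (by decide) (by decide) B2.n_eq)
    (T₂ := n * 35 + 45) (Q₂ := 7) ?_).mono (by omega) (by omega) fun _ _ _ h => h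
  rintro y - m₃ ⟨o3, hy⟩
  have B3 := B2.congr o3 (by decide)
  have O3 : Off [2, 16, 18, 19, 20, 25, 26, 33] m m₃ :=
    (o1.trans o2 (C := [2, 18, 19]) (by simp) (by simp)).trans o3 (by simp) (by simp)
  refine (impl_queriesProg (T := 3) (q := 0) B3 (hr.off o2 (by decide) |>.off o3 (by decide))
    (hx.off o3 (by decide)) hy ?_).mono (by omega) (by omega) fun _ _ _ h => h
  intro m₄ o4 a0 a1 a2 a3 a4 a5 a6
  have O4 : Off [2, 16, 18, 19, 20, 25, 26, 33] m m₄ := O3.trans o4 (by simp) (by simp)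
  have e25 : m₄ 25 0 = m 25 0 := by
    rw [o4 25 (by decide), o3 25 (by decide), o2 25 (by decide), o1 25 (by decide)]
  have e26 : m₄ 26 = m 26 := by
    rw [o4 26 (by decide), o3 26 (by decide), o2 26 (by decide), o1 26 (by decide)]
  refine Impl.assign_then (T := 1) (Impl.assign ⟨(O4.write (by decide) _ _).write (by decide) _ _,
    ?_, fun c => ?_⟩)
  · rw [write_of_ne _ _ _ (by decide)]
    -- `failExpr` is an arithmetic form of the Boolean test; the equivalence is checked on all
    -- values of the six answers.
    have hfail : failExpr.eval m₄ ≠ 0 ↔ dictatorFails (probe f b ℓ) r x y = true := by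
      unfold failExpr dictatorFails
      simp only [Expr.eval, dist, a0, a1, a2, a3, a4, a5]
      generalize probe f b ℓ r = c0
      generalize probe f b ℓ (symmDiff r x) = c1
      generalize probe f b ℓ (symmDiff r y) = c2
      generalize probe f b ℓ (symmDiff (symmDiff r x) y) = c3
      generalize probe f b ℓ (symmDiff r (x ⊓ y)) = c4
      generalize probe f b ℓ (symmDiff r ⊤) = c5
      revert c0 c1 c2 c3 c4 c5
      decide
    have : (m₄.write 25 (Expr.eval m₄ (.lit 0)) (Expr.eval m₄ (.add (var 25) failExpr))) 25 0 =
        m 25 0 + failExpr.eval m₄ := by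
      simp [write_apply, Expr.eval, e25]
    rw [this, Bool.or_eq_true, ← hfail, ← hq.1]
    omega
  · have hbit : Expr.eval (m₄.write 25 (Expr.eval m₄ (.lit 0))
        (Expr.eval m₄ (.add (var 25) failExpr))) (dist (ans 0) (ans 6)) =
        (probe f b ℓ r ^^ probe f b ℓ (symmDiff r u)).toNat :=
      eval_dist_bool (by simp [Expr.eval, write_apply, a0]) (by simp [Expr.eval, write_apply, a6])
    rw [hbit, write_apply, write_of_ne _ _ _ (by decide), e26, hq.2]
    generalize (probe f b ℓ r ^^ probe f b ℓ (symmDiff r u)) = d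
    cases c <;> cases d <;> simp [Expr.eval]

/-! ### Test of a block -/

/-- The test of one block with one sample. -/
def blockProg : Program :=
  .seq (.assign 26 (.lit 0) (.lit 0)) (.seq (.assign 26 (.lit 1) (.lit 0))
  (.seq (forLoop 31 (var 7) repProg)
  (.seq (.assign 25 (.lit 0) (.add (var 25) (.sub (.add (var 26) (.get 26 (.lit 1))) (.lit 1))))
  (.seq (strMap 17 (.lit 0) (dist (el 11) (.add (var 30) (.lit 1))) (el 17) (.get 26 (.lit 1)))
  (.assign 32 (.lit 0) (.add (var 32) (var 0)))))))

theorem impl_blockProg {s : Bool × Cube n} (hB : BlockEnv b ℓ u m) (hR : m 7 0 = R)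
    (hs : m 25 0 ≠ 0 ↔ s.1 = true) (hW : Holds m 17 s.2) :
    Impl f D S blockProg m (R * (n * 47 + 60) + n * 5 + 20) (R * 7) (blockStep f R b u ℓ s)
      fun s' m' => Off [2, 16, 17, 18, 19, 20, 25, 26, 31, 32, 33] m m' ∧
        (m' 25 0 ≠ 0 ↔ s'.1 = true) ∧ Holds m' 17 s'.2 ∧ m' 32 0 = (ℓ + 1) * n := by
  unfold blockProg blockStep PMF.map
  refine (Impl.assign_then (Impl.assign_then ?_)).mono
    (T₁ := R * (n * 47 + 60) + n * 5 + 15 + 2 + 2) (Q₁ := R * 7) (by omega) (by omega)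
    fun _ _ _ h => h
  set m₀ := (m.write 26 (Expr.eval m (.lit 0)) (Expr.eval m (.lit 0))).write 26
    (Expr.eval (m.write 26 (Expr.eval m (.lit 0)) (Expr.eval m (.lit 0))) (.lit 1))
    (Expr.eval (m.write 26 (Expr.eval m (.lit 0)) (Expr.eval m (.lit 0))) (.lit 0)) with hm₀
  have o0 : Off [2, 16, 18, 19, 20, 25, 26, 31, 33] m m₀ :=
    ((Off.refl _ _).write (by decide) _ _).write (by decide) _ _
  have e25 : m₀ 25 0 = m 25 0 := by
    rw [hm₀, write_of_ne _ _ _ (by decide), write_of_ne _ _ _ (by decide)]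
  refine (Impl.seq (Impl.forLoop (N := R) (T := n * 47 + 57) (Q := 7)
    (F := fun _ => repStep (probe f b ℓ) u) (b := (s.1, fun _ => false))
    (I := fun _ q m' => Off [2, 16, 18, 19, 20, 25, 26, 31, 33] m m' ∧ RepState q m') ?_ ?_ ?_
    ⟨o0, ?_, ?_⟩) (T₂ := n * 5 + 7) (Q₂ := 0) ?_).mono (by ring_nf; omega) le_rfl
    fun _ _ _ h => h
  · rintro j q m' ⟨h, -⟩
    simp only [Expr.eval, h 7 (by decide), hR]
  · rintro j q m' v ⟨h, h1, h2⟩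
    exact ⟨h.write (by decide) _ _, by rwa [write_of_ne _ _ _ (by decide)],
      by rwa [write_of_ne _ _ _ (by decide)]⟩
  · rintro j q m' - ⟨h1, h2⟩ h3
    refine (impl_repProg (hB.congr h1 (by decide)) h2).mono le_rfl le_rfl ?_
    rintro q' - m'' ⟨h4, h5⟩
    exact ⟨by rw [h4 31 (by decide), h3], h1.trans h4 (by simp) (by simp), h5⟩
  · rw [e25]; exact hs
  · intro c
    cases c <;> simp [hm₀, write_apply, Expr.eval]
  · rintro q - m₁ ⟨o1, h1, h2⟩
    have hF := h2 false
    have hT := h2 true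
    simp only [Bool.toNat_false, Bool.toNat_true] at hF hT
    refine Impl.assign_then (T := n * 5 + 5) ?_
    set m₂ := m₁.write 25 (Expr.eval m₁ (.lit 0)) (Expr.eval m₁ (.add (var 25)
      (.sub (.add (var 26) (.get 26 (.lit 1))) (.lit 1)))) with hm₂
    have o2 : Off [2, 16, 18, 19, 20, 25, 26, 31, 33] m m₂ := o1.write (by decide) _ _
    have B2 := hB.congr o2 (by decide)
    -- Array `25` accumulates evidence and is nonzero once rejection is decided. Both flags are set
    -- exactly when the truncated difference of their sum and `1` is nonzero.
    have f2 : m₂ 25 0 ≠ 0 ↔ (q.1 || (q.2 false && q.2 true)) = true := by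
      have : m₂ 25 0 = m₁ 25 0 + ((q.2 false).toNat + (q.2 true).toNat - 1) := by
        simp [hm₂, write_apply, Expr.eval, hF, hT]
      rw [this, Bool.or_eq_true, ← h1]
      cases q.2 false <;> cases q.2 true <;> simp
    refine (Impl.then (det_strMap_holds (a := 17)
      (x := fun i => if b.own i = ℓ + 1 then q.2 true else s.2 i)
      (by decide) (by decide) B2.n_eq fun i m' h3 h4 h5 => ?_) (T₂ := 1) (Q₂ := 0) ?_).mono
      (by omega) (by omega) fun _ _ _ h => h
    · have e := eval_dist_eq_zero (m := m') (e₁ := el 11) (e₂ := .add (var 30) (.lit 1))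
      simp only [Expr.eval, h4, h3 11 (by decide), h3 30 (by decide), B2.rep.own_eq i,
        B2.num_eq] at e
      by_cases h : b.own i = ℓ + 1
      · rw [if_neg (not_not.2 (e.2 h)), if_pos h]
        simp only [Expr.eval, h3 26 (by decide)]
        rw [hm₂, write_of_ne _ _ _ (by decide), hT]
      · rw [if_pos fun hc => h (e.1 hc), if_neg h]
        simp only [Expr.eval, h4, h5, o2 17 (by decide)]
        exact hW i
    · rintro m₃ ⟨o3, h3⟩
      refine Impl.assign ⟨(o2.trans o3 (by simp) (by simp)).write (by decide) _ _, ?_,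
        h3.congr (write_of_ne _ _ _ (by decide)), ?_⟩
      · rw [write_of_ne _ _ _ (by decide), o3 25 (by decide)]
        exact f2
      · have e1 := B2.off_eq
        have e2 := B2.n_eq
        simp [write_apply, Expr.eval, o3 32 (by decide), o3 0 (by decide), e1, e2, add_mul]

/-! ### Verification -/

/-- The test with one sample. -/
def sampleProg : Program :=
  .seq (.exampleQuery 15)
  (.seq (strMap 16 (.lit 0) (el 11) (el 15) (.lit 0))
  (.seq (.memberQuery 21 (.lit 0) 16)
  (.seq (strMap 17 (.lit 0) (.lit 0) (.lit 0) (.lit 0))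
  (.seq (.assign 32 (.lit 0) (.lit 0))
  (.seq (forLoop 30 (var 13) blockProg)
  (.seq (.memberQuery 22 (.lit 0) 17)
  (.assign 25 (.lit 0) (.add (var 25) (dist (var 21) (var 22))))))))))

theorem impl_sampleProg {c : Bool} (hE : Env n k L R M lab m) (hR : Rep b m) (hb : b.cnt ≤ k + 1)
    (hc : m 25 0 ≠ 0 ↔ c = true) :
    Impl f D S sampleProg m ((k + 1) * (R * (n * 47 + 60) + n * 5 + 23) + n * 10 + 30)
      ((k + 1) * (R * 7) + 3) (sampleStep f D R b c) fun c' m' =>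
        Off [2, 15, 16, 17, 18, 19, 20, 21, 22, 25, 26, 30, 31, 32, 33] m m' ∧
        (m' 25 0 ≠ 0 ↔ c' = true) := by
  unfold sampleProg sampleStep
  -- The time of a block is made opaque so that the budget is linear in the product `b.cnt * T'`,
  -- which is then compared with `(k + 1) * T'`.
  obtain ⟨T', hT'⟩ : ∃ T', T' = R * (n * 47 + 60) + n * 5 + 23 := ⟨_, rfl⟩
  rw [← hT']
  have hT : b.cnt * T' ≤ (k + 1) * T' := by gcongr
  have hQ : b.cnt * (R * 7) ≤ (k + 1) * (R * 7) := by gcongr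
  refine (Impl.seq (Impl.exampleQuery (R := fun u m' => m' = m.writeString 15 u) fun _ => rfl)
    (T₂ := b.cnt * T' + n * 10 + 20) (Q₂ := b.cnt * (R * 7) + 2) ?_).mono (by omega) (by omega)
    fun _ _ _ h => h
  rintro u - m₁ rfl
  have o1 : Off [15] m (m.writeString 15 u) := fun a ha => writeString_of_ne _ _ (by simpa using ha)
  have u1 : Holds (m.writeString 15 u) 15 u := writeString_self m 15 u
  refine (Impl.then (det_restr (hE.congr o1 (by decide)) (hR.congr o1 (by decide)) u1
    (a := 16) (by decide)) (T₂ := b.cnt * T' + n * 5 + 16) (Q₂ := b.cnt * (R * 7) + 2) ?_).mono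
    (by omega) (by omega) fun _ _ _ h => h
  rintro m₂ ⟨o2, h2⟩
  refine (Impl.memberQuery_then (T := b.cnt * T' + n * 5 + 14) (Q := b.cnt * (R * 7) + 1) ?_)
  rw [h2.readString]
  set m₃ := m₂.write 21 (Expr.eval m₂ (.lit 0)) (f (restr b.own u)).toNat with hm₃
  have o3 : Off [2, 15, 16, 21] m m₃ :=
    (o1.trans o2 (C := [2, 15, 16, 21]) (by simp) (by simp)).write (by decide) _ _
  have u3 : Holds m₃ 15 u := (u1.off o2 (by decide)).congr (write_of_ne _ _ _ (by decide))
  have e21 : m₃ 21 0 = (f (restr b.own u)).toNat := by simp [hm₃, write_apply, Expr.eval]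
  refine (Impl.then (det_strMap_holds (a := 17) (x := fun _ => false) (by decide) (by decide)
    (hE.congr o3 (by decide)).n_eq fun i m' _ _ _ => rfl) (T₂ := b.cnt * T' + 9)
    (Q₂ := b.cnt * (R * 7) + 1) ?_).mono (by omega) (by omega) fun _ _ _ h => h
  rintro m₄ ⟨o4, h4⟩
  refine Impl.assign_then (T := b.cnt * T' + 7) ?_
  set m₅ := m₄.write 32 (Expr.eval m₄ (.lit 0)) (Expr.eval m₄ (.lit 0)) with hm₅
  have o45 : Off [2, 17, 32] m₃ m₅ :=
    (o4.mono (by simp)).write (by decide) _ _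
  have o5 : Off [2, 15, 16, 17, 21, 32] m m₅ := o3.trans o45 (by simp) (by simp)
  have u5 : Holds m₅ 15 u := u3.off o45 (by decide)
  have e21' : m₅ 21 0 = (f (restr b.own u)).toNat := by rw [o45 21 (by decide), e21]
  unfold PMF.map
  refine (Impl.seq (Impl.forLoop (N := b.cnt) (T := R * (n * 47 + 60) + n * 5 + 20) (Q := R * 7)
    (F := blockStep f R b u) (b := (c, fun _ => false))
    (I := fun j s m' => Off [2, 16, 17, 18, 19, 20, 25, 26, 30, 31, 32, 33] m₅ m' ∧
      (m' 25 0 ≠ 0 ↔ s.1 = true) ∧ Holds m' 17 s.2 ∧ m' 32 0 = j * n) ?_ ?_ ?_ ⟨Off.refl _ _, ?_, ?_,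
      ?_⟩) (T₂ := 3) (Q₂ := 1) ?_).mono (le_of_eq (by rw [hT'])) (by omega) fun _ _ _ h => h
  · rintro j s m' ⟨h, -⟩
    simp only [Expr.eval, h 13 (by decide), o5 13 (by decide), hR.cnt_eq]
  · rintro j s m' v ⟨h, h1, h2, h3⟩
    exact ⟨h.write (by decide) _ _, by rwa [write_of_ne _ _ _ (by decide)],
      h2.congr (write_of_ne _ _ _ (by decide)), by rwa [write_of_ne _ _ _ (by decide)]⟩
  · rintro j s m' hj ⟨h, h1, h2, h3⟩ h4
    have E5 := (hE.congr o5 (by decide)).congr h (by decide)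
    refine (impl_blockProg (s := s) ⟨E5.n_eq, (hR.congr o5 (by decide)).congr h (by decide), hj, h4,
      h3, u5.off h (by decide)⟩ E5.R_eq h1 h2).mono le_rfl le_rfl ?_
    rintro s' - m'' ⟨h5, h6, h7, h8⟩
    exact ⟨by rw [h5 30 (by decide), h4], h.trans h5 (by simp) (by simp), h6, h7, h8⟩
  · rw [o5 25 (by decide)]; exact hc
  · exact h4.congr (write_of_ne _ _ _ (by decide))
  · simp [hm₅, write_apply, Expr.eval]
  · rintro s - m₆ ⟨o6, h6, h7, -⟩
    refine Impl.memberQuery_then (T := 1) (Q := 0) ?_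
    rw [h7.readString]
    set m₇ := m₆.write 22 (Expr.eval m₆ (.lit 0)) (f s.2).toNat with hm₇
    have o7 : Off [2, 15, 16, 17, 18, 19, 20, 21, 22, 25, 26, 30, 31, 32, 33] m m₇ :=
      (o5.trans o6 (by simp) (by simp)).write (by decide) _ _
    refine Impl.assign ⟨o7.write (by decide) _ _, ?_⟩
    have e : Expr.eval m₇ (dist (var 21) (var 22)) = (f (restr b.own u) ^^ f s.2).toNat := by
      refine eval_dist_bool ?_ ?_
      · simp only [Expr.eval, hm₇]
        rw [write_of_ne _ _ _ (by decide), o6 21 (by decide), e21']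
      · simp [hm₇, write_apply, Expr.eval]
    have e2 : (m₇.write 25 (Expr.eval m₇ (.lit 0)) (Expr.eval m₇ (.add (var 25)
        (dist (var 21) (var 22))))) 25 0 = m₆ 25 0 + (f (restr b.own u) ^^ f s.2).toNat := by
      rw [← e]
      simp [hm₇, write_apply, Expr.eval]
    rw [e2, Bool.or_eq_true, ← h6]
    cases f (restr b.own u) <;> cases f s.2 <;> simp

/-- The verification. -/
def verifyProg : Program :=
  .seq (.assign 25 (.lit 0) (.sub (var 13) (.get 0 (.lit 1)))) (forLoop 28 (var 8) sampleProg)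

theorem impl_verifyProg (hE : Env n k L R M lab m) (hR : Rep b m) (hb : b.cnt ≤ k + 1) :
    Impl f D S verifyProg m
      (M * ((k + 1) * (R * (n * 47 + 60) + n * 5 + 23) + n * 10 + 33) + 5)
      (M * ((k + 1) * (R * 7) + 3)) (verify f D R M k b) fun c m' =>
        (m' 25 0 ≠ 0 ↔ c = true) := by
  unfold verifyProg verify
  refine Impl.assign_then ?_
  -- The truncated difference `cnt - k` is nonzero exactly when too many blocks were found, so
  -- rejection is recorded before any sample is drawn.
  set m₀ := m.write 25 (Expr.eval m (.lit 0)) (Expr.eval m (.sub (var 13) (.get 0 (.lit 1))))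
    with hm₀
  have o0 : Off [25] m m₀ := (Off.refl _ _).write (by decide) _ _
  refine (Impl.forLoop (N := M)
    (T := (k + 1) * (R * (n * 47 + 60) + n * 5 + 23) + n * 10 + 30) (Q := (k + 1) * (R * 7) + 3)
    (I := fun _ c m' => Env n k L R M lab m' ∧ Rep b m' ∧ (m' 25 0 ≠ 0 ↔ c = true)) ?_ ?_ ?_
    ⟨hE.congr o0 (by decide), hR.congr o0 (by decide), ?_⟩).mono le_rfl le_rfl
    fun _ _ _ h => h.2.2
  · rintro j s m' ⟨h, -⟩
    exact h.M_eq
  · rintro j s m' v ⟨h1, h2, h3⟩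
    have o : Off [28] m' (m'.write 28 0 v) := (Off.refl _ _).write (by decide) _ _
    exact ⟨h1.congr o (by decide), h2.congr o (by decide), by rwa [o 25 (by decide)]⟩
  · rintro j c m' - ⟨h1, h2, h3⟩ h4
    refine (impl_sampleProg h1 h2 hb h3).mono le_rfl le_rfl ?_
    rintro c' - m'' ⟨o, h⟩
    exact ⟨by rw [o 28 (by decide), h4], h1.congr o (by decide), h2.congr o (by decide), h⟩
  · simp [hm₀, write_apply, Expr.eval, hR.cnt_eq, hE.k_eq, Nat.sub_eq_zero_iff_le]

end Verify

end JuntaTesting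

/-! ### The complete program, its parameters and its cost. -/

namespace JuntaTesting

open scoped ENNReal

section Main

variable {n k L R M N t c num den : ℕ} {lab : ℕ → ℕ} {f : Cube n → Bool} {D : PMF (Cube n)}
  {S : Set Config} {m m' : Memory}

/-! ### Labels -/

/-- The choice of the labels. -/
def labelProg : Program :=
  forLoop 27 (var 0) (.seq (.assign 35 (.lit 0) (.lit 0))
    (.seq (forLoop 29 (var 5) (.seq (.coin 34 (.lit 0))
      (.assign 35 (.lit 0) (.add (.add (var 35) (var 35)) (var 34)))))
    (.assign 10 (var 27) (var 35))))

theorem impl_labelProg (hn : m 0 0 = n) (hL : m 5 0 = L) :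
    Impl f D S labelProg m (n * (L * 6 + 10) + 3) 0 (labels n L) fun lab m' =>
      Off [10, 27, 29, 34, 35] m m' ∧ ∀ i < n, m' 10 i = lab i := by
  unfold labelProg labels
  refine (Impl.forLoop (N := n) (T := L * 6 + 7) (Q := 0) (I := fun j lab m' =>
    Off [10, 27, 29, 34, 35] m m' ∧ ∀ i < j, m' 10 i = lab i) ?_ ?_ ?_
    ⟨Off.refl _ _, by simp⟩).mono le_rfl (by omega) fun _ _ _ h => h
  · rintro j lab m' ⟨h, -⟩
    simp only [Expr.eval, h 0 (by decide), hn]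
  · rintro j lab m' v ⟨h1, h2⟩
    exact ⟨h1.write (by decide) _ _, by rwa [write_of_ne _ _ _ (by decide)]⟩
  · rintro j lab m₁ hj ⟨h1, h2⟩ h3
    refine Impl.assign_then (T := L * 6 + 5) ?_
    set m₂ := m₁.write 35 (Expr.eval m₁ (.lit 0)) (Expr.eval m₁ (.lit 0)) with hm₂
    have o2 : Off [29, 34, 35] m₁ m₂ := (Off.refl _ _).write (by decide) _ _
    have hcoins := Impl.forLoop (f := f) (D := D) (S := S) (c := 29) (e := var 5) (m := m₂) (b := 0)
      (P := .seq (.coin 34 (.lit 0)) (.assign 35 (.lit 0) (.add (.add (var 35) (var 35)) (var 34))))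
      (N := L) (T := 3) (Q := 0) (F := fun _ c => (unif Bool).map fun r => c + c + r.toNat)
      (I := fun _ c m' => Off [29, 34, 35] m₁ m' ∧ m' 35 0 = c) ?_ ?_ ?_
      ⟨o2, by simp [hm₂, write_apply, Expr.eval]⟩
    · refine (Impl.seq (κ := fun c => PMF.pure (Function.update lab j c)) hcoins
        (T₂ := 1) (Q₂ := 0) ?_).mono (by omega) (by omega) fun _ _ _ h => h
      rintro c - m' ⟨h4, h5⟩
      refine Impl.assign ⟨?_, (h1.trans h4 (by simp) (by simp)).write (by decide) _ _,
        fun i hi => ?_⟩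
      · rw [write_of_ne _ _ _ (by decide), h4 27 (by decide), h3]
      · rw [write_apply]
        simp only [Expr.eval, h4 27 (by decide), h3, h5]
        by_cases hij : i = j
        · simp [hij]
        · simp only [hij, and_false, if_false, Function.update_of_ne hij, h4 10 (by decide)]
          exact h2 i (by omega)
    · rintro i c m' ⟨h, -⟩
      simp only [Expr.eval, h 5 (by decide), h1 5 (by decide), hL]
    · rintro i c m' v ⟨h, h'⟩
      exact ⟨h.write (by decide) _ _, by rwa [write_of_ne _ _ _ (by decide)]⟩
    · rintro i c m' - ⟨h, h'⟩ h4
      unfold PMF.map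
      refine (Impl.seq (Impl.coin (m := m') (a := 34) (i := .lit 0)
        (R := fun r m'' => m'' = m'.write 34 0 r.toNat) fun r => rfl) (T₂ := 1) (Q₂ := 0) ?_).mono
        (by omega) (by omega) fun _ _ _ h => h
      rintro r - m'' rfl
      refine Impl.assign ⟨?_, (h.write (by decide) _ _).write (by decide) _ _, ?_⟩
      · simp [write_apply, h4]
      · simp [write_apply, Expr.eval, h']

/-! ### Parameters -/

/-- The computation of the parameters. -/
def setupProg : Program :=
  .seq (.loop (.sub (.get 0 (.lit 3)) (var 9))
    (.seq (.assign 9 (.lit 0) (.add (var 9) (.get 0 (.lit 2))))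
      (.assign 3 (.lit 0) (.add (var 3) (.lit 1)))))
  (.seq (.assign 4 (.lit 0) (.lit 4))
  (.seq (.assign 9 (.lit 0) (.lit 1))
  (.seq (.loop (.sub (.add (.get 0 (.lit 1)) (.lit 1)) (var 9))
    (.seq (.assign 9 (.lit 0) (.add (var 9) (var 9)))
      (.assign 4 (.lit 0) (.add (var 4) (.lit 1)))))
  (.seq (.assign 5 (.lit 0) (.add (var 4) (var 4)))
  (.seq (.assign 6 (.lit 0) (.lit 1))
  (.seq (forLoop 29 (var 5) (.assign 6 (.lit 0) (.add (var 6) (var 6))))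
  (.seq (.assign 7 (.lit 0) (.add (var 5) (var 5)))
  (.seq (.assign 7 (.lit 0) (.add (var 7) (var 7)))
  (forLoop 29 (var 3) (.assign 8 (.lit 0) (.add (var 8) (.add (var 5) (var 5)))))))))))))

/-- Without multiplication and division the parameters come from counting: `hN` and `hc` say that
the two loop tests fail first after `N` and `c` rounds, so `N = ⌈den / num⌉` and `c = ⌈log₂ (k +
1)⌉`. The products `2t`, `8t` and `4Nt` are built by repeated addition. -/
theorem det_setupProg (hk : m 0 1 = k) (hnum : m 0 2 = num) (hden : m 0 3 = den)
    (hz : ∀ a ≠ 0, ∀ i, m a i = 0) (hN : ∀ j, j * num < den ↔ j < N)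
    (hc : ∀ j, 2 ^ j < k + 1 ↔ j < c) (ht : t = 4 + c) :
    Det f D S setupProg m (N * 9 + c * 5 + t * 8 + 30) 0 fun m' =>
      Off [3, 4, 5, 6, 7, 8, 9, 29] m m' ∧ m' 5 0 = 2 * t ∧ m' 6 0 = 2 ^ (2 * t) ∧
      m' 7 0 = 8 * t ∧ m' 8 0 = 4 * N * t := by
  unfold setupProg
  -- The invariant is indexed by the number `j` of rounds still to come; `i` counts those done.
  refine (Impl.then (Det.while (T := 3) (Q := 0) (I := fun j m' => Off [3, 9] m m' ∧
    ∃ i, i + j = N ∧ m' 3 0 = i ∧ m' 9 0 = i * num) ?_ ?_ N m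
    ⟨Off.refl _ _, 0, by omega, hz 3 (by decide) 0, by simp [hz 9 (by decide) 0]⟩)
    (T₂ := N * 4 + c * 5 + t * 8 + 28) (Q₂ := 0) ?_).mono (by omega) (by omega) fun _ _ _ h => h
  · rintro j m' ⟨h1, i, h2, h3, h4⟩
    refine ⟨?_, Impl.assign_then (T := 1) (Impl.assign ⟨?_, i + 1, by omega, ?_, ?_⟩)⟩
    · have := (hN i).2 (by omega)
      simp only [Expr.eval, h1 0 (by decide), hden, h4]
      omega
    · exact (h1.write (by decide) _ _).write (by decide) _ _
    · simp [write_apply, Expr.eval, h3]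
    · simp [write_apply, Expr.eval, h4, h1 0 (by decide), hnum, add_mul]
  · rintro m' ⟨h1, i, h2, h3, h4⟩
    have := (hN i).not.2 (by omega)
    simp only [Expr.eval, h1 0 (by decide), hden, h4]
    omega
  rintro m₁ ⟨o1, i, hi, v3, -⟩
  obtain rfl : i = N := by omega
  refine Impl.assign_then (T := i * 4 + c * 5 + t * 8 + 26)
    (Impl.assign_then (T := i * 4 + c * 5 + t * 8 + 24) ?_)
  set m₂ := (m₁.write 4 (Expr.eval m₁ (.lit 0)) (Expr.eval m₁ (.lit 4))).write 9
    (Expr.eval (m₁.write 4 (Expr.eval m₁ (.lit 0)) (Expr.eval m₁ (.lit 4))) (.lit 0))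
    (Expr.eval (m₁.write 4 (Expr.eval m₁ (.lit 0)) (Expr.eval m₁ (.lit 4))) (.lit 1)) with hm₂
  have o2 : Off [3, 4, 9] m m₂ :=
    ((o1.mono (by simp)).write (by decide) _ _).write (by decide) _ _
  have v3' : m₂ 3 0 = i := by
    rw [hm₂, write_of_ne _ _ _ (by decide), write_of_ne _ _ _ (by decide), v3]
  refine (Impl.then (Det.while (T := 3) (Q := 0) (I := fun j m' => Off [3, 4, 9] m m' ∧
    m' 3 0 = i ∧ ∃ d, d + j = c ∧ m' 4 0 = 4 + d ∧ m' 9 0 = 2 ^ d) ?_ ?_ c m₂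
    ⟨o2, v3', 0, by omega, by simp [hm₂, write_apply, Expr.eval],
      by simp [hm₂, write_apply, Expr.eval]⟩)
    (T₂ := i * 4 + t * 8 + 22) (Q₂ := 0) ?_).mono (by omega) (by omega) fun _ _ _ h => h
  · rintro j m' ⟨h1, h0, d, h2, h3, h4⟩
    refine ⟨?_, Impl.assign_then (T := 1) (Impl.assign ⟨?_, ?_, d + 1, by omega, ?_, ?_⟩)⟩
    · have := (hc d).2 (by omega)
      simp only [Expr.eval, h1 0 (by decide), hk, h4]
      omega
    · exact (h1.write (by decide) _ _).write (by decide) _ _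
    · simp [write_apply, h0]
    · simp [write_apply, Expr.eval, h3, add_assoc]
    · simp [write_apply, Expr.eval, h4, pow_succ, mul_two]
  · rintro m' ⟨h1, -, d, h2, h3, h4⟩
    have := (hc d).not.2 (by omega)
    simp only [Expr.eval, h1 0 (by decide), hk, h4]
    omega
  rintro m₃ ⟨o3, w3, d, hd, v4, -⟩
  obtain rfl : d = c := by omega
  rw [← ht] at v4
  refine Impl.assign_then (T := i * 4 + t * 8 + 20)
    (Impl.assign_then (T := i * 4 + t * 8 + 18) ?_)
  set m₄ := (m₃.write 5 (Expr.eval m₃ (.lit 0)) (Expr.eval m₃ (.add (var 4) (var 4)))).write 6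
    (Expr.eval (m₃.write 5 (Expr.eval m₃ (.lit 0)) (Expr.eval m₃ (.add (var 4) (var 4)))) (.lit 0))
    (Expr.eval (m₃.write 5 (Expr.eval m₃ (.lit 0)) (Expr.eval m₃ (.add (var 4) (var 4)))) (.lit 1))
    with hm₄
  have o4 : Off [3, 4, 5, 6, 9, 29] m m₄ :=
    ((o3.mono (by simp)).write (by decide) _ _).write (by decide) _ _
  have v5 : m₄ 5 0 = 2 * t := by
    simp [hm₄, write_apply, Expr.eval, v4, two_mul]
  have w3' : m₄ 3 0 = i := by
    rw [hm₄, write_of_ne _ _ _ (by decide), write_of_ne _ _ _ (by decide), w3]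
  refine (Impl.then (Det.forLoop (N := 2 * t) (T := 1) (Q := 0) (I := fun j m' =>
    Off [3, 4, 5, 6, 9, 29] m m' ∧ m' 3 0 = i ∧ m' 5 0 = 2 * t ∧ m' 6 0 = 2 ^ j) ?_ ?_ ?_
    ⟨o4, w3', v5, by simp [hm₄, write_apply, Expr.eval]⟩)
    (T₂ := i * 4 + 10) (Q₂ := 0) ?_).mono (by omega) (by omega) fun _ _ _ h => h
  · rintro j m' ⟨-, -, h, -⟩
    exact h
  · rintro j m' v ⟨h1, h2, h3, h4⟩
    exact ⟨h1.write (by decide) _ _, by rwa [write_of_ne _ _ _ (by decide)],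
      by rwa [write_of_ne _ _ _ (by decide)], by rwa [write_of_ne _ _ _ (by decide)]⟩
  · rintro j m' - ⟨h1, h2, h3, h4⟩ h5
    refine Impl.assign ⟨?_, h1.write (by decide) _ _, ?_, ?_, ?_⟩
    · simp [write_apply, h5]
    · simp [write_apply, h2]
    · simp [write_apply, h3]
    · simp [write_apply, Expr.eval, h4, pow_succ, mul_two]
  rintro m₅ ⟨o5, x3, x5, x6⟩
  refine (Impl.assign_then (T := i * 4 + 5) (Impl.assign_then (T := i * 4 + 3) ?_)).mono
    (by omega) le_rfl fun _ _ _ h => h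
  set m₆ := m₅.write 7 (Expr.eval m₅ (.lit 0)) (Expr.eval m₅ (.add (var 5) (var 5))) with hm₆
  set m₇ := m₆.write 7 (Expr.eval m₆ (.lit 0)) (Expr.eval m₆ (.add (var 7) (var 7))) with hm₇
  have o7 : Off [3, 4, 5, 6, 7, 8, 9, 29] m m₇ :=
    ((o5.mono (by simp)).write (by decide) _ _).write (by decide) _ _
  refine (Det.forLoop (N := i) (T := 1) (Q := 0) (I := fun j m' =>
    Off [3, 4, 5, 6, 7, 8, 9, 29] m m' ∧ m' 3 0 = i ∧ m' 5 0 = 2 * t ∧ m' 6 0 = 2 ^ (2 * t) ∧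
      m' 7 0 = 8 * t ∧ m' 8 0 = 4 * j * t) ?_ ?_ ?_
    ⟨o7, ?_, ?_, ?_, ?_, ?_⟩).mono (by omega) (by omega) fun _ _ _ h => ⟨h.1, h.2.2⟩
  · rintro j m' ⟨-, h, -⟩
    exact h
  · rintro j m' v ⟨h1, h2, h3, h4, h5, h6⟩
    exact ⟨h1.write (by decide) _ _, by rwa [write_of_ne _ _ _ (by decide)],
      by rwa [write_of_ne _ _ _ (by decide)], by rwa [write_of_ne _ _ _ (by decide)],
      by rwa [write_of_ne _ _ _ (by decide)], by rwa [write_of_ne _ _ _ (by decide)]⟩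
  · rintro j m' - ⟨h1, h2, h3, h4, h5, h6⟩ h7
    refine Impl.assign ⟨?_, h1.write (by decide) _ _, ?_, ?_, ?_, ?_, ?_⟩
    · simp [write_apply, h7]
    · simp [write_apply, h2]
    · simp [write_apply, h3]
    · simp [write_apply, h4]
    · simp [write_apply, h5]
    · simp only [write_apply, Expr.eval, h3, h6, and_self, if_true]
      ring
  · simp [hm₇, hm₆, write_apply, x3]
  · simp [hm₇, hm₆, write_apply, x5]
  · simp [hm₇, hm₆, write_apply, x6]
  · simp only [hm₇, hm₆, write_apply, Expr.eval, x5, and_self, if_true]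
    ring
  · rw [hm₇, hm₆, write_of_ne _ _ _ (by decide), write_of_ne _ _ _ (by decide), o5 8 (by decide),
      hz 8 (by decide)]
    ring

/-! ### The tester -/

/-- The tester, for `k < n` and a distance parameter of at most `1`. -/
def coreProg : Program :=
  .seq setupProg (.seq labelProg (.seq searchProg (.seq verifyProg
    (.assign 1 (.lit 0) (.sub (.lit 1) (var 25))))))

/-- The number of steps of the tester. -/
def coreTime (n k L R M N c t : ℕ) : ℕ :=
  (N * 9 + c * 5 + t * 8 + 30) + (n * (L * 6 + 10) + 3) +
    ((k + 1) * (M * (L * (n * 5 + 13) + n * 15 + 46) + 6) + 3) +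
    (M * ((k + 1) * (R * (n * 47 + 60) + n * 5 + 23) + n * 10 + 33) + 5) + 5

/-- The number of queries of the tester. -/
def coreQueries (k L R M : ℕ) : ℕ := (k + 1) * (M * (L + 3)) + M * ((k + 1) * (R * 7) + 3)

theorem search_cnt_le {s : Blocks n} (h : s ∈ (search f D lab L M k).support) :
    s.cnt ≤ k + 1 := by
  have := iter_support (I := fun j s => s.cnt ≤ j) (fun j s hj hs s' hs' => by
    refine iter_support (I := fun _ s => s.cnt ≤ j + 1) ?_ (by omega) s' hs'
    intro _ s _ hs s' hs'
    rcases tryStep_support hs' with rfl | ⟨h1, u, -, rfl⟩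
    · exact hs
    · simp [extend, h1]) (by simp) s h
  omega

theorem impl_coreProg (hn : m 0 0 = n) (hk : m 0 1 = k) (hnum : m 0 2 = num) (hden : m 0 3 = den)
    (hz : ∀ a ≠ 0, ∀ i, m a i = 0) (hN : ∀ j, j * num < den ↔ j < N)
    (hc : ∀ j, 2 ^ j < k + 1 ↔ j < c) (ht : t = 4 + c) :
    Impl f D S coreProg m (coreTime n k (2 * t) (8 * t) (4 * N * t) N c t)
      (coreQueries k (2 * t) (8 * t) (4 * N * t)) (process f D (2 * t) (8 * t) (4 * N * t) k)
      fun x m' => m' 1 0 ≠ 0 ↔ x = false := by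
  unfold coreProg process coreTime coreQueries
  generalize hTs : (k + 1) * (4 * N * t * (2 * t * (n * 5 + 13) + n * 15 + 46) + 6) + 3 = Ts
  generalize hTv : 4 * N * t * ((k + 1) * (8 * t * (n * 47 + 60) + n * 5 + 23) + n * 10 + 33) + 5
    = Tv
  generalize hQs : (k + 1) * (4 * N * t * (2 * t + 3)) = Qs
  generalize hQv : 4 * N * t * ((k + 1) * (8 * t * 7) + 3) = Qv
  refine (Impl.then (det_setupProg hk hnum hden hz hN hc ht)
    (T₂ := n * (2 * t * 6 + 10) + 3 + Ts + Tv + 4) (Q₂ := Qs + Qv) ?_).mono (by omega) (by omega)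
    fun _ _ _ h => h
  rintro m₁ ⟨o1, h5, h6, h7, h8⟩
  refine (Impl.seq (impl_labelProg (by rw [o1 0 (by decide), hn]) h5)
    (T₂ := Ts + Tv + 3) (Q₂ := Qs + Qv) ?_).mono (by omega) (by omega) fun _ _ _ h => h
  rintro lab - m₂ ⟨o2, h10⟩
  have o : Off [3, 4, 5, 6, 7, 8, 9, 10, 27, 29, 34, 35] m m₂ := o1.trans o2 (by simp) (by simp)
  have hE : Env n k (2 * t) (8 * t) (4 * N * t) lab m₂ :=
    ⟨by rw [o 0 (by decide), hn], by rw [o 0 (by decide), hk], by rw [o2 5 (by decide), h5],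
      by rw [o2 6 (by decide), h6], by rw [o2 7 (by decide), h7], by rw [o2 8 (by decide), h8], h10⟩
  have hR : Rep (⟨fun _ => 0, fun _ _ => false, 0⟩ : Blocks n) m₂ :=
    ⟨fun i => by rw [o 11 (by decide), hz _ (by decide)], fun ℓ hℓ => absurd hℓ (by simp),
      by rw [o 13 (by decide), hz _ (by decide)],
      by rw [o 14 (by decide), hz _ (by decide)]; simp⟩
  refine (Impl.seq (impl_searchProg hE hR) (T₂ := Tv + 2) (Q₂ := Qv) ?_).mono (by omega) (by omega)
    fun _ _ _ h => h
  rintro b hb m₃ ⟨hE3, hR3⟩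
  rw [← PMF.bind_pure (verify f D (8 * t) (4 * N * t) k b)]
  refine (Impl.seq (impl_verifyProg hE3 hR3 (search_cnt_le hb)) (T₂ := 1) (Q₂ := 0) ?_).mono
    (by omega) (by omega) fun _ _ _ h => h
  rintro x - m₄ h
  refine Impl.assign ?_
  have : (m₄.write 1 (Expr.eval m₄ (.lit 0)) (Expr.eval m₄ (.sub (.lit 1) (var 25)))) 1 0 =
      1 - m₄ 25 0 := by simp [write_apply, Expr.eval]
  rw [this]
  cases x
  · have h0 : ¬ m₄ 25 0 ≠ 0 := fun h' => by simpa using h.1 h'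
    simp; omega
  · have h0 := h.2 rfl
    simp; omega

/-- The tester. -/
def tester : Program :=
  .branch (.sub (var 0) (.get 0 (.lit 1)))
    (.branch (.sub (.get 0 (.lit 2)) (.get 0 (.lit 3))) (.assign 1 (.lit 0) (.lit 1)) coreProg)
    (.assign 1 (.lit 0) (.lit 1))

theorem Impl.good {β : Type} {P : Program} {T Q q : ℕ} {μ : PMF β} {A : β → Prop}
    (h : Impl f D S P m T Q μ fun x m' => A x → ∀ q, (⟨[], m', q⟩ : Config) ∈ S) :
    Good f D S ⟨[P], m, q⟩ T Q (pr μ A) := by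
  refine h [] q 0 0 _ fun x _ m' hm' q' => ⟨?_, ?_, ?_⟩
  · intro z' hz'
    simp only [run, PMF.mem_support_pure_iff] at hz'
    subst hz'; rfl
  · intro t z' hz'
    rw [run_halted f D (z := ⟨[], m', q'⟩) rfl, PMF.mem_support_pure_iff] at hz'
    subst hz'; simp
  · rw [run, pr_pure]
    unfold ind
    split_ifs with h1 h2
    · exact le_rfl
    · exact absurd (hm' h1 q') h2
    · exact bot_le
    · exact bot_le

/-- The guarantees on one input, from an implementation of a random process. -/
theorem guarantees_of_impl {P : Program} {n k : ℕ} {e : ℚ} {ε : ℝ} {T Q : ℕ}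
    (μ : (Cube n → Bool) → PMF (Cube n) → PMF Bool)
    (h : ∀ f D S, Impl f D S P (inputMemory n k e) T Q (μ f D) fun x m' => m' 1 0 ≠ 0 ↔ x = false)
    (hc : ∀ f D, f ∈ kJunta n k → pr (μ f D) (fun x => x = true) ≤ 1 / 3)
    (hs : ∀ f D, FarFrom D ε f (kJunta n k) → pr (μ f D) (fun x => x = false) ≤ 1 / 3) :
    IsJuntaTester P n k e ε ∧ HaltsWithin P n k e T ∧ ∀ B : ℝ, Q ≤ B → QueriesAtMost P n k e B := by
  -- The target set in `Impl` is arbitrary, so one implementation gives the bounds for acceptance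
  -- and for rejection.
  have acc : ∀ f D, Good f D {z | z.Accepting} (initConfig P n k e) T Q
      (pr (μ f D) fun x => x = false) := fun f D =>
    Impl.good ((h f D _).mono le_rfl le_rfl fun x _ m' hm' hx q => ⟨rfl, hm'.2 hx⟩)
  have rej : ∀ f D, Good f D {z | z.Rejecting} (initConfig P n k e) T Q
      (pr (μ f D) fun x => x = true) := fun f D =>
    Impl.good ((h f D _).mono le_rfl le_rfl fun x _ m' hm' hx q => ⟨rfl, by
      show m' 1 0 = 0
      by_contra hne
      rw [hm'.1 hne] at hx
      simp at hx⟩)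
  have twoThirds : ∀ {A B : ℝ≥0∞}, A + B = 1 → B ≤ 1 / 3 → 2 / 3 ≤ A := by
    intro A B hAB hB
    have h1 : (2 / 3 : ℝ≥0∞) + 1 / 3 ≤ A + 1 / 3 := by
      calc (2 / 3 : ℝ≥0∞) + 1 / 3 = 1 := by
            rw [← ENNReal.toReal_eq_toReal_iff' (by simp; finiteness) (by simp),
              ENNReal.toReal_add (by finiteness) (by simp)]
            norm_num
        _ = A + B := hAB.symm
        _ ≤ A + 1 / 3 := by gcongr
    exact (ENNReal.add_le_add_iff_right (by simp)).1 h1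
  have htot : ∀ f D, pr (μ f D) (fun x => x = false) + pr (μ f D) (fun x => x = true) = 1 := by
    intro f D
    rw [← pr_add_pr_not (μ f D) fun x => x = false]
    simp
  refine ⟨fun f D => ⟨fun hf => ?_, fun hf => ?_⟩, fun f D => (acc f D).halts,
    fun B hB f D t z hz => ?_⟩
  · refine (twoThirds (htot f D) (hc f D hf)).trans ((acc f D).prob.trans ?_)
    rw [pr_eq_toOuterMeasure]
    exact le_iSup (fun t => (run f D t (initConfig P n k e)).toOuterMeasure {z | z.Accepting}) T
  · refine (twoThirds ((add_comm _ _).trans (htot f D)) (hs f D hf)).trans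
      ((rej f D).prob.trans ?_)
    rw [pr_eq_toOuterMeasure]
    exact le_iSup (fun t => (run f D t (initConfig P n k e)).toOuterMeasure {z | z.Rejecting}) T
  · refine le_trans ?_ hB
    have := (acc f D).queries t z hz
    simp only [initConfig, zero_add] at this
    exact_mod_cast this

/-! ### Complexity -/

theorem coreTime_le {Z : ℕ} (hn : n ≤ Z) (hk : k + 1 ≤ Z) (hN : N ≤ Z) (hc : c ≤ Z) (ht : t ≤ Z) :
    coreTime n k (2 * t) (8 * t) (4 * N * t) N c t ≤ 10000 * Z ^ 6 := by
  have hZ : 1 ≤ Z := by omega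
  unfold coreTime
  have hZ2 : 1 ≤ Z ^ 2 := Nat.one_le_pow _ _ hZ
  have hZ3 : 1 ≤ Z ^ 3 := Nat.one_le_pow _ _ hZ
  calc _ ≤ (Z * 9 + Z * 5 + Z * 8 + 30 * Z) + (Z * (2 * Z * 6 + 10 * Z) + 3 * Z) +
        (Z * (4 * Z * Z * (2 * Z * (Z * 5 + 13 * Z) + Z * (15 * Z) + 46 * Z ^ 2) + 6 * Z) + 3 * Z) +
        (4 * Z * Z * (Z * (8 * Z * (Z * 47 + 60 * Z) + Z * (5 * Z) + 23 * Z ^ 2) + Z * (10 * Z ^ 2) +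
          33 * Z ^ 3) + 5 * Z) + 5 * Z := by
        gcongr <;> omega
    _ = 68 * Z + 22 * Z ^ 2 + 6 * Z ^ 2 + 388 * Z ^ 5 + 3708 * Z ^ 5 := by ring
    _ ≤ 10000 * Z ^ 6 := by
        have h1 : Z ≤ Z ^ 6 := Nat.le_self_pow (by norm_num) Z
        have h2 : Z ^ 2 ≤ Z ^ 6 := Nat.pow_le_pow_right hZ (by norm_num)
        have h5 : Z ^ 5 ≤ Z ^ 6 := Nat.pow_le_pow_right hZ (by norm_num)
        omega

theorem coreQueries_le (ht : 1 ≤ t) :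
    coreQueries k (2 * t) (8 * t) (4 * N * t) ≤ 256 * ((k + 1) * N * t ^ 2) := by
  unfold coreQueries
  have h1 : (k + 1) * (4 * N * t * (2 * t + 3)) ≤ (k + 1) * (4 * N * t * (5 * t)) := by
    gcongr; omega
  have h2 : 4 * N * t * ((k + 1) * (8 * t * 7) + 3) ≤
      -- The constant is `256 = 4·5 + 4·8·7 + 4·3`: search, dictator tests, and the remaining
      -- queries per sample.
      4 * N * t * ((k + 1) * (8 * t * 7) + 3 * ((k + 1) * t)) := by
    gcongr
    nlinarith
  calc _ ≤ _ := add_le_add h1 h2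
    _ = 256 * ((k + 1) * N * t ^ 2) := by ring

end Main

end JuntaTesting

/-! ### Guarantees of the tester on every kind of input. -/

namespace JuntaTesting

open scoped ENNReal

section Final

variable {n k : ℕ} {ε : ℝ} {e : ℚ}

theorem log_bound {t c : ℕ} {x : ℝ} (hx : (k : ℝ) / 2 ≤ x) (ht : t = 4 + c)
    (hc : ∀ j, 2 ^ j < k + 1 ↔ j < c) : (t : ℝ) ≤ 14 * Real.log (2 + x) := by
  have hk0 : (0 : ℝ) ≤ k := Nat.cast_nonneg k
  have hl2 := Real.log_two_gt_d9
  have hlog : Real.log 2 ≤ Real.log (2 + x) := Real.log_le_log (by norm_num) (by linarith)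
  rw [ht]
  push_cast
  rcases Nat.eq_zero_or_pos c with rfl | hc0
  · push_cast; linarith
  -- Minimality of `c` gives `2^{c-1} < k + 1 ≤ 2(2 + x)`, hence `t ≤ 5 + 4 log (2 + x)`; the `5` is
  -- absorbed since `log (2 + x) ≥ log 2 > 1/2`.
  · have h1 : 2 ^ (c - 1) < k + 1 := (hc _).2 (by omega)
    have h2 : (2 : ℝ) ^ (c - 1) ≤ 2 * (2 + x) := by
      have : ((2 ^ (c - 1) : ℕ) : ℝ) < ((k + 1 : ℕ) : ℝ) := by exact_mod_cast h1
      push_cast at this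
      linarith
    have h3 := Real.log_le_log (by positivity) h2
    rw [Real.log_pow, Real.log_mul (by norm_num) (by linarith), Nat.cast_sub hc0] at h3
    push_cast at h3
    have h4 : ((c : ℝ) - 1) * (1 / 2) ≤ ((c : ℝ) - 1) * Real.log 2 := by
      have : (1 : ℝ) ≤ c := by exact_mod_cast hc0
      gcongr; linarith
    linarith

theorem guarantees_of_accept {P : Program} (hfar : ∀ (f : Cube n → Bool) (D : PMF (Cube n)),
      ¬ FarFrom D ε f (kJunta n k))
    (h : ∀ (f : Cube n → Bool) (D : PMF (Cube n)) (S : Set Config),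
      Det f D S P (inputMemory n k e) 3 0 fun m' => m' 1 0 ≠ 0) :
    IsJuntaTester P n k e ε ∧ HaltsWithin P n k e 3 ∧ ∀ B : ℝ, 0 ≤ B → QueriesAtMost P n k e B := by
  have := guarantees_of_impl (P := P) (n := n) (k := k) (e := e) (ε := ε) (T := 3) (Q := 0)
    (fun _ _ => PMF.pure false) (fun f D S => (h f D S).of_det fun m' hm' => by simpa using hm')
    (fun f D _ => by simp [pr_pure, ind]) (fun f D hf => absurd hf (hfar f D))
  simpa using this

theorem not_farFrom_of_le (h : n ≤ k) (hε : 0 < ε) (f : Cube n → Bool) (D : PMF (Cube n)) :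
    ¬ FarFrom D ε f (kJunta n k) := by
  intro hf
  have h1 := hf f ⟨Finset.univ, by simpa using h, fun x y hxy => by
    rw [show x = y from funext fun i => hxy i (Finset.mem_univ i)]⟩
  simp at h1
  linarith

theorem not_farFrom_of_one_lt (hε : 1 < ε) (f : Cube n → Bool) (D : PMF (Cube n)) :
    ¬ FarFrom D ε f (kJunta n k) := by
  intro hf
  have h1 := hf (fun _ => false) ⟨∅, by simp, fun _ _ _ => rfl⟩
  rw [← pr_eq_toOuterMeasure] at h1
  have h2 := h1.trans (pr_le_one _ _)
  rw [ENNReal.ofReal_le_one] at h2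
  linarith

/-- Rounding `N` up keeps `1/N ≤ e ≤ ε`, so `ε`-far functions are `1/N`-far; `t = 4 + c` gives
`16(k+1) ≤ 2^t`. The two extra steps are the branches of `tester`. -/
theorem guarantees_core {N t c : ℕ} (hkn : k < n) (he0 : 0 < e) (he1 : e ≤ 1) (heε : (e : ℝ) ≤ ε)
    (hN : ∀ j, j * e.num.toNat < e.den ↔ j < N) (hc : ∀ j, 2 ^ j < k + 1 ↔ j < c)
    (ht : t = 4 + c) :
    IsJuntaTester tester n k e ε ∧
      HaltsWithin tester n k e (coreTime n k (2 * t) (8 * t) (4 * N * t) N c t + 2) ∧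
      ∀ B : ℝ, (coreQueries k (2 * t) (8 * t) (4 * N * t) : ℝ) ≤ B → QueriesAtMost tester n k e B := by
  have hnum : 0 < e.num := Rat.num_pos.2 he0
  have hnumden : e.num.toNat ≤ e.den := by
    have : e.num ≤ e.den := by
      have := Rat.num_div_den e
      have hd : (0 : ℚ) < e.den := by exact_mod_cast e.den_pos
      rw [← this, div_le_one hd] at he1
      exact_mod_cast he1
    omega
  have hN1 : 1 ≤ N := by
    have := (hN 0).1 (by simpa using e.den_pos)
    omega
  have hNε : ENNReal.ofReal ε ≥ (N : ℝ≥0∞)⁻¹ := by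
    have h1 : e.den ≤ N * e.num.toNat := by
      have := (hN N).not.2 (by omega)
      omega
    have h2 : (1 : ℝ) / N ≤ e := by
      rw [div_le_iff₀ (by exact_mod_cast hN1)]
      have h3 : (e : ℝ) = (e.num.toNat : ℝ) / e.den := by
        conv_lhs => rw [← Rat.num_div_den e]
        push_cast
        congr 1
        have : ((e.num.toNat : ℤ) : ℝ) = (e.num : ℝ) := by rw [Int.toNat_of_nonneg hnum.le]
        exact_mod_cast this.symm
      rw [h3, div_mul_eq_mul_div, le_div_iff₀ (by exact_mod_cast e.den_pos), one_mul, mul_comm]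
      exact_mod_cast h1
    have h4 : (N : ℝ≥0∞)⁻¹ = ENNReal.ofReal (1 / N) := by
      rw [one_div, ENNReal.ofReal_inv_of_pos (by exact_mod_cast hN1), ENNReal.ofReal_natCast]
    rw [h4]
    exact ENNReal.ofReal_le_ofReal (h2.trans heε)
  have hkt : 16 * (k + 1) ≤ 2 ^ t := by
    have := (hc c).not.2 (by omega)
    rw [ht, pow_add]
    omega
  have : Nonempty (Fin n) := ⟨⟨k, hkn⟩⟩
  refine guarantees_of_impl (fun f D => process f D (2 * t) (8 * t) (4 * N * t) k)
    (fun f D S => ?_) (fun f D hf => process_complete (by omega) rfl hkt hf)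
    (fun f D hf => process_sound hN1 (by omega) hkt rfl rfl fun g hg => ?_)
  · unfold tester
    refine Impl.branch (fun _ => Impl.branch (fun h => ?_) fun _ => ?_) (fun h => ?_)
    · exact absurd h (by simp [Expr.eval, inputMemory]; omega)
    · exact impl_coreProg rfl rfl rfl rfl (fun a ha i => by simp [inputMemory, ha]) hN hc ht
    · exact absurd h (by simp [Expr.eval, inputMemory]; omega)
  · rw [pr_eq_toOuterMeasure]
    exact hNε.le.trans (hf g hg)

end Final

end JuntaTesting

/-! ### Numerical bounds in terms of `ε`, and the conclusion. -/

namespace JuntaTesting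

section Final

variable {n k : ℕ} {ε : ℝ} {e : ℚ}

theorem mul_num_lt_den_iff (he : 0 < e) (j : ℕ) :
    j * e.num.toNat < e.den ↔ j < ⌈(1 / e : ℚ)⌉₊ := by
  have hnum : 0 < e.num := Rat.num_pos.2 he
  have hd : (0 : ℚ) < e.den := by exact_mod_cast e.den_pos
  have h : e * e.den = (e.num.toNat : ℚ) := by
    rw [Rat.mul_den_eq_num]
    have : ((e.num.toNat : ℤ) : ℚ) = e.num := by rw [Int.toNat_of_nonneg hnum.le]
    exact_mod_cast this.symm
  rw [Nat.lt_ceil, lt_div_iff₀ he, ← mul_lt_mul_iff_left₀ hd, mul_assoc, h, one_mul]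
  exact_mod_cast Iff.rfl

theorem time_bound {N c t : ℕ} (hkn : k < n) (hε : 0 < ε) (hN : (N : ℝ) ≤ 2 / ε + 1)
    (hc : ∀ j, 2 ^ j < k + 1 ↔ j < c) (ht : t = 4 + c) :
    ((coreTime n k (2 * t) (8 * t) (4 * N * t) N c t + 2 : ℕ) : ℝ) ≤
      10002 * 6 ^ 6 * ((n : ℝ) + 1 / ε + 1) ^ 6 := by
  have hck : c ≤ k + 1 := by
    by_contra! h
    have := (hc (k + 1)).2 h
    have := Nat.lt_two_pow_self (n := k + 1)
    omega
  -- As `k < n`, we have `c ≤ k + 1 ≤ n` and `t ≤ n + 4`, so `n + N + 4` dominates every parameter.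
  have h1 := coreTime_le (n := n) (k := k) (N := N) (c := c) (t := t) (Z := n + N + 4)
    (by omega) (by omega) (by omega) (by omega) (by omega)
  have h2 : 1 ≤ (n + N + 4) ^ 6 := Nat.one_le_pow _ _ (by omega)
  have h3 : coreTime n k (2 * t) (8 * t) (4 * N * t) N c t + 2 ≤ 10002 * (n + N + 4) ^ 6 := by omega
  have h4 : ((n + N + 4 : ℕ) : ℝ) ≤ 6 * ((n : ℝ) + 1 / ε + 1) := by
    push_cast
    have h5 : 2 / ε = 2 * (1 / ε) := by ring
    have h6 : 0 < 1 / ε := by positivity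
    have h7 : (0 : ℝ) ≤ n := Nat.cast_nonneg n
    linarith
  calc ((coreTime n k (2 * t) (8 * t) (4 * N * t) N c t + 2 : ℕ) : ℝ)
      ≤ ((10002 * (n + N + 4) ^ 6 : ℕ) : ℝ) := by exact_mod_cast h3
    _ = 10002 * ((n + N + 4 : ℕ) : ℝ) ^ 6 := by push_cast; ring
    _ ≤ 10002 * (6 * ((n : ℝ) + 1 / ε + 1)) ^ 6 := by gcongr
    _ = _ := by ring

theorem query_bound {N c t : ℕ} (hk : 1 ≤ k) (hε : 0 < ε) (hε2 : ε ≤ 2) (hN : (N : ℝ) ≤ 4 / ε)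
    (hc : ∀ j, 2 ^ j < k + 1 ↔ j < c) (ht : t = 4 + c) :
    (coreQueries k (2 * t) (8 * t) (4 * N * t) : ℝ) ≤
      401408 * ((k : ℝ) / ε) * Real.log (2 + (k : ℝ) / ε) ^ 2 := by
  have hk1 : (1 : ℝ) ≤ k := by exact_mod_cast hk
  have h1 : (t : ℝ) ≤ 14 * Real.log (2 + (k : ℝ) / ε) :=
    log_bound (by gcongr) ht hc
  calc (coreQueries k (2 * t) (8 * t) (4 * N * t) : ℝ)
      ≤ ((256 * ((k + 1) * N * t ^ 2) : ℕ) : ℝ) := by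
        exact_mod_cast coreQueries_le (by omega)
    _ = 256 * (((k : ℝ) + 1) * N * t ^ 2) := by push_cast; ring
    -- The factors are `k + 1 ≤ 2k`, `N ≤ 4/ε` and `t ≤ 14 log (2 + k/ε)`; the final constant is
    -- `256·2·4·14²`.
    _ ≤ 256 * ((2 * k : ℝ) * (4 / ε) * (14 * Real.log (2 + (k : ℝ) / ε)) ^ 2) := by
        gcongr
        linarith
    _ = _ := by ring

theorem det_tester_of_le {f : Cube n → Bool} {D : PMF (Cube n)} {S : Set Config} (h : n ≤ k) :
    Det f D S tester (inputMemory n k e) 3 0 fun m' => m' 1 0 ≠ 0 := by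
  unfold tester
  refine (Impl.branch (T := 2) (fun h' => ?_) (fun _ => ?_))
  · exact absurd h' (by simp [Expr.eval, inputMemory]; omega)
  · exact (Impl.assign (by simp [write_apply, Expr.eval])).mono (by omega) (by omega)
      fun _ _ _ h => h

theorem det_tester_of_one_lt {f : Cube n → Bool} {D : PMF (Cube n)} {S : Set Config}
    (h : k < n) (he : 1 < e) :
    Det f D S tester (inputMemory n k e) 3 0 fun m' => m' 1 0 ≠ 0 := by
  have hlt : e.den < e.num.toNat := by
    have : (e.den : ℤ) < e.num := by
      have hd : (0 : ℚ) < e.den := by exact_mod_cast e.den_pos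
      rw [← Rat.num_div_den e, lt_div_iff₀ hd, one_mul] at he
      exact_mod_cast he
    omega
  unfold tester
  refine (Impl.branch (T := 2) (fun _ => Impl.branch (T := 1) (fun _ => ?_) fun h' => ?_)
    fun h' => ?_)
  · exact Impl.assign (by simp [write_apply, Expr.eval])
  · exact absurd h' (by simp [Expr.eval, inputMemory]; omega)
  · exact absurd h' (by simp [Expr.eval, inputMemory]; omega)

end Final

end JuntaTesting

/-- One program `P` tests `k`-juntas for all `n`, `k ≥ 1`, `ε > 0`. Since an input is a finite
object, `ε` is handed to it as a rational `e` with `ε / 2 ≤ e ≤ ε` (`e = ε` when `ε` is rational).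
The time is polynomial in `n` and `1 / ε`, and the number of queries is
`Õ(k / ε) = O((k / ε) · polylog(k / ε))`, independently of `n`. -/
theorem mainTheorem3 :
    ∃ (P : JuntaTesting.Program) (A B : ℝ) (a b : ℕ),
      ∀ (n k : ℕ) (ε : ℝ) (e : ℚ), 1 ≤ k → 0 < ε → ε / 2 ≤ (e : ℝ) → (e : ℝ) ≤ ε →
        JuntaTesting.IsJuntaTester P n k e ε ∧
        (∃ T : ℕ, (T : ℝ) ≤ A * ((n : ℝ) + 1 / ε + 1) ^ a ∧
          JuntaTesting.HaltsWithin P n k e T) ∧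
        JuntaTesting.QueriesAtMost P n k e
          (B * ((k : ℝ) / ε) * Real.log (2 + (k : ℝ) / ε) ^ b) := by
  refine ⟨JuntaTesting.tester, 10002 * 6 ^ 6, 401408, 6, 2, fun n k ε e hk hε h1 h2 => ?_⟩
  have he : 0 < e := by
    have : (0 : ℝ) < e := by linarith
    exact_mod_cast this
  have hT : ((3 : ℕ) : ℝ) ≤ 10002 * 6 ^ 6 * ((n : ℝ) + 1 / ε + 1) ^ 6 := by
    have : (1 : ℝ) ≤ ((n : ℝ) + 1 / ε + 1) ^ 6 := one_le_pow₀ (by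
      have : 0 < 1 / ε := by positivity
      have : (0 : ℝ) ≤ n := Nat.cast_nonneg n
      linarith)
    push_cast
    linarith
  have hB : 0 ≤ 401408 * ((k : ℝ) / ε) * Real.log (2 + (k : ℝ) / ε) ^ 2 := by positivity
  rcases le_or_gt n k with hnk | hnk
  · obtain ⟨g1, g2, g3⟩ := JuntaTesting.guarantees_of_accept
      (JuntaTesting.not_farFrom_of_le hnk hε)
      fun f D S => JuntaTesting.det_tester_of_le (e := e) (f := f) (D := D) (S := S) hnk
    exact ⟨g1, ⟨3, hT, g2⟩, g3 _ hB⟩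
  rcases lt_or_ge 1 e with he1 | he1
  · have hε1 : 1 < ε := lt_of_lt_of_le (by exact_mod_cast he1) h2
    obtain ⟨g1, g2, g3⟩ := JuntaTesting.guarantees_of_accept
      (JuntaTesting.not_farFrom_of_one_lt hε1)
      fun f D S => JuntaTesting.det_tester_of_one_lt (f := f) (D := D) (S := S) hnk he1
    exact ⟨g1, ⟨3, hT, g2⟩, g3 _ hB⟩
  have hc : ∀ j, 2 ^ j < k + 1 ↔ j < Nat.clog 2 (k + 1) := fun j =>
    (Nat.lt_clog_iff_pow_lt one_lt_two).symm
  have he1' : (e : ℝ) ≤ 1 := by exact_mod_cast he1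
  have heR : (0 : ℝ) < e := by exact_mod_cast he
  have hinv : 1 / (e : ℝ) ≤ 2 / ε := by
    rw [div_le_div_iff₀ heR hε]
    linarith
  have hN : ((⌈(1 / e : ℚ)⌉₊ : ℕ) : ℝ) ≤ 2 / ε + 1 := by
    have : ((⌈(1 / e : ℚ)⌉₊ : ℕ) : ℚ) < 1 / e + 1 := Nat.ceil_lt_add_one (by positivity)
    have : ((⌈(1 / e : ℚ)⌉₊ : ℕ) : ℝ) < 1 / (e : ℝ) + 1 := by exact_mod_cast this
    linarith
  -- Here `e ≤ 1` forces `ε ≤ 2`, so the rounding error `1` is at most `2/ε`.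
  have hN' : ((⌈(1 / e : ℚ)⌉₊ : ℕ) : ℝ) ≤ 4 / ε := by
    have : 1 ≤ 2 / ε := by
      rw [le_div_iff₀ hε]
      linarith
    have h4 : 4 / ε = 2 / ε + 2 / ε := by ring
    linarith
  obtain ⟨g1, g2, g3⟩ := JuntaTesting.guarantees_core hnk he he1 h2
    (JuntaTesting.mul_num_lt_den_iff he) hc rfl
  exact ⟨g1, ⟨_, JuntaTesting.time_bound hnk hε hN hc rfl, g2⟩,
    g3 _ (JuntaTesting.query_bound hk hε (by linarith) hN' hc rfl)⟩
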